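/- Let $\Bbbk$ be a field of characteristic zero, let $t,a,b,d,k,\ell,p,q\in\Bbbk$, and let $V$ be the vector space with basis $x_1,x_2,x_3$ and braiding $c(x_i\otimes x_j)=\sum_{m,n\in\{1,2,3\}} r^{ij}_{mn}\,x_m\otimes x_n$, where $r^{ij}_{mn}$ is the entry in row $mn$ and column $ij$ of the matrix $$\mathfrak R_{1,7}=\left(\begin{array}{ccc|ccc|ccc} t & tk & tp & -tk & -tk\ell & td & ta & t(k(a-q)-d) & tb\\ 0 & t & 0 & 0 & -t\ell & t(p-q) & 0 & ta & 0\\ 0 & 0 & t & 0 & 0 & -tk & 0 & 0 & ta\\ \hline 0 & 0 & 0 & t & t\ell & tq & 0 & 0 & 0\\ 0 & 0 & 0 & 0 & t & 0 & 0 & 0 & 0\\ 0 & 0 & 0 & 0 & 0 & t & 0 & 0 & 0\\ \hline 0 & 0 & 0 & 0 & 0 & 0 & t & tk & tp\\ 0 & 0 & 0 & 0 & 0 & 0 & 0 & t & 0\\ 0 & 0 & 0 & 0 & 0 & 0 & 0 & 0 & t \end{array}\right),$$ whose rows are indexed by $11,12,13,21,22,23,31,32,33$ and whose columns are indexed by $11,21,31,12,22,32,13,23,33$.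 Let $\mathfrak B(V)=T(V)/\mathcal J(V)$ be the Nichols algebra of $(V,c)$, where $\mathcal J(V)$ is the largest homogeneous Hopf ideal, generated by homogeneous elements of degree $\ge 2$, of the braided Hopf algebra $T(V)$ in which the elements of $V$ are primitive. Then: (a) If $t=1$ and $a=p-2q$, then $$\mathcal J(V)=\langle x_2x_1-x_1x_2-k\,x_1^2,\ x_3x_1-x_1x_3-q\,x_1^2,\ x_3x_2-x_2x_3+k\,x_1x_3-q\,x_1x_2-(d+qk)\,x_1^2\rangle,$$ $B_3=\{x_1^{a_1}x_2^{a_2}x_3^{a_3}: a_i\ge 0\}$ is a basis of $\mathfrak B(V)$, and $\operatorname{GKdim}\mathfrak B(V)=3$. (b) If $t=-1$, $a=-p$ and $b\neq -p^2$, then $$\mathcal J(V)=\langle x_2x_1+x_1x_2,\ x_3x_1+x_1x_3,\ x_3x_2+x_2x_3-k\,x_1x_3-q\,x_1x_2,\ x_1^2,\ x_2^2-\ell\,x_1x_2\rangle,$$ $B_1=\{x_1^{a_1}x_2^{a_2}x_3^{a_3}: a_i\ge 0;\ a_1,a_2<2\}$ is a basis of $\mathfrak B(V)$, and $\operatorname{GKdim}\mathfrak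 B(V)=1$. (c) If $t=-1$, $a=-p$ and $b=-p^2$, then $$\mathcal J(V)=\langle x_2x_1+x_1x_2,\ x_3x_1+x_1x_3,\ x_3x_2+x_2x_3-k\,x_1x_3-q\,x_1x_2,\ x_1^2,\ x_2^2-\ell\,x_1x_2,\ x_3^2-p\,x_1x_3\rangle,$$ $B_0=\{x_1^{a_1}x_2^{a_2}x_3^{a_3}: 0\le a_i<2\}$ is a basis of $\mathfrak B(V)$, $\operatorname{GKdim}\mathfrak B(V)=0$ and $\dim\mathfrak B(V)=8$. -/

import Mathlib

open scoped TensorProduct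

noncomputable section

/-! ### Nichols algebras of braided vector spaces with a chosen basis

`X` is a finite set indexing a basis `(x_i)` of a vector space `V` over `𝕜`.  A map
`c : V ⊗ V → V ⊗ V` is given by its coefficients `r`, where `r i j m n` is the coefficient of
`x_m ⊗ x_n` in `c (x_i ⊗ x_j)`.  The tensor algebra `T(V)` is `FreeAlgebra 𝕜 X`. -/

namespace Nichols

variable {𝕜 : Type*} [Field 𝕜] {X : Type*} [Fintype X] [DecidableEq X]

/-- The extended braiding `c : V ⊗ T(V) → T(V) ⊗ V`, written as
`c (x_i ⊗ f) = ∑ l, (braidMatrix r f) i l ⊗ x_l`.  On generators it is `c`; the hexagon rule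
`c_{V, U ⊗ W} = (id_U ⊗ c_{V, W}) (c_{V, U} ⊗ id_W)` says that `f ↦ braidMatrix r f` is
multiplicative. -/
def braidMatrix (r : X → X → X → X → 𝕜) :
    FreeAlgebra 𝕜 X →ₐ[𝕜] Matrix X X (FreeAlgebra 𝕜 X) :=
  FreeAlgebra.lift 𝕜 fun j => Matrix.of fun i l => ∑ m, r i j m l • FreeAlgebra.ι 𝕜 m

/-- The `(i, l)` entry of `braidMatrix r`, as a linear endomorphism of `T(V)`. -/
def braidEntry (r : X → X → X → X → 𝕜) (i l : X) :
    FreeAlgebra 𝕜 X →ₗ[𝕜] FreeAlgebra 𝕜 X where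
  toFun f := braidMatrix r f i l
  map_add' f g := by simp
  map_smul' s f := by simp

/-- Left multiplication by `Δ (x_i) = x_i ⊗ 1 + 1 ⊗ x_i` in the braided tensor product algebra
`T(V) ⊗ T(V)`, whose product is `(mul ⊗ mul) (id ⊗ c ⊗ id)`:
`a ⊗ b ↦ x_i a ⊗ b + ∑ l, (braidMatrix r a) i l ⊗ x_l b`. -/
def comulStep (r : X → X → X → X → 𝕜) (i : X) :
    Module.End 𝕜 (FreeAlgebra 𝕜 X ⊗[𝕜] FreeAlgebra 𝕜 X) :=
  TensorProduct.map (LinearMap.mulLeft 𝕜 (FreeAlgebra.ι 𝕜 i)) LinearMap.id +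
    ∑ l, TensorProduct.map (braidEntry r i l) (LinearMap.mulLeft 𝕜 (FreeAlgebra.ι 𝕜 l))

/-- The braided comultiplication `Δ` of `T(V)`: the multiplicative map into the braided tensor
product algebra `T(V) ⊗ T(V)` for which the `x_i` are primitive, so that
`Δ (x_{i₁} ⋯ x_{iₙ}) = Δ (x_{i₁}) ⋯ Δ (x_{iₙ}) (1 ⊗ 1)`. -/
def comul (r : X → X → X → X → 𝕜) :
    FreeAlgebra 𝕜 X →ₗ[𝕜] FreeAlgebra 𝕜 X ⊗[𝕜] FreeAlgebra 𝕜 X where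
  toFun f := FreeAlgebra.lift 𝕜 (comulStep r) f (1 ⊗ₜ[𝕜] 1)
  map_add' f g := by simp
  map_smul' s f := by simp

/-- `g ↦ mul (c (S (x_i) ⊗ g)) = - ∑ l, (braidMatrix r g) i l * x_l`, where `S (x_i) = - x_i`. -/
def antipodeStep (r : X → X → X → X → 𝕜) (i : X) : Module.End 𝕜 (FreeAlgebra 𝕜 X) :=
  -∑ l, LinearMap.mulRight 𝕜 (FreeAlgebra.ι 𝕜 l) ∘ₗ braidEntry r i l

/-- The antipode `S` of the braided Hopf algebra `T(V)`: `S 1 = 1`, `S (x_i) = - x_i` and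
`S (x_i f) = mul (c (S (x_i) ⊗ S f))`. -/
def antipode (r : X → X → X → X → 𝕜) : FreeAlgebra 𝕜 X →ₗ[𝕜] FreeAlgebra 𝕜 X where
  toFun f := FreeAlgebra.lift 𝕜 (antipodeStep r) f 1
  map_add' f g := by simp
  map_smul' s f := by simp

variable (𝕜 X) in
/-- The homogeneous component `Tⁿ(V)` of the tensor algebra. -/
def degreePart (n : ℕ) : Submodule 𝕜 (FreeAlgebra 𝕜 X) :=
  Submodule.span 𝕜 (Set.range (FreeAlgebra.ι 𝕜 (X := X))) ^ n

/-- A homogeneous Hopf ideal of `T(V)` generated by homogeneous elements of degree `≥ 2`.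
The counit kills such an ideal automatically, as it kills every element of positive degree. -/
structure IsHopfIdeal (r : X → X → X → X → 𝕜) (I : TwoSidedIdeal (FreeAlgebra 𝕜 X)) :
    Prop where
  generated : ∃ S : Set (FreeAlgebra 𝕜 X),
    (∀ s ∈ S, ∃ n, 2 ≤ n ∧ s ∈ degreePart 𝕜 X n) ∧ I = TwoSidedIdeal.span S
  /-- `Δ(I) ⊆ I ⊗ T(V) + T(V) ⊗ I` -/
  comul_mem : ∀ f ∈ I, comul r f ∈
    Submodule.span 𝕜 {z | ∃ u v : FreeAlgebra 𝕜 X, (u ∈ I ∨ v ∈ I) ∧ z = u ⊗ₜ[𝕜] v}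
  antipode_mem : ∀ f ∈ I, antipode r f ∈ I

/-- The defining ideal `𝒥(V)` of the Nichols algebra: the largest homogeneous Hopf ideal of `T(V)`
generated by homogeneous elements of degree `≥ 2`. -/
def nicholsIdeal (r : X → X → X → X → 𝕜) : TwoSidedIdeal (FreeAlgebra 𝕜 X) :=
  sSup {I | IsHopfIdeal r I}

/-- Every element of a supremum of ideals is reached by sums of elements of the ideals. -/
theorem sSup_ideal_induction {R : Type*} [Ring R] {S : Set (TwoSidedIdeal R)} {P : R → Prop}
    (hmem : ∀ I ∈ S, ∀ f ∈ I, P f) (hzero : P 0) (hadd : ∀ f g, P f → P g → P (f + g))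
    {f : R} (hf : f ∈ sSup S) : P f := by
  let A : AddSubmonoid R := ⨆ I ∈ S, (TwoSidedIdeal.asIdeal I).toAddSubmonoid
  have hsub : ∀ I ∈ S, ∀ x ∈ I, x ∈ A := fun I hI x hx =>
    AddSubmonoid.mem_iSup_of_mem I (AddSubmonoid.mem_iSup_of_mem hI hx)
  have ind : ∀ (Q : R → Prop), (∀ I ∈ S, ∀ f ∈ I, Q f) → Q 0 →
      (∀ f g, Q f → Q g → Q (f + g)) → ∀ x ∈ A, Q x := by
    intro Q h1 h2 h3 x hx
    let B : AddSubmonoid R :=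
      { carrier := {y | Q y}, add_mem' := fun {a b} ha hb => h3 a b ha hb, zero_mem' := h2 }
    have hAB : A ≤ B := iSup₂_le fun I hI y hy => h1 I hI y hy
    exact hAB hx
  let K : TwoSidedIdeal R := TwoSidedIdeal.mk' {x | x ∈ A} A.zero_mem
    (fun {x y} hx hy => A.add_mem hx hy)
    (fun {x} hx => ind (fun y => -y ∈ A) (fun I hI y hy => hsub I hI _ (I.neg_mem hy))
      (by simp) (fun f g h1 h2 => by rw [neg_add]; exact A.add_mem h1 h2) x hx)
    (fun {x y} hy => ind (fun z => x * z ∈ A)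
      (fun I hI z hz => hsub I hI _ (I.mul_mem_left _ _ hz))
      (by simp) (fun f g h1 h2 => by rw [mul_add]; exact A.add_mem h1 h2) y hy)
    (fun {x y} hx => ind (fun z => z * y ∈ A)
      (fun I hI z hz => hsub I hI _ (I.mul_mem_right _ _ hz))
      (by simp) (fun f g h1 h2 => by rw [add_mul]; exact A.add_mem h1 h2) x hx)
  have hK : sSup S ≤ K := sSup_le fun I hI x hx => by
    rw [TwoSidedIdeal.mem_mk']; exact hsub I hI x hx
  have := hK hf
  rw [TwoSidedIdeal.mem_mk'] at this
  exact ind P hmem hzero hadd f this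

/-- `nicholsIdeal r` is indeed the greatest ideal of the required kind. -/
theorem nicholsIdeal_isGreatest (r : X → X → X → X → 𝕜) :
    IsGreatest {I | IsHopfIdeal r I} (nicholsIdeal r) := by
  refine ⟨⟨?_, ?_, ?_⟩, fun I hI => le_sSup hI⟩
  · refine ⟨{s | s ∈ nicholsIdeal r ∧ ∃ n, 2 ≤ n ∧ s ∈ degreePart 𝕜 X n}, fun s hs => hs.2,
      le_antisymm (sSup_le fun I hI => ?_) ?_⟩
    · obtain ⟨S, hS, rfl⟩ := hI.generated
      refine TwoSidedIdeal.span_mono fun s hs => ⟨?_, hS s hs⟩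
      exact (le_sSup hI : _ ≤ nicholsIdeal r) (TwoSidedIdeal.subset_span hs)
    · exact TwoSidedIdeal.span_le.2 fun s hs => hs.1
  · intro f hf
    refine sSup_ideal_induction (S := {I | IsHopfIdeal r I})
      (P := fun f => comul r f ∈ Submodule.span 𝕜 {z | ∃ u v : FreeAlgebra 𝕜 X,
        (u ∈ nicholsIdeal r ∨ v ∈ nicholsIdeal r) ∧ z = u ⊗ₜ[𝕜] v})
      (fun I hI f hf => ?_) (by rw [map_zero]; exact Submodule.zero_mem _)
      (fun f g h1 h2 => by rw [map_add]; exact Submodule.add_mem _ h1 h2) hf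
    refine Submodule.span_mono ?_ (hI.comul_mem f hf)
    rintro z ⟨u, v, huv, rfl⟩
    have hle : I ≤ nicholsIdeal r := le_sSup hI
    exact ⟨u, v, huv.imp (fun h => hle h) (fun h => hle h), rfl⟩
  · intro f hf
    refine sSup_ideal_induction (S := {I | IsHopfIdeal r I})
      (P := fun f => antipode r f ∈ nicholsIdeal r) (fun I hI f hf => ?_)
      (by rw [map_zero]; exact TwoSidedIdeal.zero_mem _)
      (fun f g h1 h2 => by rw [map_add]; exact TwoSidedIdeal.add_mem _ h1 h2) hf
    have hle : I ≤ nicholsIdeal r := le_sSup hI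
    exact hle (hI.antipode_mem f hf)

/-- The Nichols algebra `𝔅(V) = T(V) / 𝒥(V)`. -/
abbrev NicholsAlgebra (r : X → X → X → X → 𝕜) : Type _ := (nicholsIdeal r).ringCon.Quotient

/-- The image of `x_i` in the Nichols algebra. -/
def gen (r : X → X → X → X → 𝕜) (i : X) : NicholsAlgebra r :=
  (nicholsIdeal r).ringCon.mk' (FreeAlgebra.ι 𝕜 i)

/-- In rank three: the family `x₁^{e₁} x₂^{e₂} x₃^{e₃}`, `e ∈ E`, is a basis of `𝔅(V)`. -/
def IsMonomialBasis (r : Fin 3 → Fin 3 → Fin 3 → Fin 3 → 𝕜) (E : Set (Fin 3 → ℕ)) : Prop :=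
  ∃ β : Module.Basis E 𝕜 (NicholsAlgebra r),
    ∀ e : E, β e = gen r 0 ^ e.1 0 * gen r 1 ^ e.1 1 * gen r 2 ^ e.1 2

/-- Exponents of the family `B₀`. -/
def expB0 : Set (Fin 3 → ℕ) := {e | ∀ i, e i < 2}

/-- Exponents of the family `B₁`. -/
def expB1 : Set (Fin 3 → ℕ) := {e | e 0 < 2 ∧ e 1 < 2}

/-- Exponents of the family `B₃`. -/
def expB3 : Set (Fin 3 → ℕ) := Set.univ

end Nichols

/-- The Gelfand--Kirillov dimension of a `𝕜`-algebra `A`: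
`sup_W limsup_n log (dim (W⁰ + W¹ + ⋯ + Wⁿ)) / log n`, over the finite-dimensional subspaces `W`
of `A`. -/
def gkDim (𝕜 A : Type*) [Field 𝕜] [Ring A] [Algebra 𝕜 A] : EReal :=
  ⨆ (W : Submodule 𝕜 A) (_ : W.FG),
    Filter.limsup (fun n : ℕ =>
      ((Real.log (Module.finrank 𝕜 (⨆ i ≤ n, W ^ i : Submodule 𝕜 A)) / Real.log n : ℝ) : EReal))
      Filter.atTop

/-! ### The family `ℜ_{1,7}` -/

namespace R17

variable {𝕜 : Type*} [Field 𝕜]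

/-- The matrix `ℜ_{1,7}`.  Rows are indexed by `11, 12, 13, 21, 22, 23, 31, 32, 33` and columns by
`11, 21, 31, 12, 22, 32, 13, 23, 33`. -/
def RMatrix (t a b d k ℓ p q : 𝕜) : Matrix (Fin 9) (Fin 9) 𝕜 :=
  !![t, t*k, t*p, -(t*k), -(t*k*ℓ), t*d,       t*a, t*(k*(a - q) - d), t*b;
     0, t,   0,   0,      -(t*ℓ),   t*(p - q), 0,   t*a,               0;
     0, 0,   t,   0,      0,        -(t*k),    0,   0,                 t*a;
     0, 0,   0,   t,      t*ℓ,      t*q,       0,   0,                 0;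
     0, 0,   0,   0,      t,        0,         0,   0,                 0;
     0, 0,   0,   0,      0,        t,         0,   0,                 0;
     0, 0,   0,   0,      0,        0,         t,   t*k,               t*p;
     0, 0,   0,   0,      0,        0,         0,   t,                 0;
     0, 0,   0,   0,      0,        0,         0,   0,                 t]

/-- The braiding associated with `ℜ_{1,7}`: `c (x_i ⊗ x_j) = ∑ m n, r^{ij}_{mn} x_m ⊗ x_n`, where
`r^{ij}_{mn}` is the entry in row `mn` and column `ij` of the matrix (the indices are `0, 1, 2`
here). -/
def braiding (t a b d k ℓ p q : 𝕜) (i j m n : Fin 3) : 𝕜 :=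
  RMatrix t a b d k ℓ p q ⟨3 * m.1 + n.1, by omega⟩ ⟨i.1 + 3 * j.1, by omega⟩

variable (𝕜) in
/-- The generators of `T(V)`: `x₁ = x 𝕜 0`, `x₂ = x 𝕜 1`, `x₃ = x 𝕜 2`. -/
abbrev x (i : Fin 3) : FreeAlgebra 𝕜 (Fin 3) := FreeAlgebra.ι 𝕜 i

/-- `x₂x₁ - x₁x₂ - k x₁²`, `x₃x₁ - x₁x₃ - q x₁²`,
`x₃x₂ - x₂x₃ + k x₁x₃ - q x₁x₂ - (d + qk) x₁²`. -/
def relA (d k q : 𝕜) : Set (FreeAlgebra 𝕜 (Fin 3)) :=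
  {x 𝕜 1 * x 𝕜 0 - x 𝕜 0 * x 𝕜 1 - k • x 𝕜 0 ^ 2,
   x 𝕜 2 * x 𝕜 0 - x 𝕜 0 * x 𝕜 2 - q • x 𝕜 0 ^ 2,
   x 𝕜 2 * x 𝕜 1 - x 𝕜 1 * x 𝕜 2 + k • (x 𝕜 0 * x 𝕜 2) - q • (x 𝕜 0 * x 𝕜 1)
     - (d + q * k) • x 𝕜 0 ^ 2}

/-- `x₂x₁ + x₁x₂`, `x₃x₁ + x₁x₃`, `x₃x₂ + x₂x₃ - k x₁x₃ - q x₁x₂`, `x₁²`, `x₂² - ℓ x₁x₂`. -/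
def relB (k ℓ q : 𝕜) : Set (FreeAlgebra 𝕜 (Fin 3)) :=
  {x 𝕜 1 * x 𝕜 0 + x 𝕜 0 * x 𝕜 1,
   x 𝕜 2 * x 𝕜 0 + x 𝕜 0 * x 𝕜 2,
   x 𝕜 2 * x 𝕜 1 + x 𝕜 1 * x 𝕜 2 - k • (x 𝕜 0 * x 𝕜 2) - q • (x 𝕜 0 * x 𝕜 1),
   x 𝕜 0 ^ 2,
   x 𝕜 1 ^ 2 - ℓ • (x 𝕜 0 * x 𝕜 1)}

/-- The relations `relB` together with `x₃² - p x₁x₃`. -/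
def relC (k ℓ p q : 𝕜) : Set (FreeAlgebra 𝕜 (Fin 3)) :=
  relB k ℓ q ∪ {x 𝕜 2 ^ 2 - p • (x 𝕜 0 * x 𝕜 2)}

end R17

end

noncomputable section

set_option linter.unusedSectionVars false

namespace Nichols

variable {𝕜 : Type*} [Field 𝕜] {X : Type*} [Fintype X] [DecidableEq X]

/-! ### Quadratic Hopf ideals -/

/-! Write I for the ideal of the listed relations and J for the Nichols ideal. The relations span a
space W of quadratic tensors on which the braiding c acts by -1, and c carries V ⊗ W into W ⊗ V and
W ⊗ V into V ⊗ W. Such a W generates a Hopf ideal (`isHopfIdeal_span_quad`), so I ⊆ J by maximality.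
Straightening with the relations shows that the listed monomials span T(V)/I. If they are also
independent in T(V)/J, the surjection T(V)/I → T(V)/J is injective, so I = J and the monomials form
a basis (`nicholsIdeal_eq_of_orderedMonomial`). The Gelfand–Kirillov dimension is then the growth
rate of the set of exponents (`gkDim_eq_of_orderedMonomial`).

Independence comes from the skew derivations ∂_l, the components of Δ in T(V) ⊗ x_l. They descend to
T(V)/J because J is a Hopf ideal without linear part. The braiding is triangular: moving x_i past
anything never produces x_l with l > i. Hence ∂_l commutes with left multiplication by the
generators of smaller index (`der_gen_mul`), and exponents can be stripped off starting from the
last variable.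

For t = 1, ∂_l lowers powers of x_l with leading coefficients that are nonzero in characteristic
zero (`eq_zero_of_sum_mul_pow_eq_zero`). For t = -1 the question is the size of x₃². The element z =
x₃² - p x₁x₃ is killed by ∂₂ and ∂₃, while ∂₁ z = -(b + p²) x₁. If b = -p², z is a further relation.
Otherwise ∂₁² acts on powers of z as a nonzero multiple of d/dz, and all powers of z are independent
(`sqDefect_independent`). -/

/-- The quadratic element `∑ S i j x_i x_j` of `T(V)`. -/
def quad : Matrix X X 𝕜 →ₗ[𝕜] FreeAlgebra 𝕜 X where
  toFun S := ∑ i, ∑ j, S i j • (FreeAlgebra.ι 𝕜 i * FreeAlgebra.ι 𝕜 j)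
  map_add' S T := by simp [add_smul, Finset.sum_add_distrib]
  map_smul' s S := by simp [mul_smul, Finset.smul_sum]

theorem quad_apply (S : Matrix X X 𝕜) :
    quad S = ∑ i, ∑ j, S i j • (FreeAlgebra.ι 𝕜 i * FreeAlgebra.ι 𝕜 j) := rfl

/-- The coefficients of the braiding with the second input and the first output fixed. -/
def innerSlice (r : X → X → X → X → 𝕜) (n m : X) : Matrix X X 𝕜 := Matrix.of fun i l => r i n m l

/-- The coefficients of the braiding with the first input and the second output fixed. -/
def outerSlice (r : X → X → X → X → 𝕜) (i l : X) : Matrix X X 𝕜 := Matrix.of fun j m => r i j m l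

theorem braidMatrix_ι (r : X → X → X → X → 𝕜) (i j l : X) :
    braidMatrix r (FreeAlgebra.ι 𝕜 j) i l = ∑ m, r i j m l • FreeAlgebra.ι 𝕜 m := by
  simp [braidMatrix]

theorem quad_mul_mul (A S B : Matrix X X 𝕜) :
    quad (A.transpose * S * B) = ∑ j, ∑ j', S j j' •
      ((∑ m, A j m • FreeAlgebra.ι 𝕜 m) * ∑ m, B j' m • FreeAlgebra.ι 𝕜 m) := by
  simp only [quad_apply, Matrix.mul_apply, Matrix.transpose_apply, Finset.sum_mul, Finset.mul_sum,
    Finset.sum_smul, Finset.smul_sum]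
  have : ∀ f : X → X → X → X → FreeAlgebra 𝕜 X, ∑ a, ∑ b, ∑ j', ∑ j, f a b j' j =
      ∑ j, ∑ j', ∑ b, ∑ a, f a b j' j := by
    intro f
    simp only [← Finset.sum_product']
    refine Finset.sum_bij' (fun x _ => (x.2.2.2, x.2.2.1, x.2.1, x.1))
      (fun x _ => (x.2.2.2, x.2.2.1, x.2.1, x.1)) ?_ ?_ ?_ ?_ ?_ <;> simp
  rw [this]
  refine Finset.sum_congr rfl fun j _ => Finset.sum_congr rfl fun j' _ => ?_
  refine Finset.sum_congr rfl fun a _ => Finset.sum_congr rfl fun b _ => ?_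
  simp only [smul_mul_assoc, mul_smul_comm, smul_smul]
  congr 1
  ring

/-- By multiplicativity x_i passes the two letters one after the other, becoming x_m in between.
Each letter contributes one slice, which acts on one side of the coefficient matrix. -/
theorem braidMatrix_quad (r : X → X → X → X → 𝕜) (S : Matrix X X 𝕜) (i l : X) :
    braidMatrix r (quad S) i l =
      quad (∑ m, (outerSlice r i m).transpose * S * outerSlice r m l) := by
  simp only [map_sum, quad_mul_mul]
  simp only [quad_apply, map_sum, map_smul, map_mul, Matrix.sum_apply, Matrix.smul_apply,
    Matrix.mul_apply, braidMatrix_ι, outerSlice, Matrix.of_apply]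
  rw [Finset.sum_comm' (t' := Finset.univ) (s' := fun _ => Finset.univ) (by simp)]
  simp only [Finset.smul_sum]
  rw [Finset.sum_comm]
  conv_rhs => rw [Finset.sum_comm]
  refine Finset.sum_congr rfl fun j _ => ?_
  conv_rhs => rw [Finset.sum_comm]

/-- The action of `a` on rows indexed by pairs, i.e. moving an element of `V ⊗ V` past `a`. -/
def pairAct (r : X → X → X → X → 𝕜) (a : FreeAlgebra 𝕜 X) :
    Matrix X X (FreeAlgebra 𝕜 X) →ₗ[FreeAlgebra 𝕜 X] Matrix X X (FreeAlgebra 𝕜 X) where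
  toFun Y := Matrix.of fun l l' => ∑ i, ∑ j, Y i j * braidMatrix r (braidMatrix r a j l') i l
  map_add' Y Z := by
    ext l l'
    simp [add_mul, Finset.sum_add_distrib]
  map_smul' s Y := by
    ext l l'
    simp [Finset.mul_sum, mul_assoc]

theorem pairAct_apply (r : X → X → X → X → 𝕜) (a : FreeAlgebra 𝕜 X)
    (Y : Matrix X X (FreeAlgebra 𝕜 X)) (l l' : X) :
    pairAct r a Y l l' = ∑ i, ∑ j, Y i j * braidMatrix r (braidMatrix r a j l') i l := rfl

/-- The hexagon rule for a pair of letters: a pair moving right past a * b meets a first, whence the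
order of composition. -/
theorem pairAct_mul (r : X → X → X → X → 𝕜) (a b : FreeAlgebra 𝕜 X)
    (Y : Matrix X X (FreeAlgebra 𝕜 X)) :
    pairAct r (a * b) Y = pairAct r b (pairAct r a Y) := by
  ext l l'
  simp only [pairAct_apply, map_mul, Matrix.mul_apply, map_sum, Matrix.sum_apply, Finset.mul_sum,
    Finset.sum_mul, mul_assoc]
  simp only [← Finset.sum_product']
  refine Finset.sum_bij' (fun x _ => (x.2.2.2, x.2.2.1, x.1, x.2.1))
      (fun x _ => (x.2.2.1, x.2.2.2, x.2.1, x.1)) ?_ ?_ ?_ ?_ ?_ <;> simp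

theorem pairAct_add (r : X → X → X → X → 𝕜) (a b : FreeAlgebra 𝕜 X)
    (Y : Matrix X X (FreeAlgebra 𝕜 X)) :
    pairAct r (a + b) Y = pairAct r a Y + pairAct r b Y := by
  ext l l'
  simp [pairAct_apply, mul_add, Finset.sum_add_distrib]

/-- The left `T(V)`-module of matrices generated by scalar matrices in `W`. -/
def extendScalars (W : Submodule 𝕜 (Matrix X X 𝕜)) :
    Submodule (FreeAlgebra 𝕜 X) (Matrix X X (FreeAlgebra 𝕜 X)) :=
  Submodule.span _ ((fun S : Matrix X X 𝕜 => S.map (algebraMap 𝕜 (FreeAlgebra 𝕜 X))) '' W)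

theorem map_mem_extendScalars {W : Submodule 𝕜 (Matrix X X 𝕜)} {S : Matrix X X 𝕜} (hS : S ∈ W) :
    S.map (algebraMap 𝕜 (FreeAlgebra 𝕜 X)) ∈ extendScalars W :=
  Submodule.subset_span ⟨S, hS, rfl⟩

/-- Stability for moving W past one letter propagates to arbitrary tensors, since `pairAct` turns
products into compositions. Only the case of a generator uses the hypothesis. -/
theorem pairAct_mem {r : X → X → X → X → 𝕜} {W : Submodule 𝕜 (Matrix X X 𝕜)}
    (h : ∀ S ∈ W, ∀ n m, ∑ m', (innerSlice r m' m).transpose * S * innerSlice r n m' ∈ W)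
    (a : FreeAlgebra 𝕜 X) :
    ∀ Y ∈ extendScalars W, pairAct r a Y ∈ extendScalars W := by
  induction a using FreeAlgebra.induction with
  | grade0 c =>
    intro Y hY
    have : pairAct r (algebraMap 𝕜 _ c) Y = algebraMap 𝕜 (FreeAlgebra 𝕜 X) c • Y := by
      ext l l'
      rw [pairAct_apply]
      have h0 : ∀ i j, braidMatrix r (braidMatrix r (algebraMap 𝕜 _ c) j l') i l =
          if j = l' then if i = l then algebraMap 𝕜 _ c else 0 else 0 := by
        intro i j
        rw [AlgHom.commutes, Matrix.algebraMap_matrix_apply]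
        split_ifs with h1 h2
        · rw [AlgHom.commutes, Matrix.algebraMap_matrix_apply, if_pos h2]
        · rw [AlgHom.commutes, Matrix.algebraMap_matrix_apply, if_neg h2]
        · simp
      simp only [h0]
      simp [Algebra.commutes]
    rw [this]
    exact Submodule.smul_mem _ _ hY
  | grade1 n =>
    intro Y hY
    induction hY using Submodule.span_induction with
    | mem Y hY =>
      obtain ⟨S, hS, rfl⟩ := hY
      have : pairAct r (FreeAlgebra.ι 𝕜 n) (S.map (algebraMap 𝕜 (FreeAlgebra 𝕜 X))) =
          ∑ m, FreeAlgebra.ι 𝕜 m •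
            (∑ m', (innerSlice r m' m).transpose * S * innerSlice r n m').map
              (algebraMap 𝕜 (FreeAlgebra 𝕜 X)) := by
        ext l l'
        simp only [pairAct_apply, braidMatrix_ι, Matrix.sum_apply, Matrix.smul_apply,
          Matrix.map_apply, map_sum, map_smul, smul_eq_mul, Matrix.mul_apply, Finset.mul_sum,
          Matrix.transpose_apply, innerSlice, Matrix.of_apply, Finset.sum_mul, Finset.smul_sum,
          map_mul]
        simp only [← Finset.sum_product']
        refine Finset.sum_bij' (fun x _ => (x.2.2.2, x.2.2.1, x.2.1, x.1))
          (fun x _ => (x.2.2.2, x.2.2.1, x.2.1, x.1)) ?_ ?_ ?_ ?_ ?_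
        · simp
        · simp
        · simp
        · simp
        · intro x _
          rw [← Algebra.smul_def, ← map_mul, ← map_mul, ← Algebra.commutes, ← Algebra.smul_def,
            smul_smul, smul_smul]
          congr 1
          ring
      rw [this]
      exact Submodule.sum_mem _ fun m _ =>
        Submodule.smul_mem _ _ (map_mem_extendScalars (h S hS n m))
    | zero => simp
    | add Y Z _ _ hY hZ => rw [map_add]; exact Submodule.add_mem _ hY hZ
    | smul s Y _ hY => rw [map_smul]; exact Submodule.smul_mem _ _ hY
  | mul a b ha hb => intro Y hY; rw [pairAct_mul]; exact hb _ (ha _ hY)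
  | add a b ha hb => intro Y hY; rw [pairAct_add]; exact Submodule.add_mem _ (ha _ hY) (hb _ hY)

theorem _root_.TwoSidedIdeal.smul_mem_of_algebra {A : Type*} [Ring A] [Algebra 𝕜 A] (I : TwoSidedIdeal A)
    (c : 𝕜) {f : A} (hf : f ∈ I) : c • f ∈ I := by
  rw [Algebra.smul_def]; exact I.mul_mem_left _ _ hf

/-- If the generators of `T(V)` act by operators preserving `K`, and the elements of `s` act by
operators with values in `K`, then so do all elements of the ideal generated by `s`. -/
theorem lift_apply_mem_of_mem_span {M : Type*} [AddCommGroup M] [Module 𝕜 M] (K : Submodule 𝕜 M)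
    (F : X → Module.End 𝕜 M) (hF : ∀ i, ∀ v ∈ K, F i v ∈ K) {s : Set (FreeAlgebra 𝕜 X)}
    (hs : ∀ f ∈ s, ∀ v, FreeAlgebra.lift 𝕜 F f v ∈ K) {f : FreeAlgebra 𝕜 X}
    (hf : f ∈ TwoSidedIdeal.span s) (v : M) : FreeAlgebra.lift 𝕜 F f v ∈ K := by
  have hK : ∀ a, ∀ v ∈ K, FreeAlgebra.lift 𝕜 F a v ∈ K := by
    intro a
    induction a using FreeAlgebra.induction with
    | grade0 c =>
      intro v hv
      rw [AlgHom.commutes, Module.algebraMap_end_apply]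
      exact K.smul_mem _ hv
    | grade1 n => intro v hv; rw [FreeAlgebra.lift_ι_apply]; exact hF n v hv
    | mul a b ha hb => intro v hv; rw [map_mul]; exact ha _ (hb _ hv)
    | add a b ha hb => intro v hv; rw [map_add]; exact K.add_mem (ha _ hv) (hb _ hv)
  let N : TwoSidedIdeal (FreeAlgebra 𝕜 X) :=
    TwoSidedIdeal.mk' {f | ∀ v, FreeAlgebra.lift 𝕜 F f v ∈ K} (by simp)
      (fun {x y} hx hy v => by rw [map_add]; exact K.add_mem (hx v) (hy v))
      (fun {x} hx v => by rw [map_neg]; exact K.neg_mem (hx v))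
      (fun {x y} hy v => by rw [map_mul]; exact hK x _ (hy v))
      (fun {x y} hx v => by rw [map_mul]; exact hx _)
  have hN : TwoSidedIdeal.span s ≤ N :=
    TwoSidedIdeal.span_le.2 fun f hf => (TwoSidedIdeal.mem_mk' ..).2 (hs f hf)
  exact (TwoSidedIdeal.mem_mk' ..).1 (hN hf) v

theorem quad_mem_span {W : Submodule 𝕜 (Matrix X X 𝕜)} {S : Matrix X X 𝕜} (hS : S ∈ W) :
    quad S ∈ TwoSidedIdeal.span (quad '' (W : Set (Matrix X X 𝕜))) :=
  TwoSidedIdeal.subset_span ⟨S, hS, rfl⟩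

/-- Multiplicativity of `braidMatrix` makes the elements whose matrix entries all lie in the ideal a
two-sided ideal, so it suffices to look at the quadratic generators. -/
theorem braidMatrix_mem_span {r : X → X → X → X → 𝕜} {W : Submodule 𝕜 (Matrix X X 𝕜)}
    (h : ∀ S ∈ W, ∀ i l, ∑ m, (outerSlice r i m).transpose * S * outerSlice r m l ∈ W)
    {f : FreeAlgebra 𝕜 X} (hf : f ∈ TwoSidedIdeal.span (quad '' (W : Set (Matrix X X 𝕜)))) :
    ∀ i l, braidMatrix r f i l ∈ TwoSidedIdeal.span (quad '' (W : Set (Matrix X X 𝕜))) := by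
  set I := TwoSidedIdeal.span (quad '' (W : Set (Matrix X X 𝕜))) with hI
  let N : TwoSidedIdeal (FreeAlgebra 𝕜 X) :=
    TwoSidedIdeal.mk' {f | ∀ i l, braidMatrix r f i l ∈ I} (by simp [I.zero_mem])
      (fun {x y} hx hy i l => by rw [map_add]; exact I.add_mem (hx i l) (hy i l))
      (fun {x} hx i l => by rw [map_neg]; exact I.neg_mem (hx i l))
      (fun {x y} hy i l => by
        rw [map_mul, Matrix.mul_apply]
        exact sum_mem fun j _ => I.mul_mem_left _ _ (hy j l))
      (fun {x y} hx i l => by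
        rw [map_mul, Matrix.mul_apply]
        exact sum_mem fun j _ => I.mul_mem_right _ _ (hx i j))
  have hN : I ≤ N := by
    refine TwoSidedIdeal.span_le.2 ?_
    rintro _ ⟨S, hS, rfl⟩
    refine (TwoSidedIdeal.mem_mk' ..).2 fun i l => ?_
    rw [braidMatrix_quad]
    exact quad_mem_span (h S hS i l)
  exact (TwoSidedIdeal.mem_mk' ..).1 (hN hf)

theorem comulStep_tmul (r : X → X → X → X → 𝕜) (i : X) (u v : FreeAlgebra 𝕜 X) :
    comulStep r i (u ⊗ₜ[𝕜] v) = (FreeAlgebra.ι 𝕜 i * u) ⊗ₜ[𝕜] v +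
      ∑ l, braidMatrix r u i l ⊗ₜ[𝕜] (FreeAlgebra.ι 𝕜 l * v) := by
  simp [comulStep, braidEntry]

theorem antipodeStep_apply (r : X → X → X → X → 𝕜) (i : X) (u : FreeAlgebra 𝕜 X) :
    antipodeStep r i u = -∑ l, braidMatrix r u i l * FreeAlgebra.ι 𝕜 l := by
  simp [antipodeStep, braidEntry]

theorem lift_quad {A : Type*} [Semiring A] [Algebra 𝕜 A] (F : X → A) (S : Matrix X X 𝕜) :
    FreeAlgebra.lift 𝕜 F (quad S) = ∑ i, ∑ j, S i j • (F i * F j) := by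
  simp [quad_apply]

/-- The hypothesis is c(S) = -S in V ⊗ V; here it is read off in the component V ⊗ x_k. This
identity makes the mixed terms of Δ cancel. -/
theorem sum_smul_braidMatrix {r : X → X → X → X → 𝕜} {S : Matrix X X 𝕜}
    (h : ∀ m n, ∑ i, ∑ j, S i j * r i j m n = - S m n) (k : X) :
    ∑ i, ∑ j, S i j • braidMatrix r (FreeAlgebra.ι 𝕜 j) i k =
      - ∑ i, S i k • FreeAlgebra.ι 𝕜 i := by
  simp only [braidMatrix_ι, Finset.smul_sum, smul_smul]
  rw [← Finset.sum_neg_distrib]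
  simp only [← neg_smul, ← h, Finset.sum_smul]
  simp only [← Finset.sum_product']
  refine Finset.sum_bij' (fun x _ => (x.2.2, x.1, x.2.1))
    (fun x _ => (x.2.1, x.2.2, x.1)) ?_ ?_ ?_ ?_ ?_ <;> simp

/-- As c = -1 on W, the component of Δ in V ⊗ V, which is (1 + c)(S), vanishes and W consists of
primitive elements. The two stability conditions allow W to be braided past any tensor on either
side, so that the ideal generated by W inherits compatibility with Δ and the antipode. -/
theorem isHopfIdeal_span_quad {r : X → X → X → X → 𝕜} {W : Submodule 𝕜 (Matrix X X 𝕜)}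
    (hprim : ∀ S ∈ W, ∀ m n, ∑ i, ∑ j, S i j * r i j m n = - S m n)
    (hout : ∀ S ∈ W, ∀ i l, ∑ m, (outerSlice r i m).transpose * S * outerSlice r m l ∈ W)
    (hin : ∀ S ∈ W, ∀ n m, ∑ m', (innerSlice r m' m).transpose * S * innerSlice r n m' ∈ W) :
    IsHopfIdeal r (TwoSidedIdeal.span (quad '' (W : Set (Matrix X X 𝕜)))) := by
  set I := TwoSidedIdeal.span (quad '' (W : Set (Matrix X X 𝕜))) with hI
  refine ⟨⟨_, ?_, hI⟩, ?_, ?_⟩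
  · rintro _ ⟨S, hS, rfl⟩
    refine ⟨2, le_rfl, ?_⟩
    rw [quad_apply]
    refine Submodule.sum_mem _ fun i _ => Submodule.sum_mem _ fun j _ =>
      Submodule.smul_mem _ _ ?_
    rw [degreePart, pow_two]
    exact Submodule.mul_mem_mul (Submodule.subset_span ⟨i, rfl⟩) (Submodule.subset_span ⟨j, rfl⟩)
  · intro f hf
    refine lift_apply_mem_of_mem_span _ _ ?_ ?_ hf _
    · intro i z hz
      induction hz using Submodule.span_induction with
      | mem z hz =>
        obtain ⟨u, v, huv, rfl⟩ := hz
        rw [comulStep_tmul]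
        refine Submodule.add_mem _ (Submodule.subset_span ⟨_, _, ?_, rfl⟩)
          (Submodule.sum_mem _ fun l _ => Submodule.subset_span ⟨_, _, ?_, rfl⟩)
        · exact huv.imp (I.mul_mem_left _ _) id
        · exact huv.imp (fun h => braidMatrix_mem_span hout h i l) (I.mul_mem_left _ _)
      | zero => simp
      | add Y Z _ _ hY hZ => rw [map_add]; exact Submodule.add_mem _ hY hZ
      | smul s Y _ hY => rw [map_smul]; exact Submodule.smul_mem _ _ hY
    · rintro _ ⟨S, hS, rfl⟩ z
      induction z using TensorProduct.induction_on with
      | zero => simp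
      | add y z hy hz => rw [map_add]; exact Submodule.add_mem _ hy hz
      | tmul a b =>
        -- Left multiplication by Δ(quad S) = quad S ⊗ 1 + 1 ⊗ quad S. In the second summand the
        -- pair of letters must first be braided past a, which is what `pairAct` records.
        have key : FreeAlgebra.lift 𝕜 (comulStep r) (quad S) (a ⊗ₜ[𝕜] b) =
            (quad S * a) ⊗ₜ[𝕜] b +
            ∑ l, ∑ l', pairAct r a (S.map (algebraMap 𝕜 (FreeAlgebra 𝕜 X))) l l' ⊗ₜ[𝕜]
              (FreeAlgebra.ι 𝕜 l * FreeAlgebra.ι 𝕜 l' * b) := by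
          have e1 : ∀ i j, comulStep r i (comulStep r j (a ⊗ₜ[𝕜] b)) =
              (FreeAlgebra.ι 𝕜 i * FreeAlgebra.ι 𝕜 j * a) ⊗ₜ[𝕜] b +
              ∑ k, (∑ l, braidMatrix r (FreeAlgebra.ι 𝕜 j) i l * braidMatrix r a l k) ⊗ₜ[𝕜]
                (FreeAlgebra.ι 𝕜 k * b) +
              ∑ k, (FreeAlgebra.ι 𝕜 i * braidMatrix r a j k) ⊗ₜ[𝕜] (FreeAlgebra.ι 𝕜 k * b) +
              ∑ l, ∑ l', braidMatrix r (braidMatrix r a j l') i l ⊗ₜ[𝕜]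
                (FreeAlgebra.ι 𝕜 l * FreeAlgebra.ι 𝕜 l' * b) := by
            intro i j
            simp only [comulStep_tmul, map_add, map_sum, map_mul, Matrix.mul_apply, mul_assoc,
              Finset.sum_add_distrib]
            rw [Finset.sum_comm (f := fun x i_1 => braidMatrix r (braidMatrix r a j x) i i_1 ⊗ₜ[𝕜]
              (FreeAlgebra.ι 𝕜 i_1 * (FreeAlgebra.ι 𝕜 x * b)))]
            abel
          have e2 : ∀ k, ∑ i, ∑ j, S i j •
              (∑ l, braidMatrix r (FreeAlgebra.ι 𝕜 j) i l * braidMatrix r a l k) =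
              - ∑ i, ∑ j, S i j • (FreeAlgebra.ι 𝕜 i * braidMatrix r a j k) := by
            intro k
            have : ∑ i, ∑ j, S i j •
                (∑ l, braidMatrix r (FreeAlgebra.ι 𝕜 j) i l * braidMatrix r a l k) =
                ∑ l, (∑ i, ∑ j, S i j • braidMatrix r (FreeAlgebra.ι 𝕜 j) i l) *
                  braidMatrix r a l k := by
              simp only [Finset.smul_sum, Finset.sum_mul, smul_mul_assoc]
              simp only [← Finset.sum_product']
              refine Finset.sum_bij' (fun x _ => (x.2.2, x.1, x.2.1))
                (fun x _ => (x.2.1, x.2.2, x.1)) ?_ ?_ ?_ ?_ ?_ <;> simp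
            rw [this]
            simp only [sum_smul_braidMatrix (hprim S hS), neg_mul, Finset.sum_neg_distrib,
              Finset.sum_mul, smul_mul_assoc]
            rw [Finset.sum_comm]
          simp only [lift_quad, LinearMap.sum_apply, LinearMap.smul_apply, Module.End.mul_apply, e1,
            smul_add, Finset.sum_add_distrib]
          have e3 : ∑ i, ∑ j, S i j • ∑ k, (∑ l, braidMatrix r (FreeAlgebra.ι 𝕜 j) i l *
                braidMatrix r a l k) ⊗ₜ[𝕜] (FreeAlgebra.ι 𝕜 k * b) =
              - ∑ i, ∑ j, S i j • ∑ k, (FreeAlgebra.ι 𝕜 i * braidMatrix r a j k) ⊗ₜ[𝕜]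
                (FreeAlgebra.ι 𝕜 k * b) := by
            have : ∀ f : X → X → X → FreeAlgebra 𝕜 X, ∑ i, ∑ j, S i j • ∑ k, f i j k ⊗ₜ[𝕜]
                (FreeAlgebra.ι 𝕜 k * b) = ∑ k, (∑ i, ∑ j, S i j • f i j k) ⊗ₜ[𝕜]
                (FreeAlgebra.ι 𝕜 k * b) := by
              intro f
              simp only [Finset.smul_sum, TensorProduct.sum_tmul, TensorProduct.smul_tmul']
              simp only [← Finset.sum_product']
              refine Finset.sum_bij' (fun x _ => (x.2.2, x.1, x.2.1))
                (fun x _ => (x.2.1, x.2.2, x.1)) ?_ ?_ ?_ ?_ ?_ <;> simp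
            rw [this, this]
            simp only [e2, TensorProduct.neg_tmul, Finset.sum_neg_distrib]
          rw [e3, neg_add_cancel_right]
          congr 1
          · simp only [quad_apply, Finset.sum_mul, TensorProduct.sum_tmul, smul_mul_assoc,
              TensorProduct.smul_tmul']
          · simp only [pairAct_apply, TensorProduct.sum_tmul, Matrix.map_apply, ← Algebra.smul_def,
              ← TensorProduct.smul_tmul', Finset.smul_sum]
            simp only [← Finset.sum_product']
            refine Finset.sum_bij' (fun x _ => (x.2.2.1, x.2.2.2, x.1, x.2.1))
                (fun x _ => (x.2.2.1, x.2.2.2, x.1, x.2.1)) ?_ ?_ ?_ ?_ ?_ <;> simp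
        rw [key]
        refine Submodule.add_mem _ (Submodule.subset_span
          ⟨_, _, Or.inl (I.mul_mem_right _ _ (quad_mem_span hS)), rfl⟩) ?_
        obtain ⟨Y, hY⟩ : ∃ Y, Y = pairAct r a (S.map (algebraMap 𝕜 (FreeAlgebra 𝕜 X))) := ⟨_, rfl⟩
        have := pairAct_mem hin a _ (map_mem_extendScalars hS)
        rw [← hY] at this ⊢
        clear hY key
        -- It suffices to treat the additive generators s • S', for which the sum collapses to the
        -- pure tensor s ⊗ quad S' * b.
        induction this using Submodule.closure_induction with
        | zero => simp
        | add Y Z _ _ hY hZ =>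
          simp only [Matrix.add_apply, TensorProduct.add_tmul, Finset.sum_add_distrib]
          exact Submodule.add_mem _ hY hZ
        | smul_mem s Y hY =>
          obtain ⟨S', hS', rfl⟩ := hY
          refine Submodule.subset_span ⟨s, quad S' * b,
            Or.inr (I.mul_mem_right _ _ (quad_mem_span hS')), ?_⟩
          simp only [quad_apply, Finset.sum_mul, TensorProduct.tmul_sum, smul_mul_assoc,
            Matrix.smul_apply, Matrix.map_apply, smul_eq_mul, TensorProduct.tmul_smul,
            ← Algebra.commutes, ← Algebra.smul_def, TensorProduct.smul_tmul']
  · intro f hf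
    let K : Submodule 𝕜 (FreeAlgebra 𝕜 X) :=
      { carrier := {f | f ∈ I}
        add_mem' := fun h h' => I.add_mem h h'
        zero_mem' := I.zero_mem
        smul_mem' := fun c f hf => I.smul_mem_of_algebra c hf }
    change _ ∈ K
    refine lift_apply_mem_of_mem_span K _ ?_ ?_ hf _
    · intro i v hv
      rw [antipodeStep_apply]
      exact K.neg_mem (K.sum_mem fun l _ => I.mul_mem_right _ _ (braidMatrix_mem_span hout hv i l))
    · rintro _ ⟨S, hS, rfl⟩ a
      -- The two signs cancel. What remains is the pair moved past a and then braided once more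
      -- within itself.
      have key : FreeAlgebra.lift 𝕜 (antipodeStep r) (quad S) a =
          ∑ m, ∑ l', pairAct r a (S.map (algebraMap 𝕜 (FreeAlgebra 𝕜 X))) m l' *
            ∑ l, braidMatrix r (FreeAlgebra.ι 𝕜 l') m l * FreeAlgebra.ι 𝕜 l := by
        simp only [lift_quad, LinearMap.sum_apply, LinearMap.smul_apply, Module.End.mul_apply,
          antipodeStep_apply, map_neg, map_sum, map_mul, 
          Matrix.mul_apply, Finset.sum_neg_distrib, neg_neg, pairAct_apply,
          Matrix.map_apply, ← Algebra.smul_def, Finset.sum_mul, Finset.mul_sum, Finset.smul_sum,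
          smul_mul_assoc, mul_assoc]
        simp only [← Finset.sum_product']
        refine Finset.sum_bij' (fun x _ => (x.2.2.2.2, x.2.2.1, x.2.2.2.1, x.1, x.2.1))
          (fun x _ => (x.2.2.2.1, x.2.2.2.2, x.2.1, x.2.2.1, x.1)) ?_ ?_ ?_ ?_ ?_ <;> simp
      rw [key]
      obtain ⟨Y, hY⟩ : ∃ Y, Y = pairAct r a (S.map (algebraMap 𝕜 (FreeAlgebra 𝕜 X))) := ⟨_, rfl⟩
      have := pairAct_mem hin a _ (map_mem_extendScalars hS)
      rw [← hY] at this ⊢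
      clear hY key
      induction this using Submodule.closure_induction with
      | zero => simp
      | add Y Z _ _ hY hZ =>
        simp only [Matrix.add_apply, add_mul, Finset.sum_add_distrib]
        exact Submodule.add_mem _ hY hZ
      | smul_mem s Y hY =>
        obtain ⟨S', hS', rfl⟩ := hY
        -- The remaining braiding inside the pair is c(S') = -S', so the result is a left multiple
        -- of a relation.
        have : ∑ m, ∑ l', (s • S'.map (algebraMap 𝕜 (FreeAlgebra 𝕜 X))) m l' *
            ∑ l, braidMatrix r (FreeAlgebra.ι 𝕜 l') m l * FreeAlgebra.ι 𝕜 l = s * - quad S' := by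
          have : - quad S' = ∑ l, (∑ m, ∑ l', S' m l' • braidMatrix r (FreeAlgebra.ι 𝕜 l') m l) *
              FreeAlgebra.ι 𝕜 l := by
            simp only [sum_smul_braidMatrix (hprim S' hS'), neg_mul, Finset.sum_neg_distrib,
              Finset.sum_mul, smul_mul_assoc, quad_apply]
            rw [Finset.sum_comm]
          rw [this]
          simp only [Matrix.smul_apply, Matrix.map_apply, smul_eq_mul, Finset.mul_sum,
            Finset.sum_mul, mul_assoc, ← Algebra.smul_def, smul_mul_assoc, mul_smul_comm]
          simp only [← Finset.sum_product']
          refine Finset.sum_bij' (fun x _ => (x.2.2, x.1, x.2.1))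
                (fun x _ => (x.2.1, x.2.2, x.1)) ?_ ?_ ?_ ?_ ?_ <;> simp
        rw [this]
        exact I.mul_mem_left _ _ (I.neg_mem (quad_mem_span hS'))

end Nichols

namespace Nichols

variable {𝕜 : Type*} [Field 𝕜] {X : Type*} [Fintype X] [DecidableEq X]

/-! ### Skew derivations -/

variable (𝕜 X) in
/-- The part of degree at most one of an element of `T(V)`. -/
def linearPart : FreeAlgebra 𝕜 X →ₐ[𝕜] TrivSqZeroExt 𝕜 (X → 𝕜) :=
  FreeAlgebra.lift 𝕜 fun i => TrivSqZeroExt.inr (Pi.single i 1)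

theorem linearPart_ι (i : X) :
    linearPart 𝕜 X (FreeAlgebra.ι 𝕜 i) = TrivSqZeroExt.inr (Pi.single i 1) := by
  simp [linearPart]

variable (𝕜 X) in
/-- The counit of `T(V)`. -/
def counit : FreeAlgebra 𝕜 X →ₗ[𝕜] 𝕜 where
  toFun f := (linearPart 𝕜 X f).fst
  map_add' f g := by simp
  map_smul' s f := by simp

variable (𝕜) in
/-- The coefficient of `x_l`. -/
def linearCoeff (l : X) : FreeAlgebra 𝕜 X →ₗ[𝕜] 𝕜 where
  toFun f := (linearPart 𝕜 X f).snd l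
  map_add' f g := by simp
  map_smul' s f := by simp

theorem counit_ι_mul (i : X) (f : FreeAlgebra 𝕜 X) :
    counit 𝕜 X (FreeAlgebra.ι 𝕜 i * f) = 0 := by
  simp [counit, linearPart_ι]

theorem linearCoeff_ι_mul (l i : X) (f : FreeAlgebra 𝕜 X) :
    linearCoeff 𝕜 l (FreeAlgebra.ι 𝕜 i * f) = if l = i then counit 𝕜 X f else 0 := by
  simp [linearCoeff, counit, linearPart_ι, Pi.single_apply]

/-- Elements of degree one have no constant term, and a product of two such elements vanishes in a
square-zero extension. -/
theorem linearPart_eq_zero {n : ℕ} (hn : 2 ≤ n) {f : FreeAlgebra 𝕜 X}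
    (hf : f ∈ degreePart 𝕜 X n) : linearPart 𝕜 X f = 0 := by
  have h1 : ∀ g ∈ degreePart 𝕜 X 1, (linearPart 𝕜 X g).fst = 0 := by
    intro g hg
    rw [degreePart, pow_one] at hg
    induction hg using Submodule.span_induction with
    | mem g hg => obtain ⟨i, rfl⟩ := hg; simp [linearPart_ι]
    | zero => simp
    | add y z _ _ hy hz => simp [hy, hz]
    | smul s y _ hy => simp [hy]
  obtain ⟨m, rfl⟩ := Nat.exists_eq_add_of_le hn
  have h2 : ∀ g ∈ degreePart 𝕜 X 2, linearPart 𝕜 X g = 0 := by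
    intro g hg
    rw [degreePart, pow_two] at hg
    induction hg using Submodule.mul_induction_on' with
    | mem_mul_mem a ha b hb =>
      have ha' := h1 a (by rwa [degreePart, pow_one])
      have hb' := h1 b (by rwa [degreePart, pow_one])
      rw [map_mul]
      ext <;> simp [ha', hb']
    | add a _ b _ ha hb => rw [map_add, ha, hb, add_zero]
  rw [degreePart, pow_add] at hf
  induction hf using Submodule.mul_induction_on' with
  | mem_mul_mem a ha b hb => rw [map_mul, h2 a ha, zero_mul]
  | add a _ b _ ha hb => rw [map_add, ha, hb, add_zero]

/-- The bound 2 on the degree of the generators enters here: it makes J invisible to the constant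
and linear coefficients. -/
theorem linearPart_of_mem_nicholsIdeal {r : X → X → X → X → 𝕜} {f : FreeAlgebra 𝕜 X}
    (hf : f ∈ nicholsIdeal r) : linearPart 𝕜 X f = 0 := by
  obtain ⟨S, hS, hspan⟩ := (nicholsIdeal_isGreatest r).1.generated
  have : nicholsIdeal r ≤ TwoSidedIdeal.ker (linearPart 𝕜 X) := by
    rw [hspan]
    refine TwoSidedIdeal.span_le.2 fun s hs => ?_
    obtain ⟨n, hn, hsn⟩ := hS s hs
    exact (TwoSidedIdeal.mem_ker _).2 (linearPart_eq_zero hn hsn)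
  exact (TwoSidedIdeal.mem_ker _).1 (this hf)

theorem one_notMem_nicholsIdeal (r : X → X → X → X → 𝕜) :
    (1 : FreeAlgebra 𝕜 X) ∉ nicholsIdeal r := fun h => by
  have := congrArg TrivSqZeroExt.fst (linearPart_of_mem_nicholsIdeal h)
  simp at this

/-- The skew derivation `∂_l` of `T(V)`: the component of `Δ f` in `T(V) ⊗ x_l`. -/
def skewDer (r : X → X → X → X → 𝕜) (l : X) : FreeAlgebra 𝕜 X →ₗ[𝕜] FreeAlgebra 𝕜 X :=
  (TensorProduct.rid 𝕜 (FreeAlgebra 𝕜 X)).toLinearMap ∘ₗ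
    TensorProduct.map LinearMap.id (linearCoeff 𝕜 l) ∘ₗ comul r

theorem comul_one (r : X → X → X → X → 𝕜) : comul r 1 = 1 ⊗ₜ[𝕜] 1 := by
  simp [comul]

theorem comul_ι_mul (r : X → X → X → X → 𝕜) (i : X) (f : FreeAlgebra 𝕜 X) :
    comul r (FreeAlgebra.ι 𝕜 i * f) = comulStep r i (comul r f) := by
  simp [comul]

/-- The counit axiom (id ⊗ ε) Δ = id. It identifies the part of Δ f in T(V) ⊗ 1, from which a new
letter x_l arises in `skewDer_ι_mul`. -/
theorem rid_counit_comul (r : X → X → X → X → 𝕜) (f : FreeAlgebra 𝕜 X) :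
    TensorProduct.rid 𝕜 (FreeAlgebra 𝕜 X) (TensorProduct.map LinearMap.id (counit 𝕜 X)
      (comul r f)) = f := by
  have h0 : ∀ i z, TensorProduct.rid 𝕜 (FreeAlgebra 𝕜 X) (TensorProduct.map LinearMap.id
      (counit 𝕜 X) (comulStep r i z)) = FreeAlgebra.ι 𝕜 i *
      TensorProduct.rid 𝕜 (FreeAlgebra 𝕜 X) (TensorProduct.map LinearMap.id (counit 𝕜 X) z) := by
    intro i z
    induction z using TensorProduct.induction_on with
    | zero => simp
    | add y z hy hz => simp only [map_add, hy, hz, mul_add]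
    | tmul u v => simp [comulStep_tmul, counit_ι_mul]
  -- Stated for the action of f on an arbitrary tensor g, so that the induction passes through
  -- products; Δ f is the case g = 1 ⊗ 1.
  have h1 : ∀ f g, TensorProduct.rid 𝕜 (FreeAlgebra 𝕜 X) (TensorProduct.map LinearMap.id
      (counit 𝕜 X) (FreeAlgebra.lift 𝕜 (comulStep r) f g)) = f *
      TensorProduct.rid 𝕜 (FreeAlgebra 𝕜 X) (TensorProduct.map LinearMap.id (counit 𝕜 X) g) := by
    intro f
    induction f using FreeAlgebra.induction with
    | grade0 c => intro g; simp [Algebra.smul_def]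
    | grade1 i => intro g; simp [h0]
    | mul a b ha hb => intro g; simp [ha, hb, mul_assoc]
    | add a b ha hb => intro g; simp [ha, hb, add_mul]
  have h2 := h1 f (1 ⊗ₜ 1)
  have h3 : counit 𝕜 X 1 = 1 := by simp [counit]
  rw [TensorProduct.map_tmul, h3, TensorProduct.rid_tmul, one_smul, LinearMap.id_apply,
    mul_one] at h2
  exact h2

/-- In Δ(x_i) Δ(f) a second factor x_l is either already present in Δ(f), or comes from moving 1 ⊗
x_i past the component f ⊗ 1. -/
theorem skewDer_ι_mul (r : X → X → X → X → 𝕜) (l i : X) (f : FreeAlgebra 𝕜 X) :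
    skewDer r l (FreeAlgebra.ι 𝕜 i * f) =
      FreeAlgebra.ι 𝕜 i * skewDer r l f + braidMatrix r f i l := by
  have h0 : ∀ z, TensorProduct.rid 𝕜 (FreeAlgebra 𝕜 X) (TensorProduct.map LinearMap.id
      (linearCoeff 𝕜 l) (comulStep r i z)) = FreeAlgebra.ι 𝕜 i *
      TensorProduct.rid 𝕜 (FreeAlgebra 𝕜 X) (TensorProduct.map LinearMap.id (linearCoeff 𝕜 l) z) +
      braidMatrix r (TensorProduct.rid 𝕜 (FreeAlgebra 𝕜 X)
        (TensorProduct.map LinearMap.id (counit 𝕜 X) z)) i l := by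
    intro z
    induction z using TensorProduct.induction_on with
    | zero => simp
    | add y z hy hz => simp only [map_add, hy, hz, mul_add, Matrix.add_apply]; abel
    | tmul u v => simp [comulStep_tmul, linearCoeff_ι_mul]
  have := h0 (comul r f)
  rw [rid_counit_comul] at this
  simpa [skewDer, comul_ι_mul] using this

theorem skewDer_one (r : X → X → X → X → 𝕜) (l : X) : skewDer r l 1 = 0 := by
  simp [skewDer, comul_one, linearCoeff]

theorem skewDer_ι (r : X → X → X → X → 𝕜) (l i : X) :
    skewDer r l (FreeAlgebra.ι 𝕜 i) = if i = l then 1 else 0 := by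
  have := skewDer_ι_mul r l i 1
  simpa [skewDer_one, Matrix.one_apply] using this

/-- The twisted Leibniz rule. -/
theorem skewDer_mul (r : X → X → X → X → 𝕜) (l : X) (f g : FreeAlgebra 𝕜 X) :
    skewDer r l (f * g) = f * skewDer r l g + ∑ j, skewDer r j f * braidMatrix r g j l := by
  induction f using FreeAlgebra.induction generalizing l g with
  | grade0 c =>
    have h : ∀ j, skewDer r j (algebraMap 𝕜 (FreeAlgebra 𝕜 X) c) = 0 := by
      intro j; rw [Algebra.algebraMap_eq_smul_one, map_smul, skewDer_one, smul_zero]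
    simp only [h, zero_mul, Finset.sum_const_zero, add_zero, ← Algebra.smul_def, map_smul]
  | grade1 i => simp [skewDer_ι_mul, skewDer_ι]
  | mul a b ha hb =>
    rw [mul_assoc, ha, hb, map_mul]
    simp only [fun j => ha j b, Matrix.mul_apply, mul_add, add_mul, Finset.sum_add_distrib, Finset.mul_sum,
      Finset.sum_mul, mul_assoc, add_assoc]
    congr 2
    rw [Finset.sum_comm]
  | add a b ha hb => simp only [add_mul, map_add, ha, hb, Finset.sum_add_distrib]; abel

/-- Δ f is a sum of tensors with one factor in J. If it is the left one, contraction of the right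
factor stays in J; if it is the right one, its linear coefficient is zero. -/
theorem skewDer_mem_nicholsIdeal {r : X → X → X → X → 𝕜} (l : X) {f : FreeAlgebra 𝕜 X}
    (hf : f ∈ nicholsIdeal r) : skewDer r l f ∈ nicholsIdeal r := by
  let K : Submodule 𝕜 (FreeAlgebra 𝕜 X) :=
    { carrier := {f | f ∈ nicholsIdeal r}
      add_mem' := fun h h' => (nicholsIdeal r).add_mem h h'
      zero_mem' := (nicholsIdeal r).zero_mem
      smul_mem' := fun c f hf => (nicholsIdeal r).smul_mem_of_algebra c hf }
  change _ ∈ K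
  have := (nicholsIdeal_isGreatest r).1.comul_mem f hf
  rw [skewDer, LinearMap.comp_apply, LinearMap.comp_apply]
  generalize comul r f = z at this ⊢
  induction this using Submodule.span_induction with
  | mem z hz =>
    obtain ⟨u, v, huv, rfl⟩ := hz
    simp only [TensorProduct.map_tmul, LinearMap.id_apply, LinearEquiv.coe_coe,
      TensorProduct.rid_tmul]
    rcases huv with hu | hv
    · exact K.smul_mem _ hu
    · have : linearCoeff 𝕜 l v = 0 := by simp [linearCoeff, linearPart_of_mem_nicholsIdeal hv]
      rw [this, zero_smul]
      exact K.zero_mem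
  | zero => simp
  | add y z _ _ hy hz => simp only [map_add]; exact K.add_mem hy hz
  | smul s y _ hy => simp only [map_smul]; exact K.smul_mem _ hy

/-- The projection onto the Nichols algebra. -/
def proj (r : X → X → X → X → 𝕜) : FreeAlgebra 𝕜 X →ₐ[𝕜] NicholsAlgebra r :=
  (nicholsIdeal r).ringCon.mkₐ 𝕜

theorem proj_surjective (r : X → X → X → X → 𝕜) : Function.Surjective (proj r) :=
  RingCon.mkₐ_surjective _

theorem proj_ι (r : X → X → X → X → 𝕜) (i : X) : proj r (FreeAlgebra.ι 𝕜 i) = gen r i := rfl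

theorem proj_eq_zero_iff (r : X → X → X → X → 𝕜) {f : FreeAlgebra 𝕜 X} :
    proj r f = 0 ↔ f ∈ nicholsIdeal r := by
  rw [TwoSidedIdeal.mem_iff, ← RingCon.eq]
  rfl

instance (r : X → X → X → X → 𝕜) : Nontrivial (NicholsAlgebra r) :=
  ⟨⟨1, 0, fun h => one_notMem_nicholsIdeal r ((proj_eq_zero_iff r).1 (by rw [map_one, h]))⟩⟩

/-- The skew derivation induced on the Nichols algebra. -/
def nicholsDer (r : X → X → X → X → 𝕜) (l : X) : NicholsAlgebra r →ₗ[𝕜] NicholsAlgebra r :=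
  (proj r).toLinearMap.exists_rightInverse_of_surjective
    (LinearMap.range_eq_top.2 (proj_surjective r)) |>.choose |> fun s =>
      (proj r).toLinearMap ∘ₗ skewDer r l ∘ₗ s

/-- The section chosen in `nicholsDer` does not matter, because two lifts differ by an element of J,
which the skew derivation preserves. -/
theorem nicholsDer_proj (r : X → X → X → X → 𝕜) (l : X) (f : FreeAlgebra 𝕜 X) :
    nicholsDer r l (proj r f) = proj r (skewDer r l f) := by
  have h := ((proj r).toLinearMap.exists_rightInverse_of_surjective
    (LinearMap.range_eq_top.2 (proj_surjective r))).choose_spec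
  have h2 := LinearMap.congr_fun h (proj r f)
  rw [← sub_eq_zero, nicholsDer]
  simp only [LinearMap.comp_apply, AlgHom.toLinearMap_apply, LinearMap.id_apply] at h2 ⊢
  rw [← map_sub, ← map_sub, proj_eq_zero_iff]
  exact skewDer_mem_nicholsIdeal l ((proj_eq_zero_iff r).1 (by rw [map_sub, h2, sub_self]))

end Nichols

/-! ### The braiding of type (1,7) and the stability of its quadratic relations -/

namespace R17

variable {𝕜 : Type*} [Field 𝕜] (t a b d k ℓ p q : 𝕜)

theorem outerSlice_00 : Nichols.outerSlice (braiding t a b d k ℓ p q) 0 0 =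
    !![t, 0, 0; -(t*k), t, 0; t*a, 0, t] := by
  ext j m
  fin_cases j <;> fin_cases m <;> rfl

theorem outerSlice_01 : Nichols.outerSlice (braiding t a b d k ℓ p q) 0 1 =
    0 := by
  ext j m
  fin_cases j <;> fin_cases m <;> rfl

theorem outerSlice_02 : Nichols.outerSlice (braiding t a b d k ℓ p q) 0 2 =
    0 := by
  ext j m
  fin_cases j <;> fin_cases m <;> rfl

theorem outerSlice_10 : Nichols.outerSlice (braiding t a b d k ℓ p q) 1 0 =
    !![t*k, 0, 0; -(t*k*ℓ), t*ℓ, 0; t*(k*(a - q) - d), 0, t*k] := by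
  ext j m
  fin_cases j <;> fin_cases m <;> rfl

theorem outerSlice_11 : Nichols.outerSlice (braiding t a b d k ℓ p q) 1 1 =
    !![t, 0, 0; -(t*ℓ), t, 0; t*a, 0, t] := by
  ext j m
  fin_cases j <;> fin_cases m <;> rfl

theorem outerSlice_12 : Nichols.outerSlice (braiding t a b d k ℓ p q) 1 2 =
    0 := by
  ext j m
  fin_cases j <;> fin_cases m <;> rfl

theorem outerSlice_20 : Nichols.outerSlice (braiding t a b d k ℓ p q) 2 0 =
    !![t*p, 0, 0; t*d, t*q, 0; t*b, 0, t*p] := by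
  ext j m
  fin_cases j <;> fin_cases m <;> rfl

theorem outerSlice_21 : Nichols.outerSlice (braiding t a b d k ℓ p q) 2 1 =
    !![0, 0, 0; t*(p - q), 0, 0; 0, 0, 0] := by
  ext j m
  fin_cases j <;> fin_cases m <;> rfl

theorem outerSlice_22 : Nichols.outerSlice (braiding t a b d k ℓ p q) 2 2 =
    !![t, 0, 0; -(t*k), t, 0; t*a, 0, t] := by
  ext j m
  fin_cases j <;> fin_cases m <;> rfl

theorem innerSlice_00 : Nichols.innerSlice (braiding t a b d k ℓ p q) 0 0 =
    !![t, 0, 0; t*k, t, 0; t*p, 0, t] := by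
  ext i l
  fin_cases i <;> fin_cases l <;> rfl

theorem innerSlice_01 : Nichols.innerSlice (braiding t a b d k ℓ p q) 0 1 =
    0 := by
  ext i l
  fin_cases i <;> fin_cases l <;> rfl

theorem innerSlice_02 : Nichols.innerSlice (braiding t a b d k ℓ p q) 0 2 =
    0 := by
  ext i l
  fin_cases i <;> fin_cases l <;> rfl

theorem innerSlice_10 : Nichols.innerSlice (braiding t a b d k ℓ p q) 1 0 =
    !![-(t*k), 0, 0; -(t*k*ℓ), -(t*ℓ), 0; t*d, t*(p - q), -(t*k)] := by
  ext i l
  fin_cases i <;> fin_cases l <;> rfl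

theorem innerSlice_11 : Nichols.innerSlice (braiding t a b d k ℓ p q) 1 1 =
    !![t, 0, 0; t*ℓ, t, 0; t*q, 0, t] := by
  ext i l
  fin_cases i <;> fin_cases l <;> rfl

theorem innerSlice_12 : Nichols.innerSlice (braiding t a b d k ℓ p q) 1 2 =
    0 := by
  ext i l
  fin_cases i <;> fin_cases l <;> rfl

theorem innerSlice_20 : Nichols.innerSlice (braiding t a b d k ℓ p q) 2 0 =
    !![t*a, 0, 0; t*(k*(a - q) - d), t*a, 0; t*b, 0, t*a] := by
  ext i l
  fin_cases i <;> fin_cases l <;> rfl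

theorem innerSlice_21 : Nichols.innerSlice (braiding t a b d k ℓ p q) 2 1 =
    0 := by
  ext i l
  fin_cases i <;> fin_cases l <;> rfl

theorem innerSlice_22 : Nichols.innerSlice (braiding t a b d k ℓ p q) 2 2 =
    !![t, 0, 0; t*k, t, 0; t*p, 0, t] := by
  ext i l
  fin_cases i <;> fin_cases l <;> rfl

theorem braiding_eq_outerSlice (i j m n : Fin 3) :
    braiding t a b d k ℓ p q i j m n =
      Nichols.outerSlice (braiding t a b d k ℓ p q) i n j m := rfl

/-- The coefficient matrices of the combinations of `relA`. -/
def spaceA : Submodule 𝕜 (Matrix (Fin 3) (Fin 3) 𝕜) where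
  carrier := {S | S 1 1 = 0 ∧ S 2 2 = 0 ∧ S 1 2 = -S 2 1 ∧ S 0 1 = -S 1 0 - q * S 2 1 ∧
    S 0 2 = -S 2 0 + k * S 2 1 ∧ S 0 0 = -(k * S 1 0) - q * S 2 0 - (d + q * k) * S 2 1}
  add_mem' := by
    rintro S T ⟨h1, h2, h3, h4, h5, h6⟩ ⟨g1, g2, g3, g4, g5, g6⟩
    simp only [Set.mem_ofPred_eq, Matrix.add_apply, h1, h2, h3, h4, h5, h6, g1, g2, g3, g4, g5, g6]
    refine ⟨?_, ?_, ?_, ?_, ?_, ?_⟩ <;> ring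
  zero_mem' := by simp
  smul_mem' := by
    rintro c S ⟨h1, h2, h3, h4, h5, h6⟩
    simp only [Set.mem_ofPred_eq, Matrix.smul_apply, smul_eq_mul, h1, h2, h3, h4, h5, h6]
    refine ⟨?_, ?_, ?_, ?_, ?_, ?_⟩ <;> ring

/-- The coefficient matrices of the combinations of `relB`. -/
def spaceB : Submodule 𝕜 (Matrix (Fin 3) (Fin 3) 𝕜) where
  carrier := {S | S 2 2 = 0 ∧ S 1 2 = S 2 1 ∧ S 0 2 = S 2 0 - k * S 2 1 ∧
    S 0 1 = S 1 0 - q * S 2 1 - ℓ * S 1 1}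
  add_mem' := by
    rintro S T ⟨h1, h2, h3, h4⟩ ⟨g1, g2, g3, g4⟩
    refine ⟨?_, ?_, ?_, ?_⟩ <;> simp only [Matrix.add_apply, h1, h2, h3, h4, g1, g2, g3, g4] <;> ring
  zero_mem' := by simp
  smul_mem' := by
    rintro c S ⟨h1, h2, h3, h4⟩
    refine ⟨?_, ?_, ?_, ?_⟩ <;> simp only [Matrix.smul_apply, smul_eq_mul, h1, h2, h3, h4] <;> ring

/-- The coefficient matrices of the combinations of `relC`. -/
def spaceC : Submodule 𝕜 (Matrix (Fin 3) (Fin 3) 𝕜) where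
  carrier := {S | S 1 2 = S 2 1 ∧ S 0 2 = S 2 0 - k * S 2 1 - p * S 2 2 ∧
    S 0 1 = S 1 0 - q * S 2 1 - ℓ * S 1 1}
  add_mem' := by
    rintro S T ⟨h1, h2, h3⟩ ⟨g1, g2, g3⟩
    refine ⟨?_, ?_, ?_⟩ <;> simp only [Matrix.add_apply, h1, h2, h3, g1, g2, g3] <;> ring
  zero_mem' := by simp
  smul_mem' := by
    rintro c S ⟨h1, h2, h3⟩
    refine ⟨?_, ?_, ?_⟩ <;> simp only [Matrix.smul_apply, smul_eq_mul, h1, h2, h3] <;> ring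

/-- The condition on a is forced by x₃x₁ - x₁x₃ - q x₁²: comparing coefficients of x₁² in c(S) = -S
gives p - a - q = q. -/
theorem prim_spaceA (ha : a = p - 2 * q) : ∀ S ∈ spaceA d k q, ∀ m n,
    ∑ i, ∑ j, S i j * braiding 1 a b d k ℓ p q i j m n = - S m n := by
  subst ha
  rintro S ⟨h1, h2, h3, h4, h5, h6⟩ m n
  simp only [Fin.sum_univ_three, braiding_eq_outerSlice]
  fin_cases m <;> fin_cases n <;>
  simp [h1, h2, h3, h4, h5, h6, outerSlice_00, outerSlice_01, outerSlice_02,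
      outerSlice_10, outerSlice_11, outerSlice_12, outerSlice_20, outerSlice_21, outerSlice_22] <;> ring

set_option maxHeartbeats 2000000 in
theorem outerSlice_spaceA (ha : a = p - 2 * q) : ∀ S ∈ spaceA d k q, ∀ i l,
    ∑ m, (Nichols.outerSlice (braiding 1 a b d k ℓ p q) i m).transpose * S *
      Nichols.outerSlice (braiding 1 a b d k ℓ p q) m l ∈ spaceA d k q := by
  subst ha
  rintro S ⟨h1, h2, h3, h4, h5, h6⟩ i l
  simp only [Fin.sum_univ_three]
  fin_cases i <;> fin_cases l <;>
    simp only [Fin.zero_eta, Fin.mk_one, Fin.reduceFinMk, outerSlice_00, outerSlice_01, outerSlice_02,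
      outerSlice_10, outerSlice_11, outerSlice_12, outerSlice_20, outerSlice_21, outerSlice_22,
      Matrix.mul_zero, Matrix.zero_mul, Matrix.transpose_zero, add_zero, zero_add] <;>
    (try exact Submodule.zero_mem _) <;> refine ⟨?_, ?_, ?_, ?_, ?_, ?_⟩ <;>
  simp [Fin.sum_univ_three, Matrix.mul_apply, h1, h2, h3, h4, h5, h6] <;> ring

set_option maxHeartbeats 2000000 in
theorem innerSlice_spaceA (ha : a = p - 2 * q) : ∀ S ∈ spaceA d k q, ∀ n m,
    ∑ m', (Nichols.innerSlice (braiding 1 a b d k ℓ p q) m' m).transpose * S *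
      Nichols.innerSlice (braiding 1 a b d k ℓ p q) n m' ∈ spaceA d k q := by
  subst ha
  rintro S ⟨h1, h2, h3, h4, h5, h6⟩ n m
  simp only [Fin.sum_univ_three]
  fin_cases n <;> fin_cases m <;>
    simp only [Fin.zero_eta, Fin.mk_one, Fin.reduceFinMk, innerSlice_00, innerSlice_01, innerSlice_02,
      innerSlice_10, innerSlice_11, innerSlice_12, innerSlice_20, innerSlice_21, innerSlice_22,
      Matrix.mul_zero, Matrix.zero_mul, Matrix.transpose_zero, add_zero, zero_add] <;>
    (try exact Submodule.zero_mem _) <;> refine ⟨?_, ?_, ?_, ?_, ?_, ?_⟩ <;>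
  simp [Fin.sum_univ_three, Matrix.mul_apply, h1, h2, h3, h4, h5, h6] <;> ring

theorem isHopfIdeal_spaceA (ha : a = p - 2 * q) : Nichols.IsHopfIdeal (braiding 1 a b d k ℓ p q)
    (TwoSidedIdeal.span (Nichols.quad '' (spaceA d k q : Set (Matrix (Fin 3) (Fin 3) 𝕜)))) :=
  Nichols.isHopfIdeal_span_quad (prim_spaceA a b d k ℓ p q ha)
    (outerSlice_spaceA a b d k ℓ p q ha) (innerSlice_spaceA a b d k ℓ p q ha)

/-- On x₃x₁ + x₁x₃ the braiding with t = -1 is -1 up to the term -(p + a) x₁², whence a = -p. -/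
theorem prim_spaceB (ha : a = -p) : ∀ S ∈ spaceB k ℓ q, ∀ m n,
    ∑ i, ∑ j, S i j * braiding (-1) a b d k ℓ p q i j m n = - S m n := by
  subst ha
  rintro S ⟨h1, h2, h3, h4⟩ m n
  simp only [Fin.sum_univ_three, braiding_eq_outerSlice]
  fin_cases m <;> fin_cases n <;>
  simp [h1, h2, h3, h4, outerSlice_00, outerSlice_01, outerSlice_02,
      outerSlice_10, outerSlice_11, outerSlice_12, outerSlice_20, outerSlice_21, outerSlice_22] <;> ring

set_option maxHeartbeats 2000000 in
theorem outerSlice_spaceB (ha : a = -p) : ∀ S ∈ spaceB k ℓ q, ∀ i l,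
    ∑ m, (Nichols.outerSlice (braiding (-1) a b d k ℓ p q) i m).transpose * S *
      Nichols.outerSlice (braiding (-1) a b d k ℓ p q) m l ∈ spaceB k ℓ q := by
  subst ha
  rintro S ⟨h1, h2, h3, h4⟩ i l
  simp only [Fin.sum_univ_three]
  fin_cases i <;> fin_cases l <;>
    simp only [Fin.zero_eta, Fin.mk_one, Fin.reduceFinMk, outerSlice_00, outerSlice_01, outerSlice_02,
      outerSlice_10, outerSlice_11, outerSlice_12, outerSlice_20, outerSlice_21, outerSlice_22,
      Matrix.mul_zero, Matrix.zero_mul, Matrix.transpose_zero, add_zero, zero_add] <;>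
    (try exact Submodule.zero_mem _) <;> refine ⟨?_, ?_, ?_, ?_⟩ <;>
  simp [Fin.sum_univ_three, Matrix.mul_apply, h1, h2, h3, h4] <;> ring

set_option maxHeartbeats 2000000 in
theorem innerSlice_spaceB (ha : a = -p) : ∀ S ∈ spaceB k ℓ q, ∀ n m,
    ∑ m', (Nichols.innerSlice (braiding (-1) a b d k ℓ p q) m' m).transpose * S *
      Nichols.innerSlice (braiding (-1) a b d k ℓ p q) n m' ∈ spaceB k ℓ q := by
  subst ha
  rintro S ⟨h1, h2, h3, h4⟩ n m
  simp only [Fin.sum_univ_three]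
  fin_cases n <;> fin_cases m <;>
    simp only [Fin.zero_eta, Fin.mk_one, Fin.reduceFinMk, innerSlice_00, innerSlice_01, innerSlice_02,
      innerSlice_10, innerSlice_11, innerSlice_12, innerSlice_20, innerSlice_21, innerSlice_22,
      Matrix.mul_zero, Matrix.zero_mul, Matrix.transpose_zero, add_zero, zero_add] <;>
    (try exact Submodule.zero_mem _) <;> refine ⟨?_, ?_, ?_, ?_⟩ <;>
  simp [Fin.sum_univ_three, Matrix.mul_apply, h1, h2, h3, h4] <;> ring

theorem isHopfIdeal_spaceB (ha : a = -p) : Nichols.IsHopfIdeal (braiding (-1) a b d k ℓ p q)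
    (TwoSidedIdeal.span (Nichols.quad '' (spaceB k ℓ q : Set (Matrix (Fin 3) (Fin 3) 𝕜)))) :=
  Nichols.isHopfIdeal_span_quad (prim_spaceB a b d k ℓ p q ha)
    (outerSlice_spaceB a b d k ℓ p q ha) (innerSlice_spaceB a b d k ℓ p q ha)

/-- For x₃² - p x₁x₃ and a = -p the coefficient of x₁² in c(S) is -(b + p²), so this is a new
primitive relation exactly when b = -p². -/
theorem prim_spaceC (ha : a = -p) (hb : b = -p ^ 2) : ∀ S ∈ spaceC k ℓ p q, ∀ m n,
    ∑ i, ∑ j, S i j * braiding (-1) a b d k ℓ p q i j m n = - S m n := by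
  subst ha
  subst hb
  rintro S ⟨h1, h2, h3⟩ m n
  simp only [Fin.sum_univ_three, braiding_eq_outerSlice]
  fin_cases m <;> fin_cases n <;>
  simp [h1, h2, h3, outerSlice_00, outerSlice_01, outerSlice_02,
      outerSlice_10, outerSlice_11, outerSlice_12, outerSlice_20, outerSlice_21, outerSlice_22] <;> ring

set_option maxHeartbeats 2000000 in
theorem outerSlice_spaceC (ha : a = -p) (hb : b = -p ^ 2) : ∀ S ∈ spaceC k ℓ p q, ∀ i l,
    ∑ m, (Nichols.outerSlice (braiding (-1) a b d k ℓ p q) i m).transpose * S *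
      Nichols.outerSlice (braiding (-1) a b d k ℓ p q) m l ∈ spaceC k ℓ p q := by
  subst ha
  subst hb
  rintro S ⟨h1, h2, h3⟩ i l
  simp only [Fin.sum_univ_three]
  fin_cases i <;> fin_cases l <;>
    simp only [Fin.zero_eta, Fin.mk_one, Fin.reduceFinMk, outerSlice_00, outerSlice_01, outerSlice_02,
      outerSlice_10, outerSlice_11, outerSlice_12, outerSlice_20, outerSlice_21, outerSlice_22,
      Matrix.mul_zero, Matrix.zero_mul, Matrix.transpose_zero, add_zero, zero_add] <;>
    (try exact Submodule.zero_mem _) <;> refine ⟨?_, ?_, ?_⟩ <;>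
  simp [Fin.sum_univ_three, Matrix.mul_apply, h1, h2, h3] <;> ring

set_option maxHeartbeats 2000000 in
theorem innerSlice_spaceC (ha : a = -p) (hb : b = -p ^ 2) : ∀ S ∈ spaceC k ℓ p q, ∀ n m,
    ∑ m', (Nichols.innerSlice (braiding (-1) a b d k ℓ p q) m' m).transpose * S *
      Nichols.innerSlice (braiding (-1) a b d k ℓ p q) n m' ∈ spaceC k ℓ p q := by
  subst ha
  subst hb
  rintro S ⟨h1, h2, h3⟩ n m
  simp only [Fin.sum_univ_three]
  fin_cases n <;> fin_cases m <;>
    simp only [Fin.zero_eta, Fin.mk_one, Fin.reduceFinMk, innerSlice_00, innerSlice_01, innerSlice_02,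
      innerSlice_10, innerSlice_11, innerSlice_12, innerSlice_20, innerSlice_21, innerSlice_22,
      Matrix.mul_zero, Matrix.zero_mul, Matrix.transpose_zero, add_zero, zero_add] <;>
    (try exact Submodule.zero_mem _) <;> refine ⟨?_, ?_, ?_⟩ <;>
  simp [Fin.sum_univ_three, Matrix.mul_apply, h1, h2, h3] <;> ring

theorem isHopfIdeal_spaceC (ha : a = -p) (hb : b = -p ^ 2) : Nichols.IsHopfIdeal (braiding (-1) a b d k ℓ p q)
    (TwoSidedIdeal.span (Nichols.quad '' (spaceC k ℓ p q : Set (Matrix (Fin 3) (Fin 3) 𝕜)))) :=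
  Nichols.isHopfIdeal_span_quad (prim_spaceC a b d k ℓ p q ha hb)
    (outerSlice_spaceC a b d k ℓ p q ha hb) (innerSlice_spaceC a b d k ℓ p q ha hb)

end R17

/-! ### Gelfand--Kirillov dimension -/

theorem tendsto_log_mul_pow_div_log {C : ℝ} (hC : 0 < C) (D : ℕ) :
    Filter.Tendsto (fun n : ℕ => ((Real.log (C * (n : ℝ) ^ D) / Real.log n : ℝ) : EReal))
      Filter.atTop (nhds (D : EReal)) := by
  have hlog : Filter.Tendsto (fun n : ℕ => Real.log (n : ℝ)) Filter.atTop Filter.atTop :=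
    Real.tendsto_log_atTop.comp tendsto_natCast_atTop_atTop
  have h1 : Filter.Tendsto (fun n : ℕ => Real.log C / Real.log (n : ℝ) + D) Filter.atTop
      (nhds (0 + D)) := (hlog.const_div_atTop _).add_const _
  rw [zero_add] at h1
  have h2 : (D : EReal) = ((D : ℝ) : EReal) := by simp
  rw [h2]
  refine (continuous_coe_real_ereal.tendsto _).comp (h1.congr' ?_)
  filter_upwards [Filter.eventually_gt_atTop 1] with n hn
  have hn' : (1 : ℝ) < n := by exact_mod_cast hn
  have hpos : 0 < Real.log (n : ℝ) := Real.log_pos hn'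
  rw [Real.log_mul hC.ne' (by positivity), Real.log_pow]
  field_simp

/-- The supremum over W needs an upper bound for every W but a lower bound for a single one;
multiplicative constants disappear after division by log n. -/
theorem gkDim_eq_of_bounds {𝕜 A : Type*} [Field 𝕜] [Ring A] [Algebra 𝕜 A] (D : ℕ)
    (hup : ∀ W : Submodule 𝕜 A, W.FG → ∃ C : ℕ, 0 < C ∧ ∀ n, 0 < n →
      Module.finrank 𝕜 (⨆ i ≤ n, W ^ i : Submodule 𝕜 A) ≤ C * n ^ D)
    (W₀ : Submodule 𝕜 A) (hW₀ : W₀.FG) {c : ℝ} (hc : 0 < c)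
    (hlow : ∀ n : ℕ, 0 < n →
      c * (n : ℝ) ^ D ≤ Module.finrank 𝕜 (⨆ i ≤ n, W₀ ^ i : Submodule 𝕜 A)) :
    gkDim 𝕜 A = D := by
  refine le_antisymm (iSup₂_le fun W hW => ?_) ?_
  · obtain ⟨C, hC, h⟩ := hup W hW
    have hC' : (0 : ℝ) < C := by exact_mod_cast hC
    rw [← (tendsto_log_mul_pow_div_log hC' D).limsup_eq]
    refine Filter.limsup_le_limsup ?_
    filter_upwards [Filter.eventually_gt_atTop 1] with n hn
    rw [EReal.coe_le_coe_iff]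
    have hn' : (1 : ℝ) < n := by exact_mod_cast hn
    refine div_le_div_of_nonneg_right ?_ (Real.log_pos hn').le
    have hb : (Module.finrank 𝕜 (⨆ i ≤ n, W ^ i : Submodule 𝕜 A) : ℝ) ≤ C * (n : ℝ) ^ D := by
      exact_mod_cast h n (by omega)
    -- Monotonicity of the logarithm needs a positive argument. When the rank is 0 the convention
    -- log 0 = 0 applies, and the bound holds because C * n ^ D ≥ 1.
    rcases Nat.eq_zero_or_pos (Module.finrank 𝕜 (⨆ i ≤ n, W ^ i : Submodule 𝕜 A)) with h0 | h0
    · rw [h0, Nat.cast_zero, Real.log_zero]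
      refine Real.log_nonneg ?_
      have h1 : (1 : ℝ) ≤ C := by exact_mod_cast hC
      exact one_le_mul_of_one_le_of_one_le h1 (one_le_pow₀ hn'.le)
    · exact Real.log_le_log (by exact_mod_cast h0) hb
  · refine le_trans ?_ (le_iSup₂ (f := fun (W : Submodule 𝕜 A) (_ : W.FG) =>
      Filter.limsup (fun n : ℕ => ((Real.log (Module.finrank 𝕜 (⨆ i ≤ n, W ^ i : Submodule 𝕜 A)) /
        Real.log n : ℝ) : EReal)) Filter.atTop) W₀ hW₀)
    rw [← (tendsto_log_mul_pow_div_log hc D).limsup_eq]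
    refine Filter.limsup_le_limsup ?_
    filter_upwards [Filter.eventually_gt_atTop 1] with n hn
    rw [EReal.coe_le_coe_iff]
    have hn' : (1 : ℝ) < n := by exact_mod_cast hn
    exact div_le_div_of_nonneg_right (Real.log_le_log (by positivity) (hlow n (by omega)))
      (Real.log_pos hn').le

/-! ### Ordered monomials in three elements -/

section OrderedMonomials

variable {𝕜 A : Type*} [Field 𝕜] [Ring A] [Algebra 𝕜 A] (y : Fin 3 → A)

/-- The ordered monomial `y₀^{e₀} y₁^{e₁} y₂^{e₂}`. -/
def orderedMonomial (e : Fin 3 → ℕ) : A := y 0 ^ e 0 * y 1 ^ e 1 * y 2 ^ e 2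

variable (𝕜) in
/-- The span of the ordered monomials of degree at most `N` with exponents in `E`. -/
def monomialSpan (E : Set (Fin 3 → ℕ)) (N : ℕ) : Submodule 𝕜 A :=
  Submodule.span 𝕜 (orderedMonomial y '' {e | e ∈ E ∧ e 0 + e 1 + e 2 ≤ N})

variable (𝕜) in
/-- The span of `1` and the generators. -/
def generatorSpan : Submodule 𝕜 A := Submodule.span 𝕜 (insert 1 (Set.range y))

variable {y} {E : Set (Fin 3 → ℕ)}

theorem monomialSpan_mono {M N : ℕ} (h : M ≤ N) : monomialSpan 𝕜 y E M ≤ monomialSpan 𝕜 y E N :=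
  Submodule.span_mono (Set.image_mono fun _ he => ⟨he.1, he.2.trans h⟩)

theorem orderedMonomial_mem_monomialSpan {e : Fin 3 → ℕ} (he : e ∈ E) {N : ℕ}
    (h : e 0 + e 1 + e 2 ≤ N) : orderedMonomial y e ∈ monomialSpan 𝕜 y E N :=
  Submodule.subset_span ⟨e, ⟨he, h⟩, rfl⟩

theorem mul_mem_monomialSpan {a : A}
    (h : ∀ e ∈ E, a * orderedMonomial y e ∈ monomialSpan 𝕜 y E (e 0 + e 1 + e 2 + 1))
    {N : ℕ} {f : A} (hf : f ∈ monomialSpan 𝕜 y E N) : a * f ∈ monomialSpan 𝕜 y E (N + 1) := by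
  induction hf using Submodule.span_induction with
  | mem f hf =>
    obtain ⟨e, ⟨he, hN⟩, rfl⟩ := hf
    exact monomialSpan_mono (by omega) (h e he)
  | zero => simp
  | add f g _ _ hf hg => rw [mul_add]; exact Submodule.add_mem _ hf hg
  | smul c f _ hf => rw [mul_smul_comm]; exact Submodule.smul_mem _ _ hf

/-- The hypothesis says that straightening a generator times an ordered monomial never raises the
total degree. A word of length N is therefore a combination of ordered monomials of degree at most
N. -/
theorem generatorSpan_pow_le (h0 : 0 ∈ E)
    (h : ∀ i, ∀ e ∈ E, y i * orderedMonomial y e ∈ monomialSpan 𝕜 y E (e 0 + e 1 + e 2 + 1))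
    (N : ℕ) : generatorSpan 𝕜 y ^ N ≤ monomialSpan 𝕜 y E N := by
  induction N with
  | zero =>
    rw [pow_zero, Submodule.one_eq_span, Submodule.span_le, Set.singleton_subset_iff]
    have := orderedMonomial_mem_monomialSpan (𝕜 := 𝕜) (y := y) h0 (N := 0) (by simp)
    simpa [orderedMonomial] using this
  | succ N ih =>
    rw [pow_succ', Submodule.mul_le]
    intro m hm n hn
    induction hm using Submodule.span_induction with
    | mem f hf =>
      rcases hf with rfl | ⟨i, rfl⟩
      · rw [one_mul]; exact monomialSpan_mono (Nat.le_succ _) (ih hn)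
      · exact mul_mem_monomialSpan (h i) (ih hn)
    | zero => simp
    | add f g _ _ hf hg => rw [add_mul]; exact Submodule.add_mem _ hf hg
    | smul c f _ hf => rw [smul_mul_assoc]; exact Submodule.smul_mem _ _ hf

theorem one_le_generatorSpan : 1 ≤ generatorSpan 𝕜 y := by
  rw [Submodule.one_eq_span, Submodule.span_le, Set.singleton_subset_iff]
  exact Submodule.subset_span (Set.mem_insert _ _)

theorem generatorSpan_pow_mono {M N : ℕ} (h : M ≤ N) :
    generatorSpan 𝕜 y ^ M ≤ generatorSpan 𝕜 y ^ N :=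
  pow_le_pow_right₀ one_le_generatorSpan h

theorem exists_mem_generatorSpan_pow (hy : Algebra.adjoin 𝕜 (Set.range y) = ⊤) (f : A) :
    ∃ N, f ∈ generatorSpan 𝕜 y ^ N := by
  have hf : f ∈ Algebra.adjoin 𝕜 (Set.range y) := hy ▸ Algebra.mem_top
  induction hf using Algebra.adjoin_induction with
  | mem f hf => exact ⟨1, by rw [pow_one]; exact Submodule.subset_span (Or.inr hf)⟩
  | algebraMap c => exact ⟨0, by rw [pow_zero]; exact Submodule.algebraMap_mem c⟩
  | add f g _ _ hf hg =>
    obtain ⟨M, hM⟩ := hf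
    obtain ⟨N, hN⟩ := hg
    exact ⟨max M N, Submodule.add_mem _ (generatorSpan_pow_mono (le_max_left _ _) hM)
      (generatorSpan_pow_mono (le_max_right _ _) hN)⟩
  | mul f g _ _ hf hg =>
    obtain ⟨M, hM⟩ := hf
    obtain ⟨N, hN⟩ := hg
    exact ⟨M + N, by rw [pow_add]; exact Submodule.mul_mem_mul hM hN⟩

theorem exists_le_generatorSpan_pow (hy : Algebra.adjoin 𝕜 (Set.range y) = ⊤)
    {W : Submodule 𝕜 A} (hW : W.FG) : ∃ N, W ≤ generatorSpan 𝕜 y ^ N := by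
  obtain ⟨s, rfl⟩ := hW
  choose N hN using exists_mem_generatorSpan_pow (𝕜 := 𝕜) hy
  exact ⟨s.sup N, Submodule.span_le.2 fun f hf =>
    generatorSpan_pow_mono (Finset.le_sup (f := N) hf) (hN f)⟩

theorem span_orderedMonomial_eq_top (hy : Algebra.adjoin 𝕜 (Set.range y) = ⊤) (h0 : 0 ∈ E)
    (h : ∀ i, ∀ e ∈ E, y i * orderedMonomial y e ∈ monomialSpan 𝕜 y E (e 0 + e 1 + e 2 + 1)) :
    Submodule.span 𝕜 (orderedMonomial y '' E) = ⊤ := by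
  refine eq_top_iff.2 fun f _ => ?_
  obtain ⟨N, hN⟩ := exists_mem_generatorSpan_pow (𝕜 := 𝕜) hy f
  exact Submodule.span_mono (Set.image_mono fun _ he => he.1) (generatorSpan_pow_le h0 h N hN)

theorem orderedMonomial_mem_generatorSpan_pow {e : Fin 3 → ℕ} {N : ℕ}
    (h : e 0 + e 1 + e 2 ≤ N) : orderedMonomial y e ∈ generatorSpan 𝕜 y ^ N := by
  have hy : ∀ i, y i ∈ generatorSpan 𝕜 y := fun i => Submodule.subset_span (Or.inr ⟨i, rfl⟩)
  refine generatorSpan_pow_mono h ?_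
  rw [pow_add, pow_add]
  exact Submodule.mul_mem_mul (Submodule.mul_mem_mul (Submodule.pow_mem_pow _ (hy 0) _)
    (Submodule.pow_mem_pow _ (hy 1) _)) (Submodule.pow_mem_pow _ (hy 2) _)

/-- The Gelfand--Kirillov dimension of an algebra with a basis of ordered monomials is the growth
rate of the set of exponents. -/
theorem gkDim_eq_of_orderedMonomial (hy : Algebra.adjoin 𝕜 (Set.range y) = ⊤) (h0 : 0 ∈ E)
    (h : ∀ i, ∀ e ∈ E, y i * orderedMonomial y e ∈ monomialSpan 𝕜 y E (e 0 + e 1 + e 2 + 1))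
    (hind : LinearIndepOn 𝕜 (orderedMonomial y) E) (D : ℕ) {K : ℕ} (hK : 0 < K)
    (hup : ∀ N, ∃ s : Finset (Fin 3 → ℕ), (∀ e ∈ E, e 0 + e 1 + e 2 ≤ N → e ∈ s) ∧
      s.card ≤ K * (N + 1) ^ D)
    {c : ℝ} (hc : 0 < c)
    (hlow : ∀ n : ℕ, ∃ s : Finset (Fin 3 → ℕ), (∀ e ∈ s, e ∈ E ∧ e 0 + e 1 + e 2 ≤ n) ∧
      c * (n : ℝ) ^ D ≤ s.card) :
    gkDim 𝕜 A = D := by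
  classical
  have hbound : ∀ N, ∃ s : Finset A, generatorSpan 𝕜 y ^ N ≤ Submodule.span 𝕜 (s : Set A) ∧
      s.card ≤ K * (N + 1) ^ D := by
    intro N
    obtain ⟨s, hs, hcard⟩ := hup N
    refine ⟨s.image (orderedMonomial y), (generatorSpan_pow_le h0 h N).trans ?_,
      Finset.card_image_le.trans hcard⟩
    refine Submodule.span_mono ?_
    rintro _ ⟨e, he, rfl⟩
    exact Finset.mem_coe.2 (Finset.mem_image_of_mem _ (hs e he.1 he.2))
  have hsup : ∀ (W : Submodule 𝕜 A) (m n : ℕ), W ≤ generatorSpan 𝕜 y ^ m →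
      (⨆ i ≤ n, W ^ i) ≤ generatorSpan 𝕜 y ^ (m * n) := by
    intro W m n hW
    refine iSup₂_le fun i hi => ?_
    calc W ^ i ≤ (generatorSpan 𝕜 y ^ m) ^ i := pow_le_pow_left₀ bot_le hW i
      _ = generatorSpan 𝕜 y ^ (m * i) := (pow_mul _ _ _).symm
      _ ≤ _ := generatorSpan_pow_mono (Nat.mul_le_mul_left _ hi)
  refine gkDim_eq_of_bounds D ?_ (generatorSpan 𝕜 y) ?_ hc ?_
  · intro W hW
    obtain ⟨m, hm⟩ := exists_le_generatorSpan_pow hy hW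
    -- If W lies in the m-th power of the generator span, its powers up to n lie in the (m * n)-th,
    -- and m * n + 1 ≤ (m + 1) * n because n ≥ 1.
    refine ⟨K * (m + 1) ^ D, by positivity, fun n hn => ?_⟩
    obtain ⟨s, hs, hcard⟩ := hbound (m * n)
    calc Module.finrank 𝕜 (⨆ i ≤ n, W ^ i : Submodule 𝕜 A)
        ≤ Module.finrank 𝕜 (Submodule.span 𝕜 (s : Set A)) :=
          Submodule.finrank_mono ((hsup W m n hm).trans hs)
      _ ≤ s.card := finrank_span_finset_le_card s
      _ ≤ K * (m * n + 1) ^ D := hcard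
      _ ≤ K * ((m + 1) * n) ^ D := by gcongr; nlinarith
      _ = _ := by rw [mul_pow]; ring
  · exact Submodule.fg_span ((Set.finite_range y).insert 1)
  · intro n hn
    obtain ⟨s, hs, hcard⟩ := hlow n
    refine hcard.trans ?_
    have hli : LinearIndependent 𝕜 (fun e : s => orderedMonomial y e) :=
      hind.mono (fun e he => (hs e he).1)
    have h1 := finrank_span_eq_card hli
    rw [Fintype.card_coe] at h1
    rw [← h1]
    -- Comparing ranks requires the larger space to be finite-dimensional; the upper bound for N = n
    -- provides a finite spanning set.
    obtain ⟨t, ht, -⟩ := hbound (1 * n)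
    have h2 := (hsup (generatorSpan 𝕜 y) 1 n (by rw [pow_one])).trans ht
    have : Module.Finite 𝕜 (⨆ i ≤ n, generatorSpan 𝕜 y ^ i : Submodule 𝕜 A) :=
      Submodule.finiteDimensional_of_le h2
    refine Nat.cast_le.2 (Submodule.finrank_mono ?_)
    rw [Submodule.span_le]
    rintro _ ⟨e, rfl⟩
    exact (le_iSup₂ (f := fun i (_ : i ≤ n) => generatorSpan 𝕜 y ^ i) n le_rfl)
      (orderedMonomial_mem_generatorSpan_pow (hs e e.2).2)

end OrderedMonomials

/-! ### Linear independence of ordered monomials -/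

section Independence

variable {𝕜 A : Type*} [Field 𝕜] [Ring A] [Algebra 𝕜 A]

/-- Turns finitely supported functions on E into arrays of coefficients on a box, where one variable
can be eliminated at a time. The sides of the box are left free so that a side of even length can be
chosen later. -/
theorem linearIndepOn_orderedMonomial {y : Fin 3 → A} {E : Set (Fin 3 → ℕ)} (bound : Fin 3 → ℕ → ℕ)
    (hE : ∀ N, ∀ e ∈ E, (∀ i, e i ≤ N) → ∀ i, e i < bound i N)
    (h : ∀ N, ∀ f : ℕ → ℕ → ℕ → 𝕜,
      ∑ c ∈ Finset.range (bound 2 N), ∑ b ∈ Finset.range (bound 1 N),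
        ∑ a ∈ Finset.range (bound 0 N), f a b c • (y 0 ^ a * y 1 ^ b * y 2 ^ c) = 0 →
      ∀ a < bound 0 N, ∀ b < bound 1 N, ∀ c < bound 2 N, f a b c = 0) :
    LinearIndepOn 𝕜 (orderedMonomial y) E := by
  classical
  rw [linearIndepOn_iff]
  intro l hl hsum
  -- The largest total degree in the support bounds every single exponent.
  set N := l.support.sup (fun e => e 0 + e 1 + e 2) with hN
  have hsupp : ∀ e ∈ l.support, ∀ i, e i < bound i N := by
    intro e he
    refine hE N e (hl he) fun i => ?_
    have h1 : e 0 + e 1 + e 2 ≤ N := Finset.le_sup (f := fun e : Fin 3 → ℕ => e 0 + e 1 + e 2) he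
    fin_cases i <;> simp <;> omega
  have hcons : ∀ e : Fin 3 → ℕ, ![e 0, e 1, e 2] = e := by
    intro e; ext i; fin_cases i <;> rfl
  let S : Finset (ℕ × ℕ × ℕ) :=
    Finset.range (bound 2 N) ×ˢ Finset.range (bound 1 N) ×ˢ Finset.range (bound 0 N)
  let φ : ℕ × ℕ × ℕ → (Fin 3 → ℕ) := fun x => ![x.2.2, x.2.1, x.1]
  have hφ : Function.Injective φ := by
    rintro ⟨a, b, c⟩ ⟨a', b', c'⟩ hab
    have h0 := congrFun hab 0
    have h1 := congrFun hab 1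
    have h2 := congrFun hab 2
    simp only [φ, Matrix.cons_val] at h0 h1 h2
    simp [h0, h1, h2]
  have hsub : l.support ⊆ S.image φ := by
    intro e he
    refine Finset.mem_image.2 ⟨(e 2, e 1, e 0), ?_, hcons e⟩
    simp [S, hsupp e he]
  have key := h N (fun a b c => l ![a, b, c]) (by
    rw [Finsupp.linearCombination_apply, Finsupp.sum_of_support_subset l hsub _ (by simp),
      Finset.sum_image hφ.injOn] at hsum
    simpa [S, φ, Finset.sum_product, orderedMonomial] using hsum)
  ext e
  by_contra hne
  have he : e ∈ l.support := Finsupp.mem_support_iff.2 hne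
  have := key _ (hsupp e he 0) _ (hsupp e he 1) _ (hsupp e he 2)
  rw [hcons] at this
  exact hne this

/-- The elements `∑ i < n, h i * y ^ i` with `h i ∈ B`. -/
def degreeLT (B : Subalgebra 𝕜 A) (y : A) (n : ℕ) : Submodule 𝕜 A where
  carrier := {f | ∃ h : ℕ → A, (∀ i, h i ∈ B) ∧ f = ∑ i ∈ Finset.range n, h i * y ^ i}
  add_mem' := by
    rintro _ _ ⟨h, hh, rfl⟩ ⟨h', hh', rfl⟩
    exact ⟨fun i => h i + h' i, fun i => B.add_mem (hh i) (hh' i), by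
      simp [add_mul, Finset.sum_add_distrib]⟩
  zero_mem' := ⟨fun _ => 0, fun _ => B.zero_mem, by simp⟩
  smul_mem' := by
    rintro c _ ⟨h, hh, rfl⟩
    exact ⟨fun i => c • h i, fun i => B.smul_mem (hh i) c, by simp [Finset.smul_sum]⟩

variable {B : Subalgebra 𝕜 A} {x y : A}

theorem mul_pow_mem_degreeLT {g : A} (hg : g ∈ B) {i n : ℕ} (hi : i < n) :
    g * y ^ i ∈ degreeLT B y n := by
  refine ⟨fun j => if j = i then g else 0, fun j => ?_, ?_⟩
  · dsimp only
    split_ifs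
    exacts [hg, B.zero_mem]
  · simp [ite_mul, hi]

theorem degreeLT_mono {m n : ℕ} (h : m ≤ n) : degreeLT B y m ≤ degreeLT B y n := by
  rintro _ ⟨f, hf, rfl⟩
  exact Submodule.sum_mem _ fun i hi =>
    mul_pow_mem_degreeLT (hf i) (lt_of_lt_of_le (Finset.mem_range.1 hi) h)

theorem mul_mem_degreeLT_left {g f : A} (hg : g ∈ B) {n : ℕ} (hf : f ∈ degreeLT B y n) :
    g * f ∈ degreeLT B y n := by
  obtain ⟨h, hh, rfl⟩ := hf
  exact ⟨fun i => g * h i, fun i => B.mul_mem hg (hh i), by simp [Finset.mul_sum, mul_assoc]⟩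

theorem mul_self_mem_degreeLT {f : A} {n : ℕ} (hf : f ∈ degreeLT B y n) :
    f * y ∈ degreeLT B y (n + 1) := by
  obtain ⟨h, hh, rfl⟩ := hf
  rw [Finset.sum_mul]
  refine Submodule.sum_mem _ fun i hi => ?_
  rw [mul_assoc, ← pow_succ]
  exact mul_pow_mem_degreeLT (hh i) (Nat.succ_lt_succ (Finset.mem_range.1 hi))

/-- Moving x to the left through a power of y creates extra factors x, which lie in B, and never
extra factors y. -/
theorem mul_mem_degreeLT_right (hx : x ∈ B) {c : 𝕜} (hyx : y * x = x * y + c • x ^ 2) {n : ℕ}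
    {f : A} (hf : f ∈ degreeLT B y n) : f * x ∈ degreeLT B y n := by
  induction n generalizing f with
  | zero => obtain ⟨h, hh, rfl⟩ := hf; simp
  | succ n ih =>
    have hpow : y ^ n * x ∈ degreeLT B y (n + 1) := by
      cases n with
      | zero => simpa using mul_pow_mem_degreeLT (y := y) hx (Nat.lt_succ_self 0)
      | succ n =>
        have h1 : y ^ n * x ∈ degreeLT B y (n + 1) :=
          ih (by simpa using mul_pow_mem_degreeLT (y := y) B.one_mem (Nat.lt_succ_self n))
        have h2 : y ^ (n + 1) * x = y ^ n * x * y + c • (y ^ n * x * x) := by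
          rw [pow_succ, mul_assoc, hyx, mul_add, mul_smul_comm, pow_two, mul_assoc, mul_assoc]
        rw [h2]
        exact Submodule.add_mem _ (mul_self_mem_degreeLT h1)
          (Submodule.smul_mem _ _ (degreeLT_mono (Nat.le_succ _) (ih h1)))
    obtain ⟨h, hh, rfl⟩ := hf
    rw [Finset.sum_range_succ, add_mul]
    refine Submodule.add_mem _ (degreeLT_mono (Nat.le_succ _) (ih ⟨h, hh, rfl⟩)) ?_
    rw [mul_assoc]
    exact mul_mem_degreeLT_left (hh n) hpow

/-- The powers of `y` are left independent over `B` if a `B`-linear operator `D` lowers their degree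
with nonzero leading coefficients. -/
theorem eq_zero_of_sum_mul_pow_eq_zero [CharZero 𝕜] (D : A →ₗ[𝕜] A)
    (hD : ∀ g ∈ B, ∀ f, D (g * f) = g * D f)
    (hpow : ∀ n : ℕ, D (y ^ (n + 1)) - ((n : 𝕜) + 1) • y ^ n ∈ degreeLT B y n) (hone : D 1 = 0)
    (N : ℕ) (g : ℕ → A) (hg : ∀ i, g i ∈ B) (h : ∑ i ∈ Finset.range N, g i * y ^ i = 0) :
    ∀ i < N, g i = 0 := by
  have hterm : ∀ n, ∀ u ∈ B, D (u * y ^ n) ∈ degreeLT B y n := by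
    intro n u hu
    rw [hD u hu]
    refine mul_mem_degreeLT_left hu ?_
    cases n with
    | zero => simp [hone]
    | succ n =>
      rw [← sub_add_cancel (D (y ^ (n + 1))) (((n : 𝕜) + 1) • y ^ n)]
      refine Submodule.add_mem _ (degreeLT_mono (Nat.le_succ _) (hpow n))
        (Submodule.smul_mem _ _ ?_)
      simpa using mul_pow_mem_degreeLT (y := y) B.one_mem (Nat.lt_succ_self n)
  induction N generalizing g with
  | zero => intro i hi; omega
  | succ N ih =>
    have hlast : g N = 0 := by
      cases N with
      | zero => simpa using h
      | succ M =>
        have h1 : ∑ i ∈ Finset.range (M + 1), D (g i * y ^ i) + D (g (M + 1) * y ^ (M + 1)) = 0 := by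
          rw [← map_sum, ← map_add, ← Finset.sum_range_succ, h, map_zero]
        have h2 : ∑ i ∈ Finset.range (M + 1), D (g i * y ^ i) +
            g (M + 1) * (D (y ^ (M + 1)) - ((M : 𝕜) + 1) • y ^ M) ∈ degreeLT B y M :=
          Submodule.add_mem _ (Submodule.sum_mem _ fun i hi => degreeLT_mono
            (Nat.lt_succ_iff.1 (Finset.mem_range.1 hi)) (hterm i _ (hg i)))
            (mul_mem_degreeLT_left (hg _) (hpow M))
        obtain ⟨u, hu, h3⟩ := h2
        -- Applying D to the relation gives (M + 1) g(M + 1) y ^ M plus terms of lower degree in y.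
        -- These are the coefficients of that shorter relation; the top one vanishes by induction,
        -- and M + 1 ≠ 0 in characteristic zero.
        have h4 := ih (fun i => if i = M then ((M : 𝕜) + 1) • g (M + 1) else u i)
          (fun i => by
            split_ifs
            exacts [B.smul_mem (hg _) _, hu i])
          (by
            rw [Finset.sum_range_succ, if_pos rfl, ← h1, hD _ (hg _)]
            have h5 : ∑ i ∈ Finset.range M,
                (if i = M then ((M : 𝕜) + 1) • g (M + 1) else u i) * y ^ i =
                ∑ i ∈ Finset.range M, u i * y ^ i :=
              Finset.sum_congr rfl fun i hi => by
                rw [if_neg (Finset.mem_range.1 hi).ne]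
            rw [h5, ← h3, mul_sub, mul_smul_comm, smul_mul_assoc]
            abel) M (Nat.lt_succ_self M)
        rw [if_pos rfl] at h4
        exact (smul_eq_zero.1 h4).resolve_left (by exact_mod_cast Nat.succ_ne_zero M)
    rw [Finset.sum_range_succ, hlast, zero_mul, add_zero] at h
    intro i hi
    rcases Nat.lt_succ_iff_lt_or_eq.1 hi with h' | rfl
    exacts [ih g hg h i h', hlast]

/-- Each application of the Leibniz rule adds 1 to the leading coefficient. The correction α • x
only contributes terms in which x has to move left, and this does not raise the degree in y. -/
theorem sub_smul_pow_mem_degreeLT {D : A →ₗ[𝕜] A} (hx : x ∈ B) {c α : 𝕜}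
    (hyx : y * x = x * y + c • x ^ 2) (hone : D 1 = 0)
    (hmul : ∀ n, D (y ^ n * y) = y ^ n + D (y ^ n) * (y + α • x)) (n : ℕ) :
    D (y ^ (n + 1)) - ((n : 𝕜) + 1) • y ^ n ∈ degreeLT B y n := by
  induction n with
  | zero =>
    have := hmul 0
    simp only [pow_zero, one_mul, hone, zero_mul, add_zero] at this
    simp [this]
  | succ n ih =>
    set f := D (y ^ (n + 1)) - ((n : 𝕜) + 1) • y ^ n with hf
    have h1 : D (y ^ (n + 1)) = ((n : 𝕜) + 1) • y ^ n + f := by rw [hf]; abel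
    have h2 : D (y ^ (n + 1 + 1)) - (((n + 1 : ℕ) : 𝕜) + 1) • y ^ (n + 1) =
        f * y + α • (f * x) + (((n : 𝕜) + 1) * α) • (y ^ n * x) := by
      rw [pow_succ, hmul, h1, pow_succ]
      simp only [add_mul, mul_add, smul_mul_assoc, mul_smul_comm]
      push_cast
      module
    rw [h2]
    refine Submodule.add_mem _ (Submodule.add_mem _ (mul_self_mem_degreeLT ih)
      (Submodule.smul_mem _ _ (degreeLT_mono (Nat.le_succ _) (mul_mem_degreeLT_right hx hyx ih))))
      (Submodule.smul_mem _ _ (mul_mem_degreeLT_right hx hyx ?_))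
    simpa using mul_pow_mem_degreeLT (y := y) B.one_mem (Nat.lt_succ_self n)

/-- An operator commuting with left multiplication by generators is linear over the subalgebra they
generate. -/
theorem map_mul_of_mem_adjoin {D : A →ₗ[𝕜] A} {s : Set A} (h : ∀ u ∈ s, ∀ f, D (u * f) = u * D f)
    {g : A} (hg : g ∈ Algebra.adjoin 𝕜 s) (f : A) : D (g * f) = g * D f := by
  induction hg using Algebra.adjoin_induction generalizing f with
  | mem u hu => exact h u hu f
  | algebraMap c => rw [← Algebra.smul_def, map_smul, ← Algebra.smul_def]
  | add u v _ _ hu hv => rw [add_mul, map_add, hu, hv, add_mul]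
  | mul u v _ _ hu hv => rw [mul_assoc, hu, hv, mul_assoc]

end Independence

/-! ### Spanning sets of ordered monomials -/

namespace R17

open Nichols

section Spanning

variable {𝕜 A : Type*} [Field 𝕜] [Ring A] [Algebra 𝕜 A] {y : Fin 3 → A} {d k ℓ p q : 𝕜}
  {E : Set (Fin 3 → ℕ)}

theorem pow_mul_pow_mul_pow_mem {a b c N : ℕ} (he : ![a, b, c] ∈ E) (h : a + b + c ≤ N) :
    y 0 ^ a * y 1 ^ b * y 2 ^ c ∈ monomialSpan 𝕜 y E N :=
  orderedMonomial_mem_monomialSpan (y := y) (e := ![a, b, c]) he h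

/-- The rewriting rules preserve the total degree, and moving a generator past y 0 only yields
further factors y 0. The one real induction is on the number of factors y 1 that y 2 has to cross.
-/
theorem mul_orderedMonomial_mem_expB3 (h1 : y 1 * y 0 = y 0 * y 1 + k • y 0 ^ 2)
    (h2 : y 2 * y 0 = y 0 * y 2 + q • y 0 ^ 2)
    (h3 : y 2 * y 1 = y 1 * y 2 - k • (y 0 * y 2) + q • (y 0 * y 1) + (d + q * k) • y 0 ^ 2)
    (i : Fin 3) (e : Fin 3 → ℕ) :
    y i * orderedMonomial y e ∈ monomialSpan 𝕜 y expB3 (e 0 + e 1 + e 2 + 1) := by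
  have hcomm : ∀ {u : A} {c : 𝕜}, u * y 0 = y 0 * u + c • y 0 ^ 2 → ∀ n : ℕ,
      u * y 0 ^ n = y 0 ^ n * u + ((n : 𝕜) * c) • y 0 ^ (n + 1) := by
    intro u c hu n
    induction n with
    | zero => simp
    | succ n ih =>
      rw [pow_succ, ← mul_assoc, ih, add_mul, mul_assoc, hu, mul_add, smul_mul_assoc,
        mul_smul_comm, ← mul_assoc, ← pow_succ, ← pow_add, ← pow_succ]
      push_cast
      module
  have m0 : ∀ e : Fin 3 → ℕ, e ∈ expB3 →
      y 0 * orderedMonomial y e ∈ monomialSpan 𝕜 y expB3 (e 0 + e 1 + e 2 + 1) := by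
    intro e _
    rw [orderedMonomial, ← mul_assoc, ← mul_assoc, ← pow_succ']
    exact pow_mul_pow_mul_pow_mem (Set.mem_univ _) (by omega)
  have m1 : ∀ e : Fin 3 → ℕ, e ∈ expB3 →
      y 1 * orderedMonomial y e ∈ monomialSpan 𝕜 y expB3 (e 0 + e 1 + e 2 + 1) := by
    intro e _
    rw [orderedMonomial, ← mul_assoc, ← mul_assoc, hcomm h1, add_mul, add_mul, mul_assoc (y 0 ^ e 0),
      ← pow_succ', smul_mul_assoc, smul_mul_assoc]
    exact Submodule.add_mem _ (pow_mul_pow_mul_pow_mem (Set.mem_univ _) (by omega))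
      (Submodule.smul_mem _ _ (pow_mul_pow_mul_pow_mem (Set.mem_univ _) (by omega)))
  have m2' : ∀ b c : ℕ, y 2 * (y 1 ^ b * y 2 ^ c) ∈ monomialSpan 𝕜 y expB3 (b + c + 1) := by
    intro b c
    have hmem : ∀ b, y 1 ^ b * y 2 ^ c ∈ monomialSpan 𝕜 y expB3 (b + c) := by
      intro b
      have := pow_mul_pow_mul_pow_mem (𝕜 := 𝕜) (y := y) (E := expB3) (a := 0) (b := b) (c := c)
        (N := b + c) (Set.mem_univ _) (by omega)
      simpa using this
    induction b with
    | zero =>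
      have := pow_mul_pow_mul_pow_mem (𝕜 := 𝕜) (y := y) (E := expB3) (a := 0) (b := 0) (c := c + 1)
        (N := 0 + c + 1) (Set.mem_univ _) (by omega)
      simpa [pow_succ'] using this
    | succ b ih =>
      have e1 : y 2 * (y 1 ^ (b + 1) * y 2 ^ c) = y 1 * (y 2 * (y 1 ^ b * y 2 ^ c)) -
          k • (y 0 * (y 2 * (y 1 ^ b * y 2 ^ c))) + q • (y 0 * (y 1 ^ (b + 1) * y 2 ^ c)) +
          (d + q * k) • (y 0 * (y 0 * (y 1 ^ b * y 2 ^ c))) := by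
        have : y 2 * (y 1 ^ (b + 1) * y 2 ^ c) = (y 2 * y 1) * (y 1 ^ b * y 2 ^ c) := by
          rw [pow_succ']; simp only [mul_assoc]
        rw [this, h3, pow_succ' (y 1), pow_two]
        simp only [add_mul, sub_mul, smul_mul_assoc, mul_assoc]
      have hN : b + 1 + c + 1 = b + c + 1 + 1 := by omega
      rw [e1, hN]
      refine Submodule.add_mem _ (Submodule.add_mem _ (Submodule.sub_mem _ ?_
        (Submodule.smul_mem _ _ ?_)) (Submodule.smul_mem _ _ ?_)) (Submodule.smul_mem _ _ ?_)
      · exact mul_mem_monomialSpan m1 ih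
      · exact mul_mem_monomialSpan m0 ih
      · have := mul_mem_monomialSpan m0 (hmem (b + 1))
        rwa [show b + 1 + c = b + c + 1 by omega] at this
      · exact mul_mem_monomialSpan m0 (mul_mem_monomialSpan m0 (hmem b))
  have hpow : ∀ (a N : ℕ) (f : A), f ∈ monomialSpan 𝕜 y expB3 N →
      y 0 ^ a * f ∈ monomialSpan 𝕜 y expB3 (N + a) := by
    intro a N f hf
    induction a with
    | zero => simpa using hf
    | succ a ih => rw [pow_succ', mul_assoc]; exact mul_mem_monomialSpan m0 ih
  fin_cases i
  · exact m0 e (Set.mem_univ _)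
  · exact m1 e (Set.mem_univ _)
  · change y 2 * orderedMonomial y e ∈ _
    have e1 : y 2 * orderedMonomial y e = y 0 ^ e 0 * (y 2 * (y 1 ^ e 1 * y 2 ^ e 2)) +
        ((e 0 : 𝕜) * q) • (y 0 ^ (e 0 + 1) * y 1 ^ e 1 * y 2 ^ e 2) := by
      rw [orderedMonomial, ← mul_assoc, ← mul_assoc, hcomm h2]
      simp only [add_mul, smul_mul_assoc, mul_assoc]
    rw [e1]
    refine Submodule.add_mem _ ?_
      (Submodule.smul_mem _ _ (pow_mul_pow_mul_pow_mem (Set.mem_univ _) (by omega)))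
    exact monomialSpan_mono (by omega) (hpow (e 0) _ _ (m2' (e 1) (e 2)))

/-- Common part of the spanning arguments for `expB1` and `expB0`. -/
theorem mul_orderedMonomial_mem_of_lt_two (h1 : y 1 * y 0 = -(y 0 * y 1))
    (h2 : y 2 * y 0 = -(y 0 * y 2))
    (h3 : y 2 * y 1 = -(y 1 * y 2) + k • (y 0 * y 2) + q • (y 0 * y 1))
    (h4 : y 0 * y 0 = 0) (h5 : y 1 * y 1 = ℓ • (y 0 * y 1)) {C : Set ℕ}
    (hE : ∀ e, e ∈ E ↔ e 0 < 2 ∧ e 1 < 2 ∧ e 2 ∈ C)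
    (hC : ∀ c ∈ C, y 2 ^ (c + 1) ∈ monomialSpan 𝕜 y E (c + 1))
    (i : Fin 3) (e : Fin 3 → ℕ) (he : e ∈ E) :
    y i * orderedMonomial y e ∈ monomialSpan 𝕜 y E (e 0 + e 1 + e 2 + 1) := by
  have h4' : ∀ f, y 0 * (y 0 * f) = 0 := fun f => by rw [← mul_assoc, h4, zero_mul]
  have h5' : ∀ f, y 1 * (y 1 * f) = ℓ • (y 0 * (y 1 * f)) := fun f => by
    rw [← mul_assoc, h5, smul_mul_assoc, mul_assoc]
  have h1' : ∀ f, y 1 * (y 0 * f) = -(y 0 * (y 1 * f)) := fun f => by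
    rw [← mul_assoc, h1, neg_mul, mul_assoc]
  have h2' : ∀ f, y 2 * (y 0 * f) = -(y 0 * (y 2 * f)) := fun f => by
    rw [← mul_assoc, h2, neg_mul, mul_assoc]
  have h3' : ∀ f, y 2 * (y 1 * f) = -(y 1 * (y 2 * f)) + k • (y 0 * (y 2 * f)) +
      q • (y 0 * (y 1 * f)) := fun f => by
    rw [← mul_assoc, h3, add_mul, add_mul, neg_mul, smul_mul_assoc, smul_mul_assoc]
    simp only [mul_assoc]
  have mem : ∀ a b c N, a < 2 → b < 2 → c ∈ C → a + b + c ≤ N →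
      y 0 ^ a * (y 1 ^ b * y 2 ^ c) ∈ monomialSpan 𝕜 y E N := by
    intro a b c N ha hb hc hN
    rw [← mul_assoc]
    exact pow_mul_pow_mul_pow_mem ((hE _).2 ⟨ha, hb, hc⟩) hN
  have mem00 : ∀ c ∈ C, ∀ N, c ≤ N → y 2 ^ c ∈ monomialSpan 𝕜 y E N := fun c hc N hN => by
    simpa using mem 0 0 c N (by omega) (by omega) hc (by omega)
  have mem10 : ∀ c ∈ C, ∀ N, c + 1 ≤ N → y 0 * y 2 ^ c ∈ monomialSpan 𝕜 y E N :=
    fun c hc N hN => by simpa using mem 1 0 c N (by omega) (by omega) hc (by omega)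
  have mem01 : ∀ c ∈ C, ∀ N, c + 1 ≤ N → y 1 * y 2 ^ c ∈ monomialSpan 𝕜 y E N :=
    fun c hc N hN => by simpa using mem 0 1 c N (by omega) (by omega) hc (by omega)
  have mem11 : ∀ c ∈ C, ∀ N, c + 2 ≤ N → y 0 * (y 1 * y 2 ^ c) ∈ monomialSpan 𝕜 y E N :=
    fun c hc N hN => by simpa using mem 1 1 c N (by omega) (by omega) hc (by omega)
  -- The exponents of y 0 and y 1 are at most 1, so left multiplication by u is decided by four
  -- shapes of monomials.
  have cases_mem : ∀ u : A, (∀ c ∈ C, u * y 2 ^ c ∈ monomialSpan 𝕜 y E (c + 1)) →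
      (∀ c ∈ C, u * (y 1 * y 2 ^ c) ∈ monomialSpan 𝕜 y E (c + 2)) →
      (∀ c ∈ C, u * (y 0 * y 2 ^ c) ∈ monomialSpan 𝕜 y E (c + 2)) →
      (∀ c ∈ C, u * (y 0 * (y 1 * y 2 ^ c)) ∈ monomialSpan 𝕜 y E (c + 3)) →
      ∀ e ∈ E, u * orderedMonomial y e ∈ monomialSpan 𝕜 y E (e 0 + e 1 + e 2 + 1) := by
    intro u c00 c01 c10 c11 e he
    obtain ⟨ha, hb, hc⟩ := (hE e).1 he
    rw [orderedMonomial, mul_assoc (y 0 ^ e 0)]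
    generalize e 0 = a at *
    generalize e 1 = b at *
    generalize e 2 = c at *
    interval_cases a <;> interval_cases b <;>
      simp only [pow_zero, pow_one, one_mul]
    · exact monomialSpan_mono (by omega) (c00 c hc)
    · exact monomialSpan_mono (by omega) (c01 c hc)
    · exact monomialSpan_mono (by omega) (c10 c hc)
    · exact monomialSpan_mono (by omega) (c11 c hc)
  have m0 : ∀ e ∈ E, y 0 * orderedMonomial y e ∈ monomialSpan 𝕜 y E (e 0 + e 1 + e 2 + 1) := by
    refine cases_mem _ (fun c hc => mem10 c hc _ le_rfl) (fun c hc => mem11 c hc _ le_rfl) ?_ ?_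
    · intro c _; rw [h4']; exact Submodule.zero_mem _
    · intro c _; rw [h4']; exact Submodule.zero_mem _
  have m1 : ∀ e ∈ E, y 1 * orderedMonomial y e ∈ monomialSpan 𝕜 y E (e 0 + e 1 + e 2 + 1) := by
    refine cases_mem _ (fun c hc => mem01 c hc _ le_rfl) ?_ ?_ ?_
    · intro c hc; rw [h5']; exact Submodule.smul_mem _ _ (mem11 c hc _ le_rfl)
    · intro c hc; rw [h1']; exact Submodule.neg_mem _ (mem11 c hc _ le_rfl)
    · intro c hc
      rw [h1', h5', mul_smul_comm, h4', smul_zero, neg_zero]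
      exact Submodule.zero_mem _
  have m2 : ∀ e ∈ E, y 2 * orderedMonomial y e ∈ monomialSpan 𝕜 y E (e 0 + e 1 + e 2 + 1) := by
    have c00 : ∀ c ∈ C, y 2 * y 2 ^ c ∈ monomialSpan 𝕜 y E (c + 1) := fun c hc => by
      rw [← pow_succ']; exact hC c hc
    have c01 : ∀ c ∈ C, y 2 * (y 1 * y 2 ^ c) ∈ monomialSpan 𝕜 y E (c + 2) := by
      intro c hc
      rw [h3']
      exact Submodule.add_mem _ (Submodule.add_mem _
        (Submodule.neg_mem _ (mul_mem_monomialSpan m1 (c00 c hc)))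
        (Submodule.smul_mem _ _ (mul_mem_monomialSpan m0 (c00 c hc))))
        (Submodule.smul_mem _ _ (mem11 c hc _ le_rfl))
    refine cases_mem _ c00 c01 ?_ ?_
    · intro c hc
      rw [h2']
      exact Submodule.neg_mem _ (mul_mem_monomialSpan m0 (c00 c hc))
    · intro c hc
      rw [h2']
      exact Submodule.neg_mem _ (mul_mem_monomialSpan m0 (c01 c hc))
  fin_cases i
  exacts [m0 e he, m1 e he, m2 e he]

theorem mul_orderedMonomial_mem_expB1 (h1 : y 1 * y 0 = -(y 0 * y 1))
    (h2 : y 2 * y 0 = -(y 0 * y 2))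
    (h3 : y 2 * y 1 = -(y 1 * y 2) + k • (y 0 * y 2) + q • (y 0 * y 1))
    (h4 : y 0 * y 0 = 0) (h5 : y 1 * y 1 = ℓ • (y 0 * y 1))
    (i : Fin 3) (e : Fin 3 → ℕ) (he : e ∈ expB1) :
    y i * orderedMonomial y e ∈ monomialSpan 𝕜 y expB1 (e 0 + e 1 + e 2 + 1) := by
  refine mul_orderedMonomial_mem_of_lt_two (C := Set.univ) h1 h2 h3 h4 h5
    (fun e => by simp [expB1]) (fun c _ => ?_) i e he
  have := pow_mul_pow_mul_pow_mem (𝕜 := 𝕜) (y := y) (E := expB1) (a := 0) (b := 0) (c := c + 1)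
    (N := c + 1) (by simp [expB1]) (by omega)
  simpa using this

theorem mul_orderedMonomial_mem_expB0 (h1 : y 1 * y 0 = -(y 0 * y 1))
    (h2 : y 2 * y 0 = -(y 0 * y 2))
    (h3 : y 2 * y 1 = -(y 1 * y 2) + k • (y 0 * y 2) + q • (y 0 * y 1))
    (h4 : y 0 * y 0 = 0) (h5 : y 1 * y 1 = ℓ • (y 0 * y 1)) (h6 : y 2 * y 2 = p • (y 0 * y 2))
    (i : Fin 3) (e : Fin 3 → ℕ) (he : e ∈ expB0) :
    y i * orderedMonomial y e ∈ monomialSpan 𝕜 y expB0 (e 0 + e 1 + e 2 + 1) := by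
  refine mul_orderedMonomial_mem_of_lt_two (C := {c | c < 2}) h1 h2 h3 h4 h5
    (fun e => by simp [expB0, Fin.forall_fin_succ]) (fun c hc => ?_) i e he
  have hc' : c < 2 := hc
  interval_cases c
  · have := pow_mul_pow_mul_pow_mem (𝕜 := 𝕜) (y := y) (E := expB0) (a := 0) (b := 0) (c := 1)
      (N := 1) (by simp [expB0, Fin.forall_fin_succ]) (by omega)
    simpa using this
  · have := pow_mul_pow_mul_pow_mem (𝕜 := 𝕜) (y := y) (E := expB0) (a := 1) (b := 0) (c := 1)
      (N := 2) (by simp [expB0, Fin.forall_fin_succ]) (by omega)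
    rw [pow_two, h6]
    exact Submodule.smul_mem _ _ (by simpa using this)

end Spanning

end R17

namespace Nichols

variable {𝕜 : Type*} [Field 𝕜] {X : Type*} [Fintype X] [DecidableEq X]

theorem nicholsDer_one (r : X → X → X → X → 𝕜) (l : X) : nicholsDer r l 1 = 0 := by
  rw [← map_one (proj r), nicholsDer_proj, skewDer_one, map_zero]

theorem nicholsDer_gen (r : X → X → X → X → 𝕜) (l i : X) :
    nicholsDer r l (gen r i) = if i = l then 1 else 0 := by
  rw [← proj_ι, nicholsDer_proj, skewDer_ι]
  split_ifs <;> simp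

/-- Right multiplication by generators in terms of the coefficients of the braiding. -/
theorem nicholsDer_mul_gen (r : X → X → X → X → 𝕜) (l i : X) (f : NicholsAlgebra r) :
    nicholsDer r l (f * gen r i) = (if i = l then f else 0) +
      ∑ j, nicholsDer r j f * ∑ m, r j i m l • gen r m := by
  obtain ⟨f, rfl⟩ := proj_surjective r f
  rw [← proj_ι, ← map_mul, nicholsDer_proj, skewDer_mul, skewDer_ι]
  simp only [braidMatrix_ι, map_add, map_sum, map_mul, nicholsDer_proj, map_smul, proj_ι]
  congr 1
  split_ifs <;> simp

/-- If the braiding never moves `x_i` to `x_l`, then left multiplication by `x_i` commutes with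
`∂_l`. -/
theorem nicholsDer_gen_mul {r : X → X → X → X → 𝕜} {l i : X}
    (h : ∀ f, braidMatrix r f i l = 0) (f : NicholsAlgebra r) :
    nicholsDer r l (gen r i * f) = gen r i * nicholsDer r l f := by
  obtain ⟨f, rfl⟩ := proj_surjective r f
  rw [← proj_ι, ← map_mul, nicholsDer_proj, skewDer_ι_mul, nicholsDer_proj, h, add_zero, map_mul]

theorem adjoin_range_mkₐ_ι (I : TwoSidedIdeal (FreeAlgebra 𝕜 X)) :
    Algebra.adjoin 𝕜 (Set.range fun i => I.ringCon.mkₐ 𝕜 (FreeAlgebra.ι 𝕜 i)) = ⊤ := by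
  have h1 : (Set.range fun i => I.ringCon.mkₐ 𝕜 (FreeAlgebra.ι 𝕜 i)) =
      I.ringCon.mkₐ 𝕜 '' Set.range (FreeAlgebra.ι 𝕜) := by
    rw [← Set.range_comp]; rfl
  rw [h1, ← AlgHom.map_adjoin, FreeAlgebra.adjoin_range_ι, Algebra.map_top]
  exact (AlgHom.range_eq_top _).2 (RingCon.mkₐ_surjective _)

theorem mkₐ_eq_zero_iff (I : TwoSidedIdeal (FreeAlgebra 𝕜 X)) {f : FreeAlgebra 𝕜 X} :
    I.ringCon.mkₐ 𝕜 f = 0 ↔ f ∈ I := by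
  rw [TwoSidedIdeal.mem_iff, ← RingCon.eq]
  rfl

theorem map_orderedMonomial {A B : Type*} [Ring A] [Algebra 𝕜 A] [Ring B] [Algebra 𝕜 B]
    (φ : A →ₐ[𝕜] B) (x : Fin 3 → A) (e : Fin 3 → ℕ) :
    φ (orderedMonomial x e) = orderedMonomial (fun i => φ (x i)) e := by
  simp [orderedMonomial]

/-- A Hopf ideal is the defining ideal of the Nichols algebra as soon as some ordered monomials span
its quotient and are linearly independent in the Nichols algebra. -/
theorem nicholsIdeal_eq_of_orderedMonomial {r : Fin 3 → Fin 3 → Fin 3 → Fin 3 → 𝕜}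
    {I : TwoSidedIdeal (FreeAlgebra 𝕜 (Fin 3))} (hI : IsHopfIdeal r I) {E : Set (Fin 3 → ℕ)}
    (hspan : Submodule.span 𝕜 (orderedMonomial
      (fun i => I.ringCon.mkₐ 𝕜 (FreeAlgebra.ι 𝕜 i)) '' E) = ⊤)
    (hind : LinearIndepOn 𝕜 (orderedMonomial (gen r)) E) : nicholsIdeal r = I := by
  have hIJ : I ≤ nicholsIdeal r := (nicholsIdeal_isGreatest r).2 hI
  refine le_antisymm (fun f hf => ?_) hIJ
  have h1 : I.ringCon.mkₐ 𝕜 f ∈ Submodule.span 𝕜 (orderedMonomial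
      (fun i => I.ringCon.mkₐ 𝕜 (FreeAlgebra.ι 𝕜 i)) '' E) := hspan ▸ Submodule.mem_top
  rw [Finsupp.mem_span_image_iff_linearCombination] at h1
  obtain ⟨l, hl, hlf⟩ := h1
  -- Lift the normal form of f modulo I to T(V). Then f - g ∈ I ⊆ J, so f ∈ J makes the same
  -- combination of monomials vanish in the Nichols algebra; its coefficients are zero and f ∈ I.
  set g := Finsupp.linearCombination 𝕜 (orderedMonomial (FreeAlgebra.ι 𝕜 (X := Fin 3))) l with hg
  have h2 : I.ringCon.mkₐ 𝕜 g = I.ringCon.mkₐ 𝕜 f := by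
    rw [← hlf, hg, Finsupp.linearCombination_apply, Finsupp.linearCombination_apply, Finsupp.sum,
      Finsupp.sum, map_sum]
    simp only [map_smul, map_orderedMonomial]
  have h3 : f - g ∈ I := by rw [← mkₐ_eq_zero_iff, map_sub, h2, sub_self]
  have h4 : proj r g = 0 := by
    have : proj r (f - g) = 0 := (proj_eq_zero_iff r).2 (hIJ h3)
    rw [map_sub, (proj_eq_zero_iff r).2 hf, zero_sub, neg_eq_zero] at this
    exact this
  have h5 : Finsupp.linearCombination 𝕜 (orderedMonomial (gen r)) l = 0 := by
    rw [← h4, hg, Finsupp.linearCombination_apply, Finsupp.linearCombination_apply, Finsupp.sum,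
      Finsupp.sum, map_sum]
    simp only [map_smul, map_orderedMonomial, proj_ι]
  have h6 : l = 0 := linearIndepOn_iff.1 hind l hl h5
  rw [hg, h6, map_zero, sub_zero] at h3
  exact h3

theorem isMonomialBasis_of_orderedMonomial {r : Fin 3 → Fin 3 → Fin 3 → Fin 3 → 𝕜}
    {E : Set (Fin 3 → ℕ)} (hspan : Submodule.span 𝕜 (orderedMonomial (gen r) '' E) = ⊤)
    (hind : LinearIndepOn 𝕜 (orderedMonomial (gen r)) E) : IsMonomialBasis r E := by
  refine ⟨Module.Basis.mk hind ?_, fun e => ?_⟩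
  · rw [← Set.image_eq_range, hspan]
  · exact Module.Basis.mk_apply _ _ _

end Nichols

/-! ### Explicit skew derivations for the braiding of type (1,7) -/

namespace R17

open Nichols

variable {𝕜 : Type*} [Field 𝕜]

/-- Lower triangular matrices are closed under products, and the matrices of the generators are
lower triangular since the outer slices 01, 02 and 12 vanish. -/
theorem braidMatrix_eq_zero (t a b d k ℓ p q : 𝕜) (f : FreeAlgebra 𝕜 (Fin 3)) :
    ∀ i l, i < l → braidMatrix (braiding t a b d k ℓ p q) f i l = 0 := by
  induction f using FreeAlgebra.induction with
  | grade0 c =>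
    intro i l hil
    rw [AlgHom.commutes, Matrix.algebraMap_matrix_apply, if_neg hil.ne]
  | grade1 n =>
    intro i l hil
    rw [braidMatrix_ι]
    simp only [braiding_eq_outerSlice]
    fin_cases i <;> fin_cases l <;> simp at hil <;>
      simp [outerSlice_01, outerSlice_02, outerSlice_12]
  | mul f g hf hg =>
    intro i l hil
    rw [map_mul, Matrix.mul_apply]
    refine Finset.sum_eq_zero fun j _ => ?_
    rcases lt_or_ge i j with h | h
    · rw [hf i j h, zero_mul]
    · rw [hg j l (h.trans_lt hil), mul_zero]
  | add f g hf hg =>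
    intro i l hil
    rw [map_add, Matrix.add_apply, hf i l hil, hg i l hil, add_zero]

variable {t a b d k ℓ p q : 𝕜}

local notation "Q" => NicholsAlgebra (braiding t a b d k ℓ p q)
local notation "y" => gen (braiding t a b d k ℓ p q)
local notation "∂" => nicholsDer (braiding t a b d k ℓ p q)

theorem der_gen_mul {i l : Fin 3} (h : i < l) (f : Q) : ∂ l (y i * f) = y i * ∂ l f :=
  nicholsDer_gen_mul (fun f => braidMatrix_eq_zero t a b d k ℓ p q f i l h) f

theorem der_zero_mul_gen_zero (f : Q) : ∂ 0 (f * y 0) = f + ∂ 0 f * t • y 0 +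
    ∂ 1 f * (t * k) • y 0 + ∂ 2 f * (t * p) • y 0 := by
  rw [nicholsDer_mul_gen]
  simp [Fin.sum_univ_three, braiding_eq_outerSlice, outerSlice_00, outerSlice_10, outerSlice_20,
    add_assoc]

theorem der_one_mul_gen_one (f : Q) : ∂ 1 (f * y 1) = f + ∂ 1 f * (t • y 1 - (t * ℓ) • y 0) +
    ∂ 2 f * (t * (p - q)) • y 0 := by
  rw [nicholsDer_mul_gen]
  simp [Fin.sum_univ_three, braiding_eq_outerSlice, outerSlice_01, outerSlice_11, outerSlice_21,
    add_assoc, sub_eq_neg_add]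

theorem der_two_mul_gen_two (f : Q) : ∂ 2 (f * y 2) = f + ∂ 2 f * (t • y 2 + (t * a) • y 0) := by
  rw [nicholsDer_mul_gen]
  simp [Fin.sum_univ_three, braiding_eq_outerSlice, outerSlice_02, outerSlice_12, outerSlice_22,
    add_comm]

theorem der_two_mul_gen_zero (f : Q) : ∂ 2 (f * y 0) = ∂ 2 f * t • y 0 := by
  rw [nicholsDer_mul_gen]
  simp [Fin.sum_univ_three, braiding_eq_outerSlice, outerSlice_02, outerSlice_12, outerSlice_22]

theorem der_one_mul_gen_zero (f : Q) : ∂ 1 (f * y 0) = ∂ 1 f * t • y 0 := by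
  rw [nicholsDer_mul_gen]
  simp [Fin.sum_univ_three, braiding_eq_outerSlice, outerSlice_01, outerSlice_11, outerSlice_21]

theorem der_one_mul_gen_two (f : Q) : ∂ 1 (f * y 2) = ∂ 1 f * (t • y 2 + (t * a) • y 0) := by
  rw [nicholsDer_mul_gen]
  simp [Fin.sum_univ_three, braiding_eq_outerSlice, outerSlice_01, outerSlice_11, outerSlice_21,
    add_comm]

theorem der_zero_mul_gen_two (f : Q) : ∂ 0 (f * y 2) = ∂ 0 f * (t • y 2 + (t * a) • y 0) +
    ∂ 1 f * ((t * k) • y 2 + (t * (k * (a - q) - d)) • y 0) +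
    ∂ 2 f * ((t * p) • y 2 + (t * b) • y 0) := by
  rw [nicholsDer_mul_gen]
  simp [Fin.sum_univ_three, braiding_eq_outerSlice, outerSlice_00, outerSlice_10, outerSlice_20,
    add_comm]

theorem der_pow_eq_zero {i l : Fin 3} (h : i < l) (n : ℕ) : ∂ l (y i ^ n) = 0 := by
  induction n with
  | zero => rw [pow_zero, nicholsDer_one]
  | succ n ih => rw [pow_succ', der_gen_mul h, ih, mul_zero]

end R17

namespace R17

open Nichols

variable {𝕜 : Type*} [Field 𝕜]

theorem sum_range_two_mul {A : Type*} [AddCommMonoid A] (F : ℕ → A) (M : ℕ) :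
    ∑ n ∈ Finset.range (2 * M), F n = ∑ m ∈ Finset.range M, (F (2 * m) + F (2 * m + 1)) := by
  induction M with
  | zero => simp
  | succ M ih =>
    rw [Nat.mul_succ, Finset.sum_range_succ, Finset.sum_range_succ, Finset.sum_range_succ, ih,
      add_assoc]

theorem der_mul_of_mem_adjoin (t a b d k ℓ p q : 𝕜) {l : Fin 3}
    {s : Set (NicholsAlgebra (braiding t a b d k ℓ p q))}
    (hs : ∀ u ∈ s, ∃ i < l, u = gen (braiding t a b d k ℓ p q) i)
    {g : NicholsAlgebra (braiding t a b d k ℓ p q)} (hg : g ∈ Algebra.adjoin 𝕜 s)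
    (f : NicholsAlgebra (braiding t a b d k ℓ p q)) :
    nicholsDer (braiding t a b d k ℓ p q) l (g * f) =
      g * nicholsDer (braiding t a b d k ℓ p q) l f := by
  refine map_mul_of_mem_adjoin (fun u hu f => ?_) hg f
  obtain ⟨i, hi, rfl⟩ := hs u hu
  exact der_gen_mul hi f

/-! ### The case `t = 1` -/

section One

variable {a b d k ℓ p q : 𝕜}

local notation "Q" => NicholsAlgebra (braiding 1 a b d k ℓ p q)
local notation "y" => gen (braiding 1 a b d k ℓ p q)
local notation "∂" => nicholsDer (braiding 1 a b d k ℓ p q)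

/-- Along 𝕜 ⊆ 𝕜[y 0] ⊆ 𝕜⟨y 0, y 1⟩ ⊆ Q, the operators `∂ 0`, `∂ 1`, `∂ 2` are linear over the first,
second and third algebra, and each acts on powers of the next generator like a derivative. A
relation is thus resolved from the powers of y 2 down to scalars. -/
theorem linearIndepOn_expB3 [CharZero 𝕜] (h1 : y 1 * y 0 = y 0 * y 1 + k • y 0 ^ 2)
    (h2 : y 2 * y 0 = y 0 * y 2 + q • y 0 ^ 2) : LinearIndepOn 𝕜 (orderedMonomial y) expB3 := by
  have hD2 : ∀ g ∈ Algebra.adjoin 𝕜 ({y 0, y 1} : Set Q), ∀ f, ∂ 2 (g * f) = g * ∂ 2 f := by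
    intro g hg f
    refine der_mul_of_mem_adjoin 1 a b d k ℓ p q ?_ hg f
    rintro u (rfl | rfl)
    exacts [⟨0, by decide, rfl⟩, ⟨1, by decide, rfl⟩]
  have hD1 : ∀ g ∈ Algebra.adjoin 𝕜 ({y 0} : Set Q), ∀ f, ∂ 1 (g * f) = g * ∂ 1 f := by
    intro g hg f
    refine der_mul_of_mem_adjoin 1 a b d k ℓ p q ?_ hg f
    rintro u rfl
    exact ⟨0, by decide, rfl⟩
  have hD0 : ∀ g ∈ (⊥ : Subalgebra 𝕜 Q), ∀ f, ∂ 0 (g * f) = g * ∂ 0 f := by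
    intro g hg f
    obtain ⟨c, rfl⟩ := Algebra.mem_bot.1 hg
    rw [← Algebra.smul_def, map_smul, ← Algebra.smul_def]
  have y0_mem : y 0 ∈ Algebra.adjoin 𝕜 ({y 0, y 1} : Set Q) :=
    Algebra.subset_adjoin (Set.mem_insert _ _)
  have y1_mem : y 1 ∈ Algebra.adjoin 𝕜 ({y 0, y 1} : Set Q) :=
    Algebra.subset_adjoin (Set.mem_insert_of_mem _ rfl)
  have y0_mem' : y 0 ∈ Algebra.adjoin 𝕜 ({y 0} : Set Q) := Algebra.subset_adjoin rfl
  have L2 := eq_zero_of_sum_mul_pow_eq_zero (∂ 2) hD2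
    (sub_smul_pow_mem_degreeLT (α := a) y0_mem h2 (nicholsDer_one _ _) (fun n => by
      rw [der_two_mul_gen_two, one_smul, one_mul])) (nicholsDer_one _ _)
  have L1 := eq_zero_of_sum_mul_pow_eq_zero (∂ 1) hD1
    (sub_smul_pow_mem_degreeLT (α := -ℓ) y0_mem' h1 (nicholsDer_one _ _) (fun n => by
      rw [der_one_mul_gen_one, der_pow_eq_zero (i := 1) (l := 2) (by decide), one_smul, one_mul,
        zero_mul, add_zero, sub_eq_add_neg, neg_smul])) (nicholsDer_one _ _)
  -- Over the scalars there is no correction term: the auxiliary element x of the general lemma is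
  -- taken to be 0.
  have hpow : ∀ n : ℕ, ∂ 0 (y 0 ^ (n + 1)) - ((n : 𝕜) + 1) • y 0 ^ n ∈
      degreeLT (⊥ : Subalgebra 𝕜 Q) (y 0) n :=
    sub_smul_pow_mem_degreeLT (x := 0) (c := 0) (α := 0) (Subalgebra.zero_mem _)
      (by simp) (nicholsDer_one _ _) (fun n => by
        rw [der_zero_mul_gen_zero, der_pow_eq_zero (i := 0) (l := 2) (by decide),
          der_pow_eq_zero (i := 0) (l := 1) (by decide), one_smul]
        simp)
  have L0 := eq_zero_of_sum_mul_pow_eq_zero (∂ 0) hD0 hpow (nicholsDer_one _ _)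
  refine linearIndepOn_orderedMonomial (fun _ N => N + 1)
    (fun N e _ h i => Nat.lt_succ_of_le (h i)) fun N f hf => ?_
  have hf' : ∑ c ∈ Finset.range (N + 1), (∑ b ∈ Finset.range (N + 1),
      (∑ a ∈ Finset.range (N + 1), algebraMap 𝕜 Q (f a b c) * y 0 ^ a) * y 1 ^ b) * y 2 ^ c = 0 := by
    rw [← hf]
    simp only [Finset.sum_mul, ← Algebra.smul_def, smul_mul_assoc]
  intro i hi j hj m hm
  have s0 : ∀ b c, ∑ a ∈ Finset.range (N + 1), algebraMap 𝕜 Q (f a b c) * y 0 ^ a ∈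
      Algebra.adjoin 𝕜 ({y 0} : Set Q) := fun b c => Subalgebra.sum_mem _ fun a _ =>
    Subalgebra.mul_mem _ (Subalgebra.algebraMap_mem _ _) (Subalgebra.pow_mem _ y0_mem' _)
  have s1 : ∀ c, ∑ b ∈ Finset.range (N + 1), (∑ a ∈ Finset.range (N + 1),
      algebraMap 𝕜 Q (f a b c) * y 0 ^ a) * y 1 ^ b ∈ Algebra.adjoin 𝕜 ({y 0, y 1} : Set Q) :=
    fun c => Subalgebra.sum_mem _ fun b _ => Subalgebra.mul_mem _
      (Algebra.adjoin_mono (by simp) (s0 b c)) (Subalgebra.pow_mem _ y1_mem _)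
  have e2 := L2 _ _ s1 hf' m hm
  have e1 := L1 _ _ (fun b => s0 b m) e2 j hj
  have e0 := L0 _ _ (fun a => Algebra.mem_bot.2 ⟨_, rfl⟩) e1 i hi
  exact (map_eq_zero_iff _ (algebraMap 𝕜 Q).injective).1 e0

end One

/-! ### The case `t = -1` -/

section MinusOne

variable {b d k ℓ p q : 𝕜}

local notation "Q" => NicholsAlgebra (braiding (-1) (-p) b d k ℓ p q)
local notation "y" => gen (braiding (-1) (-p) b d k ℓ p q)
local notation "∂" => nicholsDer (braiding (-1) (-p) b d k ℓ p q)

/-- With all exponents at most 1, `∂ 2`, `∂ 1` and `∂ 0` read off the cofactors of the last letter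
in turn, as in an exterior algebra. -/
theorem linearIndepOn_expB0 : LinearIndepOn 𝕜 (orderedMonomial y) expB0 := by
  refine linearIndepOn_orderedMonomial (fun _ _ => 2) (fun N e he _ i => he i) fun N f hf => ?_
  have hd : ∀ i, ∂ i 1 = 0 := nicholsDer_one _
  have hg : ∀ i j, ∂ i (y j) = if j = i then 1 else 0 := nicholsDer_gen _
  have d21 : ∀ f, ∂ 2 (y 1 * f) = y 1 * ∂ 2 f := der_gen_mul (by decide)
  have d20 : ∀ f, ∂ 2 (y 0 * f) = y 0 * ∂ 2 f := der_gen_mul (by decide)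
  have d10 : ∀ f, ∂ 1 (y 0 * f) = y 0 * ∂ 1 f := der_gen_mul (by decide)
  have key : ∀ g : ℕ → ℕ → 𝕜, ∑ b ∈ Finset.range 2, ∑ a ∈ Finset.range 2,
      g a b • (y 0 ^ a * y 1 ^ b) = 0 → ∀ a < 2, ∀ b < 2, g a b = 0 := by
    intro g h
    simp only [Finset.sum_range_succ, Finset.sum_range_zero, pow_zero, pow_one, mul_one, one_mul,
      zero_add] at h
    have h1 := congrArg (∂ 1) h
    simp [hd, hg, d10] at h1
    have h2 := congrArg (∂ 0) h1
    simp [hd, hg] at h2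
    simp [h2] at h1
    simp [h1, h2] at h
    have h3 := congrArg (∂ 0) h
    simp [hd, hg] at h3
    simp [h3] at h
    intro a ha b hb
    interval_cases a <;> interval_cases b <;> assumption
  have split : ∑ b ∈ Finset.range 2, ∑ a ∈ Finset.range 2, f a b 0 • (y 0 ^ a * y 1 ^ b) +
      (∑ b ∈ Finset.range 2, ∑ a ∈ Finset.range 2, f a b 1 • (y 0 ^ a * y 1 ^ b)) * y 2 = 0 := by
    rw [← hf]
    simp [Finset.sum_range_succ, add_mul]
  have h1 : ∑ b ∈ Finset.range 2, ∑ a ∈ Finset.range 2, f a b 1 • (y 0 ^ a * y 1 ^ b) = 0 := by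
    have := congrArg (∂ 2) split
    simp [Finset.sum_range_succ, add_mul, hd, hg, d20, d21, mul_assoc] at this
    simpa [Finset.sum_range_succ] using this
  rw [h1, zero_mul, add_zero] at split
  intro i hi j hj m hm
  interval_cases m
  · exact key (fun a b => f a b 0) split i hi j hj
  · exact key (fun a b => f a b 1) h1 i hi j hj

theorem der_two_mul_gen_two' (f : Q) : ∂ 2 (f * y 2) = f - ∂ 2 f * (y 2 - p • y 0) := by
  rw [der_two_mul_gen_two]
  simp [mul_add, mul_sub]
  abel

theorem der_one_mul_gen_two' (f : Q) : ∂ 1 (f * y 2) = -(∂ 1 f * (y 2 - p • y 0)) := by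
  rw [der_one_mul_gen_two]
  simp [mul_add, mul_sub]
  abel

theorem der_zero_mul_gen_two' {f : Q} (hf : ∂ 1 f = 0) :
    ∂ 0 (f * y 2) = -(∂ 0 f * (y 2 - p • y 0)) - ∂ 2 f * (p • y 2 + b • y 0) := by
  rw [der_zero_mul_gen_two, hf]
  simp [mul_add, mul_sub]
  abel

/-- A derivation passing y 2 twists it to y 2 - p • y 0, up to sign. The square of y 2 does not see
this twist. -/
theorem sub_mul_sub (h0 : y 0 * y 0 = 0) (h2 : y 2 * y 0 = -(y 0 * y 2)) :
    (y 2 - p • y 0) * (y 2 - p • y 0) = y 2 * y 2 := by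
  simp [mul_sub, sub_mul, h0, h2]

/-- Right multiplication by y 2 * y 2 fails to commute with `∂ 2` only by p • (f * y 0). Subtracting
p • (y 0 * y 2) repairs this, which leads to `sqDefect`. -/
theorem der_two_mul_mul (h0 : y 0 * y 0 = 0) (h2 : y 2 * y 0 = -(y 0 * y 2)) (f : Q) :
    ∂ 2 (f * (y 2 * y 2)) = p • (f * y 0) + ∂ 2 f * (y 2 * y 2) := by
  rw [← mul_assoc, der_two_mul_gen_two', der_two_mul_gen_two', sub_mul, mul_assoc,
    sub_mul_sub h0 h2]
  simp only [mul_sub, mul_smul_comm]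
  abel

theorem der_one_mul_mul (h0 : y 0 * y 0 = 0) (h2 : y 2 * y 0 = -(y 0 * y 2)) (f : Q) :
    ∂ 1 (f * (y 2 * y 2)) = ∂ 1 f * (y 2 * y 2) := by
  rw [← mul_assoc, der_one_mul_gen_two', der_one_mul_gen_two', neg_mul, neg_neg, mul_assoc,
    sub_mul_sub h0 h2]

theorem der_zero_mul_mul (h0 : y 0 * y 0 = 0) (h2 : y 2 * y 0 = -(y 0 * y 2)) {f : Q}
    (h1f : ∂ 1 f = 0) (h2f : ∂ 2 f = 0) :
    ∂ 0 (f * (y 2 * y 2)) = ∂ 0 f * (y 2 * y 2) - f * (p • y 2 + b • y 0) := by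
  rw [← mul_assoc, der_zero_mul_gen_two', der_zero_mul_gen_two' h1f, der_two_mul_gen_two', h2f]
  · simp only [zero_mul, sub_zero, neg_mul, neg_neg, mul_assoc, sub_mul_sub h0 h2]
  · rw [der_one_mul_gen_two', h1f, zero_mul, neg_zero]

theorem mul_gen_zero_mul_sub (h0 : y 0 * y 0 = 0) (f : Q) :
    f * y 0 * (y 2 - p • y 0) = f * (y 0 * y 2) := by
  rw [mul_assoc]
  simp [mul_sub, h0]

variable (b d k ℓ p q) in
/-- The element `x₃² - p x₁x₃` of the Nichols algebra. -/
def sqDefect : Q := y 2 * y 2 - p • (y 0 * y 2)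

local notation "z" => sqDefect b d k ℓ p q

theorem der_two_mul_sqDefect (h0 : y 0 * y 0 = 0) (h2 : y 2 * y 0 = -(y 0 * y 2)) (f : Q) : ∂ 2 (f * z) = ∂ 2 f * z := by
  rw [sqDefect, mul_sub, map_sub, der_two_mul_mul h0 h2, mul_smul_comm, map_smul, ← mul_assoc f,
    der_two_mul_gen_two', der_two_mul_gen_zero, mul_sub (∂ 2 f), mul_smul_comm, neg_one_smul]
  simp only [neg_mul, mul_gen_zero_mul_sub h0, mul_smul_comm]
  module

theorem der_one_mul_sqDefect (h0 : y 0 * y 0 = 0) (h2 : y 2 * y 0 = -(y 0 * y 2)) (f : Q) : ∂ 1 (f * z) = ∂ 1 f * z := by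
  rw [sqDefect, mul_sub, map_sub, der_one_mul_mul h0 h2, mul_smul_comm, map_smul, ← mul_assoc f,
    der_one_mul_gen_two', der_one_mul_gen_zero, mul_sub (∂ 1 f), mul_smul_comm, neg_one_smul]
  simp only [neg_mul, mul_gen_zero_mul_sub h0, mul_smul_comm]
  module

/-- Only `∂ 0` detects z, through the scalar b + p ^ 2. This is the source of the dichotomy between
the two cases with t = -1. -/
theorem der_zero_mul_sqDefect (h0 : y 0 * y 0 = 0) (h2 : y 2 * y 0 = -(y 0 * y 2)) {f : Q}
    (h1f : ∂ 1 f = 0) (h2f : ∂ 2 f = 0) :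
    ∂ 0 (f * z) = ∂ 0 f * z - (b + p ^ 2) • (f * y 0) := by
  rw [sqDefect, mul_sub, map_sub, der_zero_mul_mul h0 h2 h1f h2f, mul_smul_comm, map_smul,
    ← mul_assoc f, der_zero_mul_gen_two', der_two_mul_gen_zero, der_zero_mul_gen_zero, h1f, h2f]
  · simp only [zero_mul, add_zero, neg_one_smul, mul_neg, add_mul, neg_mul,
      mul_gen_zero_mul_sub h0]
    simp only [mul_sub, mul_add, mul_smul_comm]
    module
  · rw [der_one_mul_gen_zero, h1f, zero_mul]

theorem sqDefect_mul_gen_zero (h0 : y 0 * y 0 = 0) (h2 : y 2 * y 0 = -(y 0 * y 2)) : z * y 0 = y 0 * z := by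
  have h0' : ∀ f, y 0 * (y 0 * f) = 0 := fun f => by rw [← mul_assoc, h0, zero_mul]
  have h2' : ∀ f, y 2 * (y 0 * f) = -(y 0 * (y 2 * f)) := fun f => by
    rw [← mul_assoc, h2, neg_mul, mul_assoc]
  simp [sqDefect, sub_mul, mul_sub, mul_assoc, h2, h0', h2']

theorem sqDefect_pow_mul_gen_zero (h0 : y 0 * y 0 = 0) (h2 : y 2 * y 0 = -(y 0 * y 2)) (m : ℕ) :
    z ^ m * y 0 = y 0 * z ^ m :=
  (Commute.pow_left (show Commute z (y 0) from sqDefect_mul_gen_zero h0 h2) m).eq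

theorem der_sqDefect_pow (h0 : y 0 * y 0 = 0) (h2 : y 2 * y 0 = -(y 0 * y 2)) (m : ℕ) :
    ∂ 1 (z ^ m) = 0 ∧ ∂ 2 (z ^ m) = 0 := by
  induction m with
  | zero => simp [nicholsDer_one]
  | succ m ih =>
    rw [pow_succ, der_one_mul_sqDefect h0 h2, der_two_mul_sqDefect h0 h2, ih.1, ih.2]
    simp

/-- The correction term in `der_zero_mul_sqDefect` contains a second factor y 0 and dies because y 0
squares to zero. -/
theorem der_zero_gen_zero_mul_sqDefect_pow (h0 : y 0 * y 0 = 0) (h2 : y 2 * y 0 = -(y 0 * y 2)) (m : ℕ) :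
    ∂ 0 (y 0 * z ^ m) = z ^ m := by
  induction m with
  | zero => simp [nicholsDer_gen]
  | succ m ih =>
    have e1 : ∂ 1 (y 0 * z ^ m) = 0 := by
      rw [der_gen_mul (by decide), (der_sqDefect_pow h0 h2 m).1, mul_zero]
    have e2 : ∂ 2 (y 0 * z ^ m) = 0 := by
      rw [der_gen_mul (by decide), (der_sqDefect_pow h0 h2 m).2, mul_zero]
    rw [pow_succ, ← mul_assoc, der_zero_mul_sqDefect h0 h2 e1 e2, ih, mul_assoc (y 0),
      sqDefect_pow_mul_gen_zero h0 h2, ← mul_assoc, h0, zero_mul, smul_zero, sub_zero]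

theorem der_zero_sqDefect_pow (h0 : y 0 * y 0 = 0) (h2 : y 2 * y 0 = -(y 0 * y 2)) (m : ℕ) :
    ∂ 0 (z ^ (m + 1)) = -(((m : 𝕜) + 1) * (b + p ^ 2)) • (y 0 * z ^ m) := by
  induction m with
  | zero =>
    have := der_zero_mul_sqDefect h0 h2 (nicholsDer_one (braiding (-1) (-p) b d k ℓ p q) 1)
      (nicholsDer_one (braiding (-1) (-p) b d k ℓ p q) 2)
    rw [one_mul, nicholsDer_one, zero_mul, zero_sub, one_mul] at this
    rw [zero_add, pow_one, this, pow_zero, mul_one, Nat.cast_zero]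
    module
  | succ m ih =>
    rw [pow_succ, der_zero_mul_sqDefect h0 h2 (der_sqDefect_pow h0 h2 _).1
      (der_sqDefect_pow h0 h2 _).2, ih, sqDefect_pow_mul_gen_zero h0 h2, smul_mul_assoc, mul_assoc,
      ← pow_succ]
    push_cast
    module

/-- The difference of y 2 * y 2 and z is a left multiple of y 0, hence is killed by y 0 on the left.
-/
theorem gen_zero_mul_sq_pow (h0 : y 0 * y 0 = 0) (h2 : y 2 * y 0 = -(y 0 * y 2)) (m : ℕ) :
    y 0 * (y 2 * y 2) ^ m = y 0 * z ^ m := by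
  induction m with
  | zero => simp
  | succ m ih =>
    rw [pow_succ, ← mul_assoc, ih, pow_succ, ← mul_assoc (y 0) (z ^ m) z,
      ← sqDefect_pow_mul_gen_zero h0 h2, mul_assoc, mul_assoc]
    congr 1
    rw [sqDefect, mul_sub, mul_smul_comm, ← mul_assoc (y 0) (y 0), h0, zero_mul, smul_zero, sub_zero]

/-- `∂ 0` sends z ^ (n + 1) to a multiple of y 0 * z ^ n, and a second `∂ 0` removes y 0. After
dividing by -(b + p ^ 2) this is d/dz, so the general degree argument applies over the scalars. -/
theorem sqDefect_independent [CharZero 𝕜] (h0 : y 0 * y 0 = 0) (h2 : y 2 * y 0 = -(y 0 * y 2))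
    (hb : b ≠ -p ^ 2) (M : ℕ) (c : ℕ → 𝕜) (h : ∑ m ∈ Finset.range M, c m • z ^ m = 0) :
    ∀ m < M, c m = 0 := by
  have hb' : b + p ^ 2 ≠ 0 := fun h => hb (eq_neg_of_add_eq_zero_left h)
  have hpow : ∀ n : ℕ, ((-(b + p ^ 2))⁻¹ • (∂ 0 ∘ₗ ∂ 0)) (z ^ (n + 1)) - ((n : 𝕜) + 1) • z ^ n ∈
      degreeLT (⊥ : Subalgebra 𝕜 Q) z n := by
    intro n
    have : ((-(b + p ^ 2))⁻¹ • (∂ 0 ∘ₗ ∂ 0)) (z ^ (n + 1)) = ((n : 𝕜) + 1) • z ^ n := by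
      rw [LinearMap.smul_apply, LinearMap.comp_apply, der_zero_sqDefect_pow h0 h2, map_smul,
        der_zero_gen_zero_mul_sqDefect_pow h0 h2, smul_smul]
      congr 1
      field_simp
    rw [this, sub_self]
    exact Submodule.zero_mem _
  have L := eq_zero_of_sum_mul_pow_eq_zero _
    (fun g hg f => by
      obtain ⟨c, rfl⟩ := Algebra.mem_bot.1 hg
      rw [← Algebra.smul_def, map_smul, ← Algebra.smul_def])
    hpow (by simp [nicholsDer_one]) M (fun m => algebraMap 𝕜 Q (c m))
    (fun m => Algebra.mem_bot.2 ⟨_, rfl⟩) (by simpa [← Algebra.smul_def] using h)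
  exact fun m hm => (map_eq_zero_iff _ (algebraMap 𝕜 Q).injective).1 (L m hm)

theorem gen_zero_mul_sq_pow_independent [CharZero 𝕜] (h0 : y 0 * y 0 = 0) (h2 : y 2 * y 0 = -(y 0 * y 2))
    (hb : b ≠ -p ^ 2) (M : ℕ) (c : ℕ → 𝕜)
    (h : ∑ m ∈ Finset.range M, c m • (y 0 * (y 2 * y 2) ^ m) = 0) : ∀ m < M, c m = 0 := by
  refine sqDefect_independent h0 h2 hb M c ?_
  have := congrArg (∂ 0) h
  simpa only [map_sum, map_smul, gen_zero_mul_sq_pow h0 h2,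
    der_zero_gen_zero_mul_sqDefect_pow h0 h2, map_zero] using this

/-- `∂ 1` commutes with right multiplication by y 2 * y 2 and isolates the terms containing y 1. -/
theorem even_monomials_independent [CharZero 𝕜] (h0 : y 0 * y 0 = 0) (h2 : y 2 * y 0 = -(y 0 * y 2))
    (hb : b ≠ -p ^ 2) (M : ℕ) (c : ℕ → ℕ → 𝕜)
    (h : ∑ m ∈ Finset.range M, (c 0 m • (y 0 * (y 2 * y 2) ^ m) +
      c 1 m • (y 0 * y 1 * (y 2 * y 2) ^ m)) = 0) :
    ∀ m < M, c 0 m = 0 ∧ c 1 m = 0 := by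
  have d1 : ∀ m f, ∂ 1 (f * (y 2 * y 2) ^ m) = ∂ 1 f * (y 2 * y 2) ^ m := by
    intro m f
    induction m with
    | zero => simp
    | succ m ih => rw [pow_succ, ← mul_assoc, der_one_mul_mul h0 h2, ih, mul_assoc]
  have d10 : ∀ f, ∂ 1 (y 0 * f) = y 0 * ∂ 1 f := der_gen_mul (by decide)
  have h1 : ∀ m < M, c 1 m = 0 := by
    refine gen_zero_mul_sq_pow_independent h0 h2 hb M (c 1) ?_
    have := congrArg (∂ 1) h
    simpa [d1, d10, nicholsDer_gen] using this
  have h3 : ∀ m < M, c 0 m = 0 := by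
    refine gen_zero_mul_sq_pow_independent h0 h2 hb M (c 0) ?_
    rw [← h]
    refine Finset.sum_congr rfl fun m hm => ?_
    rw [h1 m (Finset.mem_range.1 hm), zero_smul, add_zero]
  exact fun m hm => ⟨h3 m hm, h1 m hm⟩

/-- On these monomials `∂ 2` kills the even powers of y 2 and lowers the odd ones by one, so it
separates the two parities. -/
theorem gen_zero_monomials_independent [CharZero 𝕜] (h0 : y 0 * y 0 = 0) (h2 : y 2 * y 0 = -(y 0 * y 2))
    (h1 : y 1 * y 0 = -(y 0 * y 1))
    (hb : b ≠ -p ^ 2) (M : ℕ) (c : ℕ → ℕ → 𝕜)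
    (h : ∑ n ∈ Finset.range (2 * M), ∑ j ∈ Finset.range 2,
      c j n • (y 0 * y 1 ^ j * y 2 ^ n) = 0) :
    ∀ j < 2, ∀ n < 2 * M, c j n = 0 := by
  have comm : ∀ m, (y 2 * y 2) ^ m * y 0 = y 0 * (y 2 * y 2) ^ m := fun m =>
    (Commute.pow_left (show Commute (y 2 * y 2) (y 0) by
      rw [Commute, SemiconjBy, mul_assoc, h2, mul_neg, ← mul_assoc, h2, neg_mul, neg_neg,
        mul_assoc]) m).eq
  -- The defect p • (g * (y 2 * y 2) ^ m * y 0) vanishes because even powers of y 2 commute with y 0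
  -- and g * y 0 = 0. This is why a factor y 0 is kept in the monomials.
  have dz : ∀ g, g * y 0 = 0 → ∂ 2 g = 0 → ∀ m, ∂ 2 (g * (y 2 * y 2) ^ m) = 0 := by
    intro g hg hd m
    induction m with
    | zero => simpa using hd
    | succ m ih =>
      rw [pow_succ, ← mul_assoc, der_two_mul_mul h0 h2, ih, mul_assoc g, comm, ← mul_assoc, hg]
      simp
  have ho : ∀ g, g * y 0 = 0 → ∂ 2 g = 0 → ∀ m,
      ∂ 2 (g * (y 2 * y 2) ^ m * y 2) = g * (y 2 * y 2) ^ m := by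
    intro g hg hd m
    rw [der_two_mul_gen_two', dz g hg hd, zero_mul, sub_zero]
  have g0 : y 0 * y 1 * y 0 = 0 := by
    rw [mul_assoc, h1, mul_neg, ← mul_assoc, h0, zero_mul, neg_zero]
  have e0 : ∂ 2 (y 0) = 0 := by simp [nicholsDer_gen]
  have e1 : ∂ 2 (y 0 * y 1) = 0 := by
    rw [der_gen_mul (by decide)]
    simp [nicholsDer_gen]
  have hs : ∑ m ∈ Finset.range M, ((c 0 (2 * m) • (y 0 * (y 2 * y 2) ^ m) +
      c 1 (2 * m) • (y 0 * y 1 * (y 2 * y 2) ^ m)) +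
      (c 0 (2 * m + 1) • (y 0 * (y 2 * y 2) ^ m * y 2) +
      c 1 (2 * m + 1) • (y 0 * y 1 * (y 2 * y 2) ^ m * y 2))) = 0 := by
    rw [← h, sum_range_two_mul]
    refine Finset.sum_congr rfl fun m _ => ?_
    simp only [Finset.sum_range_succ, Finset.sum_range_zero, zero_add, pow_zero, pow_one, one_mul,
      pow_succ (y 2) (2 * m), pow_mul (y 2) 2 m, pow_two (y 2), mul_assoc]
  have hodd : ∀ m < M, c 0 (2 * m + 1) = 0 ∧ c 1 (2 * m + 1) = 0 := by
    refine even_monomials_independent h0 h2 hb M (fun j m => c j (2 * m + 1)) ?_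
    have := congrArg (∂ 2) hs
    simpa only [map_sum, map_add, map_smul, dz _ h0 e0, dz _ g0 e1, ho _ h0 e0, ho _ g0 e1,
      smul_zero, zero_add, map_zero] using this
  have heven : ∀ m < M, c 0 (2 * m) = 0 ∧ c 1 (2 * m) = 0 := by
    refine even_monomials_independent h0 h2 hb M (fun j m => c j (2 * m)) ?_
    rw [← hs]
    refine Finset.sum_congr rfl fun m hm => ?_
    obtain ⟨u, v⟩ := hodd m (Finset.mem_range.1 hm)
    simp only [u, v, zero_smul, add_zero]
  intro j hj n hn
  obtain ⟨m, rfl | rfl⟩ : ∃ m, n = 2 * m ∨ n = 2 * m + 1 := ⟨n / 2, by omega⟩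
  · interval_cases j
    exacts [(heven m (by omega)).1, (heven m (by omega)).2]
  · interval_cases j
    exacts [(hodd m (by omega)).1, (hodd m (by omega)).2]

theorem linearIndepOn_expB1 [CharZero 𝕜] (h0 : y 0 * y 0 = 0) (h2 : y 2 * y 0 = -(y 0 * y 2))
    (h1 : y 1 * y 0 = -(y 0 * y 1)) (hb : b ≠ -p ^ 2) :
    LinearIndepOn 𝕜 (orderedMonomial y) expB1 := by
  -- The third side is even so that the powers of y 2 group into pairs 2 * m, 2 * m + 1.
  refine linearIndepOn_orderedMonomial ![fun _ => 2, fun _ => 2, fun N => 2 * (N + 1)]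
    (fun N e he h i => ?_) fun N f hf => ?_
  · have := h 2
    have := he.1
    have := he.2
    fin_cases i <;> simp <;> omega
  · simp only [Matrix.cons_val] at hf ⊢
    have hz : ∀ j < 2, ∀ n < 2 * (N + 1), f 0 j n = 0 := by
      refine gen_zero_monomials_independent h0 h2 h1 hb (N + 1) (f 0) ?_
      -- Left multiplication by y 0 kills the monomials that contain y 0 and puts y 0 in front of
      -- the others.
      have := congrArg (y 0 * ·) hf
      simp only [Finset.mul_sum, mul_zero, mul_smul_comm] at this
      rw [← this]
      refine Finset.sum_congr rfl fun n _ => Finset.sum_congr rfl fun j _ => ?_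
      simp [Finset.sum_range_succ, ← mul_assoc, h0]
    have ho : ∀ j < 2, ∀ n < 2 * (N + 1), f 1 j n = 0 := by
      refine gen_zero_monomials_independent h0 h2 h1 hb (N + 1) (f 1) ?_
      rw [← hf]
      refine Finset.sum_congr rfl fun n hn => Finset.sum_congr rfl fun j hj => ?_
      simp [Finset.sum_range_succ, hz j (Finset.mem_range.1 hj) n (Finset.mem_range.1 hn)]
    intro i hi j hj n hn
    interval_cases i
    exacts [hz j hj n hn, ho j hj n hn]

end MinusOne

end R17

namespace R17

open Nichols

variable {𝕜 : Type*} [Field 𝕜]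

/-! ### The ideals of relations -/

theorem span_quad_spaceA (d k q : 𝕜) :
    TwoSidedIdeal.span (quad '' (spaceA d k q : Set (Matrix (Fin 3) (Fin 3) 𝕜))) =
      TwoSidedIdeal.span (relA d k q) := by
  set I := TwoSidedIdeal.span (relA d k q) with hI
  have hmem : ∀ s ∈ relA d k q, s ∈ I := fun s hs => TwoSidedIdeal.subset_span hs
  refine le_antisymm (TwoSidedIdeal.span_le.2 ?_) (TwoSidedIdeal.span_mono ?_)
  · rintro _ ⟨S, ⟨h1, h2, h3, h4, h5, h6⟩, rfl⟩
    have : quad S = S 1 0 • (x 𝕜 1 * x 𝕜 0 - x 𝕜 0 * x 𝕜 1 - k • x 𝕜 0 ^ 2) +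
        S 2 0 • (x 𝕜 2 * x 𝕜 0 - x 𝕜 0 * x 𝕜 2 - q • x 𝕜 0 ^ 2) +
        S 2 1 • (x 𝕜 2 * x 𝕜 1 - x 𝕜 1 * x 𝕜 2 + k • (x 𝕜 0 * x 𝕜 2) - q • (x 𝕜 0 * x 𝕜 1)
          - (d + q * k) • x 𝕜 0 ^ 2) := by
      simp only [quad_apply, Fin.sum_univ_three, h1, h2, h3, h4, h5, h6, pow_two]
      module
    rw [this]
    exact I.add_mem (I.add_mem (I.smul_mem_of_algebra _ (hmem _ (by simp [relA])))
      (I.smul_mem_of_algebra _ (hmem _ (by simp [relA]))))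
      (I.smul_mem_of_algebra _ (hmem _ (by simp [relA])))
  · rintro _ (rfl | rfl | rfl)
    · refine ⟨!![-k, -1, 0; 1, 0, 0; 0, 0, 0], by simp [spaceA], ?_⟩
      simp [quad_apply, Fin.sum_univ_three, pow_two]
      module
    · refine ⟨!![-q, 0, -1; 0, 0, 0; 1, 0, 0], by simp [spaceA], ?_⟩
      simp [quad_apply, Fin.sum_univ_three, pow_two]
      module
    · refine ⟨!![-(d + q * k), -q, k; 0, 0, -1; 0, 1, 0], by simp [spaceA], ?_⟩
      simp [quad_apply, Fin.sum_univ_three, pow_two]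
      module

theorem relB_subset (k ℓ q : 𝕜) :
    relB k ℓ q ⊆ quad '' (spaceB k ℓ q : Set (Matrix (Fin 3) (Fin 3) 𝕜)) := by
  rintro _ (rfl | rfl | rfl | rfl | rfl)
  · refine ⟨!![0, 1, 0; 1, 0, 0; 0, 0, 0], by simp [spaceB], ?_⟩
    simp [quad_apply, Fin.sum_univ_three]
    module
  · refine ⟨!![0, 0, 1; 0, 0, 0; 1, 0, 0], by simp [spaceB], ?_⟩
    simp [quad_apply, Fin.sum_univ_three]
    module
  · refine ⟨!![0, -q, -k; 0, 0, 1; 0, 1, 0], by simp [spaceB], ?_⟩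
    simp [quad_apply, Fin.sum_univ_three]
    module
  · refine ⟨!![1, 0, 0; 0, 0, 0; 0, 0, 0], by simp [spaceB], ?_⟩
    simp [quad_apply, Fin.sum_univ_three, pow_two]
  · refine ⟨!![0, -ℓ, 0; 0, 1, 0; 0, 0, 0], by simp [spaceB], ?_⟩
    simp [quad_apply, Fin.sum_univ_three, pow_two]
    module

theorem spaceB_le_spaceC (k ℓ p q : 𝕜) : spaceB k ℓ q ≤ spaceC k ℓ p q := by
  rintro S ⟨h1, h2, h3, h4⟩
  exact ⟨h2, by rw [h1, h3, mul_zero, sub_zero], h4⟩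

theorem quad_mem_span_relB {k ℓ q : 𝕜} {S : Matrix (Fin 3) (Fin 3) 𝕜} (hS : S ∈ spaceB k ℓ q) :
    quad S ∈ TwoSidedIdeal.span (relB k ℓ q) := by
  obtain ⟨h1, h2, h3, h4⟩ := hS
  set I := TwoSidedIdeal.span (relB k ℓ q) with hI
  have hmem : ∀ s ∈ relB k ℓ q, s ∈ I := fun s hs => TwoSidedIdeal.subset_span hs
  have : quad S = S 1 0 • (x 𝕜 1 * x 𝕜 0 + x 𝕜 0 * x 𝕜 1) +
      S 2 0 • (x 𝕜 2 * x 𝕜 0 + x 𝕜 0 * x 𝕜 2) +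
      S 2 1 • (x 𝕜 2 * x 𝕜 1 + x 𝕜 1 * x 𝕜 2 - k • (x 𝕜 0 * x 𝕜 2) - q • (x 𝕜 0 * x 𝕜 1)) +
      S 0 0 • x 𝕜 0 ^ 2 + S 1 1 • (x 𝕜 1 ^ 2 - ℓ • (x 𝕜 0 * x 𝕜 1)) := by
    simp only [quad_apply, Fin.sum_univ_three, h1, h2, h3, h4, pow_two]
    module
  rw [this]
  exact I.add_mem (I.add_mem (I.add_mem (I.add_mem
    (I.smul_mem_of_algebra _ (hmem _ (by simp [relB])))
    (I.smul_mem_of_algebra _ (hmem _ (by simp [relB]))))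
    (I.smul_mem_of_algebra _ (hmem _ (by simp [relB]))))
    (I.smul_mem_of_algebra _ (hmem _ (by simp [relB]))))
    (I.smul_mem_of_algebra _ (hmem _ (by simp [relB])))

theorem span_quad_spaceB (k ℓ q : 𝕜) :
    TwoSidedIdeal.span (quad '' (spaceB k ℓ q : Set (Matrix (Fin 3) (Fin 3) 𝕜))) =
      TwoSidedIdeal.span (relB k ℓ q) := by
  refine le_antisymm (TwoSidedIdeal.span_le.2 ?_) (TwoSidedIdeal.span_mono (relB_subset k ℓ q))
  rintro _ ⟨S, hS, rfl⟩
  exact quad_mem_span_relB hS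

theorem span_quad_spaceC (k ℓ p q : 𝕜) :
    TwoSidedIdeal.span (quad '' (spaceC k ℓ p q : Set (Matrix (Fin 3) (Fin 3) 𝕜))) =
      TwoSidedIdeal.span (relC k ℓ p q) := by
  set I := TwoSidedIdeal.span (relC k ℓ p q) with hI
  have hmem : ∀ s ∈ relC k ℓ p q, s ∈ I := fun s hs => TwoSidedIdeal.subset_span hs
  have hBC : TwoSidedIdeal.span (relB k ℓ q) ≤ I := TwoSidedIdeal.span_mono Set.subset_union_left
  have hC : quad !![0, 0, -p; 0, 0, 0; 0, 0, 1] = x 𝕜 2 ^ 2 - p • (x 𝕜 0 * x 𝕜 2) := by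
    simp [quad_apply, Fin.sum_univ_three, pow_two]
    module
  refine le_antisymm (TwoSidedIdeal.span_le.2 ?_) (TwoSidedIdeal.span_mono ?_)
  · rintro _ ⟨S, ⟨h1, h2, h3⟩, rfl⟩
    -- The extra relation is the only one with an x₃² term; removing it leaves a combination of the
    -- relations `relB`.
    have h4 : S - S 2 2 • !![0, 0, -p; 0, 0, 0; 0, 0, 1] ∈ spaceB k ℓ q := by
      refine ⟨?_, ?_, ?_, ?_⟩ <;> simp [h1, h2, h3]
      ring
    have h5 : quad S = quad (S - S 2 2 • !![0, 0, -p; 0, 0, 0; 0, 0, 1]) +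
        S 2 2 • (x 𝕜 2 ^ 2 - p • (x 𝕜 0 * x 𝕜 2)) := by
      rw [map_sub, map_smul, hC, sub_add_cancel]
    rw [h5]
    exact I.add_mem (hBC (quad_mem_span_relB h4))
      (I.smul_mem_of_algebra _ (hmem _ (Or.inr rfl)))
  · rintro s (hs | rfl)
    · obtain ⟨S, hS, rfl⟩ := relB_subset k ℓ q hs
      exact ⟨S, spaceB_le_spaceC k ℓ p q hS, rfl⟩
    · exact ⟨_, by simp [spaceC], hC⟩

/-! ### The relations in quotients of the tensor algebra -/

section Relations

variable {A : Type*} [Ring A] [Algebra 𝕜 A] {φ : FreeAlgebra 𝕜 (Fin 3) →ₐ[𝕜] A} {d k ℓ p q : 𝕜}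

theorem relations_relA (h : ∀ s ∈ relA d k q, φ s = 0) :
    φ (x 𝕜 1) * φ (x 𝕜 0) = φ (x 𝕜 0) * φ (x 𝕜 1) + k • φ (x 𝕜 0) ^ 2 ∧
    φ (x 𝕜 2) * φ (x 𝕜 0) = φ (x 𝕜 0) * φ (x 𝕜 2) + q • φ (x 𝕜 0) ^ 2 ∧
    φ (x 𝕜 2) * φ (x 𝕜 1) = φ (x 𝕜 1) * φ (x 𝕜 2) - k • (φ (x 𝕜 0) * φ (x 𝕜 2)) +
      q • (φ (x 𝕜 0) * φ (x 𝕜 1)) + (d + q * k) • φ (x 𝕜 0) ^ 2 := by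
  have h1 := h _ (Or.inl rfl)
  have h2 := h _ (Or.inr (Or.inl rfl))
  have h3 := h _ (Or.inr (Or.inr rfl))
  simp only [map_sub, map_add, map_smul, map_mul, map_pow] at h1 h2 h3
  refine ⟨?_, ?_, ?_⟩ <;> rw [← sub_eq_zero]
  · rw [← h1]; abel
  · rw [← h2]; abel
  · rw [← h3]; abel

theorem relations_relB (h : ∀ s ∈ relB k ℓ q, φ s = 0) :
    φ (x 𝕜 1) * φ (x 𝕜 0) = -(φ (x 𝕜 0) * φ (x 𝕜 1)) ∧
    φ (x 𝕜 2) * φ (x 𝕜 0) = -(φ (x 𝕜 0) * φ (x 𝕜 2)) ∧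
    φ (x 𝕜 2) * φ (x 𝕜 1) = -(φ (x 𝕜 1) * φ (x 𝕜 2)) + k • (φ (x 𝕜 0) * φ (x 𝕜 2)) +
      q • (φ (x 𝕜 0) * φ (x 𝕜 1)) ∧
    φ (x 𝕜 0) * φ (x 𝕜 0) = 0 ∧
    φ (x 𝕜 1) * φ (x 𝕜 1) = ℓ • (φ (x 𝕜 0) * φ (x 𝕜 1)) := by
  have h1 := h _ (Or.inl rfl)
  have h2 := h _ (Or.inr (Or.inl rfl))
  have h3 := h _ (Or.inr (Or.inr (Or.inl rfl)))
  have h4 := h _ (Or.inr (Or.inr (Or.inr (Or.inl rfl))))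
  have h5 := h _ (Or.inr (Or.inr (Or.inr (Or.inr rfl))))
  simp only [map_sub, map_add, map_smul, map_mul, pow_two] at h1 h2 h3 h4 h5
  refine ⟨eq_neg_of_add_eq_zero_left h1, eq_neg_of_add_eq_zero_left h2, ?_, h4, sub_eq_zero.1 h5⟩
  rw [← sub_eq_zero, ← h3]
  abel

theorem relations_relC (h : ∀ s ∈ relC k ℓ p q, φ s = 0) :
    φ (x 𝕜 2) * φ (x 𝕜 2) = p • (φ (x 𝕜 0) * φ (x 𝕜 2)) := by
  have h6 := h _ (Or.inr rfl)
  simp only [map_sub, map_smul, map_mul, pow_two] at h6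
  exact sub_eq_zero.1 h6

end Relations

/-! ### The Nichols algebra -/

/-- The conclusion for a Hopf ideal such that the same ordered monomials span its quotient and are
independent in the Nichols algebra. -/
theorem nicholsIdeal_eq_and_basis_and_gkDim {r : Fin 3 → Fin 3 → Fin 3 → Fin 3 → 𝕜}
    {R : Set (FreeAlgebra 𝕜 (Fin 3))} (hR : IsHopfIdeal r (TwoSidedIdeal.span R))
    {E : Set (Fin 3 → ℕ)} (h0 : 0 ∈ E)
    (hspan : ∀ I : TwoSidedIdeal (FreeAlgebra 𝕜 (Fin 3)), (∀ s ∈ R, I.ringCon.mkₐ 𝕜 s = 0) →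
      ∀ i, ∀ e ∈ E, I.ringCon.mkₐ 𝕜 (x 𝕜 i) *
        orderedMonomial (fun i => I.ringCon.mkₐ 𝕜 (x 𝕜 i)) e ∈
        monomialSpan 𝕜 (fun i => I.ringCon.mkₐ 𝕜 (x 𝕜 i)) E (e 0 + e 1 + e 2 + 1))
    (hind : (∀ s ∈ R, proj r s = 0) → LinearIndepOn 𝕜 (orderedMonomial (gen r)) E)
    (D : ℕ) {K : ℕ} (hK : 0 < K)
    (hup : ∀ N, ∃ s : Finset (Fin 3 → ℕ), (∀ e ∈ E, e 0 + e 1 + e 2 ≤ N → e ∈ s) ∧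
      s.card ≤ K * (N + 1) ^ D)
    {c : ℝ} (hc : 0 < c)
    (hlow : ∀ n : ℕ, ∃ s : Finset (Fin 3 → ℕ), (∀ e ∈ s, e ∈ E ∧ e 0 + e 1 + e 2 ≤ n) ∧
      c * (n : ℝ) ^ D ≤ s.card) :
    nicholsIdeal r = TwoSidedIdeal.span R ∧ IsMonomialBasis r E ∧
      gkDim 𝕜 (NicholsAlgebra r) = D := by
  have hproj : ∀ s ∈ R, proj r s = 0 := fun s hs => (proj_eq_zero_iff r).2
    ((nicholsIdeal_isGreatest r).2 hR (TwoSidedIdeal.subset_span hs))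
  have hli := hind hproj
  have hadj : Algebra.adjoin 𝕜 (Set.range (gen r)) = ⊤ := adjoin_range_mkₐ_ι (nicholsIdeal r)
  have hgen := hspan (nicholsIdeal r) hproj
  refine ⟨nicholsIdeal_eq_of_orderedMonomial hR ?_ hli,
    isMonomialBasis_of_orderedMonomial (span_orderedMonomial_eq_top hadj h0 hgen) hli,
    gkDim_eq_of_orderedMonomial hadj h0 hgen hli D hK hup hc hlow⟩
  exact span_orderedMonomial_eq_top (adjoin_range_mkₐ_ι _) h0 (hspan _ fun s hs =>
    (mkₐ_eq_zero_iff _).2 (TwoSidedIdeal.subset_span hs))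

variable [CharZero 𝕜] (b d k ℓ p q : 𝕜)

theorem nicholsAlgebra_one {a : 𝕜} (ha : a = p - 2 * q) :
    nicholsIdeal (braiding 1 a b d k ℓ p q) = TwoSidedIdeal.span (relA d k q) ∧
      IsMonomialBasis (braiding 1 a b d k ℓ p q) expB3 ∧
      gkDim 𝕜 (NicholsAlgebra (braiding 1 a b d k ℓ p q)) = (3 : ℕ) := by
  -- The monomials of degree at most N lie in a cube of side N + 1. Conversely a cube of side n / 3
  -- + 1 has degree at most n and at least (n / 3) ^ 3 = n ^ 3 / 27 elements.
  refine nicholsIdeal_eq_and_basis_and_gkDim (K := 1) (c := 1 / 27)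
    (span_quad_spaceA d k q ▸ isHopfIdeal_spaceA a b d k ℓ p q ha) (Set.mem_univ _)
    (fun I hI i e _ => ?_) (fun h => ?_) 3 one_pos (fun N => ?_) (by norm_num) (fun n => ?_)
  · obtain ⟨h1, h2, h3⟩ := relations_relA hI
    exact mul_orderedMonomial_mem_expB3 h1 h2 h3 i e
  · obtain ⟨h1, h2, -⟩ := relations_relA h
    exact linearIndepOn_expB3 h1 h2
  · refine ⟨Fintype.piFinset fun _ => Finset.range (N + 1), fun e _ he => ?_, ?_⟩
    · rw [Fintype.mem_piFinset]
      intro i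
      fin_cases i <;> simp <;> omega
    · simp
  · refine ⟨Fintype.piFinset fun _ => Finset.range (n / 3 + 1), fun e he => ⟨Set.mem_univ _, ?_⟩, ?_⟩
    · rw [Fintype.mem_piFinset] at he
      have h0 := Finset.mem_range.1 (he 0)
      have h1 := Finset.mem_range.1 (he 1)
      have h2 := Finset.mem_range.1 (he 2)
      omega
    · have h : (n : ℝ) ≤ 3 * ((n / 3 + 1 : ℕ) : ℝ) := by exact_mod_cast (by omega)
      have h' : (n : ℝ) ^ 3 ≤ (3 * ((n / 3 + 1 : ℕ) : ℝ)) ^ 3 := by gcongr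
      simp only [Fintype.card_piFinset, Finset.card_range, Finset.prod_const, Finset.card_univ,
        Fintype.card_fin]
      rw [mul_pow] at h'
      push_cast at h' ⊢
      linarith

theorem nicholsAlgebra_neg_one_of_ne (hb : b ≠ -p ^ 2) :
    nicholsIdeal (braiding (-1) (-p) b d k ℓ p q) = TwoSidedIdeal.span (relB k ℓ q) ∧
      IsMonomialBasis (braiding (-1) (-p) b d k ℓ p q) expB1 ∧
      gkDim 𝕜 (NicholsAlgebra (braiding (-1) (-p) b d k ℓ p q)) = (1 : ℕ) := by
  -- At most 2 * 2 * (N + 1) exponents occur, and the n + 1 powers of y 2 alone give the lower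
  -- bound.
  refine nicholsIdeal_eq_and_basis_and_gkDim (K := 4) (c := 1)
    (span_quad_spaceB k ℓ q ▸ isHopfIdeal_spaceB (-p) b d k ℓ p q rfl) (by simp [expB1])
    (fun I hI i e he => ?_) (fun h => ?_) 1 (by norm_num) (fun N => ?_) one_pos (fun n => ?_)
  · obtain ⟨h1, h2, h3, h4, h5⟩ := relations_relB hI
    exact mul_orderedMonomial_mem_expB1 h1 h2 h3 h4 h5 i e he
  · obtain ⟨h1, h2, -, h4, -⟩ := relations_relB h
    exact linearIndepOn_expB1 h4 h2 h1 hb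
  · refine ⟨Fintype.piFinset ![Finset.range 2, Finset.range 2, Finset.range (N + 1)],
      fun e hE he => ?_, ?_⟩
    · rw [Fintype.mem_piFinset]
      have := hE.1
      have := hE.2
      intro i
      fin_cases i <;> simp <;> omega
    · simp [Fin.prod_univ_three]
  · refine ⟨Fintype.piFinset ![{0}, {0}, Finset.range (n + 1)], fun e he => ?_, ?_⟩
    · rw [Fintype.mem_piFinset] at he
      have h0 : e 0 = 0 := by simpa using he 0
      have h1 : e 1 = 0 := by simpa using he 1
      have h2 : e 2 < n + 1 := by simpa using he 2
      exact ⟨⟨by omega, by omega⟩, by omega⟩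
    · simp [Fin.prod_univ_three]

theorem expB0_eq_piFinset :
    expB0 = (Fintype.piFinset fun _ : Fin 3 => Finset.range 2 : Finset (Fin 3 → ℕ)) := by
  ext e
  simp [expB0]

theorem nicholsAlgebra_neg_one_of_eq (hb : b = -p ^ 2) :
    nicholsIdeal (braiding (-1) (-p) b d k ℓ p q) = TwoSidedIdeal.span (relC k ℓ p q) ∧
      IsMonomialBasis (braiding (-1) (-p) b d k ℓ p q) expB0 ∧
      gkDim 𝕜 (NicholsAlgebra (braiding (-1) (-p) b d k ℓ p q)) = (0 : ℕ) := by
  refine nicholsIdeal_eq_and_basis_and_gkDim (K := 8) (c := 1)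
    (span_quad_spaceC k ℓ p q ▸ isHopfIdeal_spaceC (-p) b d k ℓ p q rfl hb) (by simp [expB0])
    (fun I hI i e he => ?_) (fun _ => linearIndepOn_expB0) 0 (by norm_num) (fun N => ?_) one_pos
    (fun n => ?_)
  · obtain ⟨h1, h2, h3, h4, h5⟩ := relations_relB fun s hs => hI s (Or.inl hs)
    exact mul_orderedMonomial_mem_expB0 h1 h2 h3 h4 h5 (relations_relC hI) i e he
  · refine ⟨Fintype.piFinset fun _ => Finset.range 2, fun e hE _ => ?_, by simp⟩
    rw [expB0_eq_piFinset] at hE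
    exact Finset.mem_coe.1 hE
  · exact ⟨{0}, by simp [expB0], by simp⟩

theorem finrank_of_isMonomialBasis_expB0 {r : Fin 3 → Fin 3 → Fin 3 → Fin 3 → 𝕜}
    (h : IsMonomialBasis r expB0) : Module.finrank 𝕜 (NicholsAlgebra r) = 8 := by
  obtain ⟨β, -⟩ := h
  rw [Module.finrank_eq_nat_card_basis β, expB0_eq_piFinset, Nat.card_coe_set_eq, Set.ncard_coe_finset]
  simp

end R17

end

theorem proposition3p13 {𝕜 : Type*} [Field 𝕜] [CharZero 𝕜] (t a b d k ℓ p q : 𝕜) :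
    (t = 1 → a = p - 2 * q →
      Nichols.nicholsIdeal (R17.braiding t a b d k ℓ p q) =
          TwoSidedIdeal.span (R17.relA d k q) ∧
        Nichols.IsMonomialBasis (R17.braiding t a b d k ℓ p q) Nichols.expB3 ∧
        gkDim 𝕜 (Nichols.NicholsAlgebra (R17.braiding t a b d k ℓ p q)) = 3) ∧
    (t = -1 → a = -p → b ≠ -p ^ 2 →
      Nichols.nicholsIdeal (R17.braiding t a b d k ℓ p q) =
          TwoSidedIdeal.span (R17.relB k ℓ q) ∧
        Nichols.IsMonomialBasis (R17.braiding t a b d k ℓ p q) Nichols.expB1 ∧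
        gkDim 𝕜 (Nichols.NicholsAlgebra (R17.braiding t a b d k ℓ p q)) = 1) ∧
    (t = -1 → a = -p → b = -p ^ 2 →
      Nichols.nicholsIdeal (R17.braiding t a b d k ℓ p q) =
          TwoSidedIdeal.span (R17.relC k ℓ p q) ∧
        Nichols.IsMonomialBasis (R17.braiding t a b d k ℓ p q) Nichols.expB0 ∧
        gkDim 𝕜 (Nichols.NicholsAlgebra (R17.braiding t a b d k ℓ p q)) = 0 ∧
        Module.finrank 𝕜 (Nichols.NicholsAlgebra (R17.braiding t a b d k ℓ p q)) = 8) := by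
  refine ⟨fun ht ha => ?_, fun ht ha hb => ?_, fun ht ha hb => ?_⟩
  · subst ht
    exact R17.nicholsAlgebra_one b d k ℓ p q ha
  · subst ht ha
    simpa using R17.nicholsAlgebra_neg_one_of_ne b d k ℓ p q hb
  · subst ht ha
    obtain ⟨h1, h2, h3⟩ := R17.nicholsAlgebra_neg_one_of_eq b d k ℓ p q hb
    exact ⟨h1, h2, by simpa using h3, R17.finrank_of_isMonomialBasis_expB0 h2⟩
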